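/- For $d\ge 1$ let $\mathrm{Sep}$ be the convex hull of $\{\rho\otimes\sigma\}$, with $\rho,\sigma$ density matrices on $\mathbb{C}^d$, and for a positive semidefinite $Q$ on $\mathbb{C}^d\otimes\mathbb{C}^d$ put $\mathrm{OptSep}(Q)=\max_{X\in\mathrm{Sep}}\mathrm{Tr}(Q^*X)$ (the maximum is attained). For $\delta>0$ consider the following algorithm. 1. Compute a spectral decomposition $Q=\sum_t\lambda_t|\Psi_t\rangle\langle\Psi_t|$ with $(\Psi_t)$ an orthonormal basis, and let $\Gamma=\{t:\lambda_t\ge\delta/2\}$. 2. Generate a finite $\varepsilon$-net $\mathcal N$ of the closed Euclidean unit ball of $\mathbb{C}^{\Gamma}$, consisting of points of the ball, where $\varepsilon=\delta/(4\|Q\|_F)$ and $\|\cdot\|_F$ is the Frobenius norm. (If $Q=0$, then $\Gamma=\emptyset$ and $\mathcal N=\{0\}$.) For each $\alpha\in\mathcal N$ compute $\phi_\alpha=\sum_{t\in\Gamma}\alpha_t^*\sqrt{\lambda_t}\,\Psi_t$ and its largest Schmidt coefficient $\mu_1(\phi_\alpha)$. 3. Return $\mathrm{OPT}=\max_{\alpha\in\mathcal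 N}\mu_1(\phi_\alpha)^2$. **Theorem.** (a) Correctness. For all $d\ge1$, all positive semidefinite $Q$ and all $\delta>0$ the algorithm has an output, and every output (whatever the choice of the spectral decomposition and of the net) satisfies $|\mathrm{OPT}-\mathrm{OptSep}(Q)|\le\delta$. (b) Running time. Consider the real RAM: a program is a fixed finite text acting on a memory of natural numbers and a memory of real numbers with indirect addressing; the operations $+,-,\times$ on natural numbers, the operations $+,-,\times,/,\sqrt{\ }$ and comparisons on real numbers, memory accesses, branches and assignments cost one step each; there is no rounding of reals to integers. For every fixed $k\in\mathbb{N}$ there are one program and a constant $C>0$ such that, for all $d\ge2$, all positive semidefinite $Q$ on $\mathbb{C}^d\otimes\mathbb{C}^d$ and all $\delta>0$, the program started on $(d,Q,\delta)$ halts after at most $$\exp\Big(C\big(\log d+\delta^{-2}\|Q\|_F^2\ln(\|Q\|_F/\delta)\big)\Big)$$ steps (the term $\delta^{-2}\|Q\|_F^2\ln(\|Q\|_F/\delta)$ is read as $0$ for $Q=0$). Its return value differs from $\mathrm{OptSep}(Q)$ by at most $\delta$, and is an output of the algorithm above in which the spectral decomposition and the numbers $\mu_1(\phi_\alpha)^2$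 are computed to precision $\eta=\delta\,2^{-d^k}$, that is, with $\|Q-\sum_t\lambda_t|\Psi_t\rangle\langle\Psi_t|\|_F\le\eta$ for an exactly orthonormal basis $(\Psi_t)$ and real $\lambda_t$, and each $\mu_1(\phi_\alpha)^2$ replaced by a number within $\eta$ of it. -/

import Mathlib

open scoped ComplexOrder Matrix

/-! ## Separable states and the optimum over them -/

/-- Density matrices: positive semidefinite with trace one. -/
def IsDensity {n : Type*} [Fintype n] (ρ : Matrix n n ℂ) : Prop :=
  ρ.PosSemidef ∧ ρ.trace = 1

/-- The separable density matrices over `ℂ^d ⊗ ℂ^d`: convex combinations of product states.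
The tensor product has the coordinates `Fin d × Fin d`. -/
def sepStates (d : ℕ) : Set (Matrix (Fin d × Fin d) (Fin d × Fin d) ℂ) :=
  convexHull ℝ {X | ∃ ρ σ : Matrix (Fin d) (Fin d) ℂ,
    IsDensity ρ ∧ IsDensity σ ∧ X = Matrix.kronecker ρ σ}

/-- The values `⟨Q, X⟩ = Tr (Q^* X)` over separable `X` (real numbers for Hermitian `Q`). -/
def sepValues {d : ℕ} (Q : Matrix (Fin d × Fin d) (Fin d × Fin d) ℂ) : Set ℝ :=
  (fun X => (Qᴴ * X).trace.re) '' sepStates d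

/-- `OptSep(Q)`. -/
noncomputable def optSep {d : ℕ} (Q : Matrix (Fin d × Fin d) (Fin d × Fin d) ℂ) : ℝ :=
  sSup (sepValues Q)

/-- The Frobenius norm. -/
noncomputable def frobNorm {n : Type*} [Fintype n] (Q : Matrix n n ℂ) : ℝ :=
  Real.sqrt (∑ i, ∑ j, ‖Q i j‖ ^ 2)

/-! ## The algorithm -/

/-- `N` is a (finite) `ε`-net of the closed unit ball of `E`, made of points of the ball. -/
def IsBallNet {E : Type*} [NormedAddCommGroup E] (N : Finset E) (ε : ℝ) : Prop :=
  (∀ y ∈ N, ‖y‖ ≤ 1) ∧ ∀ x : E, ‖x‖ ≤ 1 → ∃ y ∈ N, ‖x - y‖ ≤ ε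

/-- `φ = ∑ k, μ k • u k ⊗ v k` is a Schmidt decomposition of `φ`. -/
def IsSchmidtDecomposition {d : ℕ} (φ : EuclideanSpace ℂ (Fin d × Fin d)) (μ : Fin d → ℝ)
    (u v : OrthonormalBasis (Fin d) ℂ (EuclideanSpace ℂ (Fin d))) : Prop :=
  (∀ k, 0 ≤ μ k) ∧ ∀ i j, φ (i, j) = ∑ k, (μ k : ℂ) * u k i * v k j

/-- `m` is the largest coefficient of some Schmidt decomposition of `φ`. -/
def IsLargestSchmidtCoeff {d : ℕ} (φ : EuclideanSpace ℂ (Fin d × Fin d)) (m : ℝ) : Prop :=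
  ∃ μ u v, IsSchmidtDecomposition φ μ u v ∧ IsGreatest (Set.range μ) m

/-- `∑ t, lam t |Ψ t⟩⟨Ψ t|`. -/
noncomputable def spectralSum {d : ℕ}
    (Ψ : OrthonormalBasis (Fin d × Fin d) ℂ (EuclideanSpace ℂ (Fin d × Fin d)))
    (lam : Fin d × Fin d → ℝ) : Matrix (Fin d × Fin d) (Fin d × Fin d) ℂ :=
  Matrix.of fun x y => ∑ t, (lam t : ℂ) * Ψ t x * star (Ψ t y)

/-- `Γ`: the indices `t` with `lam t ≥ δ / 2`. -/
abbrev LargeIndex {d : ℕ} (lam : Fin d × Fin d → ℝ) (δ : ℝ) : Type :=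
  {t : Fin d × Fin d // δ / 2 ≤ lam t}

/-- `φ_α = ∑ t ∈ Γ, α_t^* √(lam t) |Ψ t⟩`. -/
noncomputable def phiVec {d : ℕ}
    (Ψ : OrthonormalBasis (Fin d × Fin d) ℂ (EuclideanSpace ℂ (Fin d × Fin d)))
    (lam : Fin d × Fin d → ℝ) (δ : ℝ) (α : EuclideanSpace ℂ (LargeIndex lam δ)) :
    EuclideanSpace ℂ (Fin d × Fin d) :=
  ∑ t : LargeIndex lam δ, (star (α t) * (Real.sqrt (lam t.1) : ℂ)) • Ψ t.1

/-- `opt` is a possible output of the algorithm on the input `Q`, `δ` when the spectral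
decomposition (in Frobenius norm) and the squares of the largest Schmidt coefficients are computed
up to an error of at most `η`; for `η = 0` all the linear algebra is exact. The steps are:
the spectral decomposition of `Q`; an `ε`-net of the unit ball of `ℂ^Γ`, `ε = δ / (4 ‖Q‖_F)`,
where `Γ` is the set of indices of the eigenvalues `≥ δ / 2`; for each point `α` of the net, the
largest Schmidt coefficient of `φ_α`; the maximum of the squares of these numbers. -/
def IsAlgorithmOutput {d : ℕ} (Q : Matrix (Fin d × Fin d) (Fin d × Fin d) ℂ) (δ η opt : ℝ) :
    Prop :=
  ∃ (Ψ : OrthonormalBasis (Fin d × Fin d) ℂ (EuclideanSpace ℂ (Fin d × Fin d)))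
    (lam : Fin d × Fin d → ℝ),
    frobNorm (Q - spectralSum Ψ lam) ≤ η ∧
    ∃ (N : Finset (EuclideanSpace ℂ (LargeIndex lam δ)))
      (s : EuclideanSpace ℂ (LargeIndex lam δ) → ℝ),
      IsBallNet N (δ / (4 * frobNorm Q)) ∧
      (∀ α ∈ N, ∃ m, IsLargestSchmidtCoeff (phiVec Ψ lam δ α) m ∧ |s α - m ^ 2| ≤ η) ∧
      IsGreatest (s '' (N : Set (EuclideanSpace ℂ (LargeIndex lam δ)))) opt

/-! ## The machine: a real RAM

A program is a fixed finite text, the same for all inputs. It works on two unbounded memories, one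
of natural numbers (counters and addresses) and one of real numbers, both with indirect
addressing. Each arithmetic operation (on reals: `+`, `-`, `*`, `/`, `√`), memory access,
comparison, branch and assignment costs one step. Its only constants are natural numbers, and
there is no rounding from the reals to the natural numbers. Division by `0` and the root of a
negative number return `0`. -/

/-- The memory of the machine. -/
structure RamState where
  nat : ℕ → ℕ
  real : ℕ → ℝ

/-- Expressions of natural number value; `get a` reads the natural number at address `a`. -/
inductive NatExpr where
  | const (c : ℕ)
  | get (a : NatExpr)
  | add (a b : NatExpr)
  | sub (a b : NatExpr)
  | mul (a b : NatExpr)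

/-- Expressions of real value; `get a` reads the real number at address `a`. -/
inductive RealExpr where
  | ofNat (a : NatExpr)
  | get (a : NatExpr)
  | add (x y : RealExpr)
  | sub (x y : RealExpr)
  | mul (x y : RealExpr)
  | div (x y : RealExpr)
  | sqrt (x : RealExpr)

/-- Tests. -/
inductive TestExpr where
  | natLt (a b : NatExpr)
  | realLt (x y : RealExpr)
  | not (b : TestExpr)
  | and (b c : TestExpr)

def NatExpr.eval (s : RamState) : NatExpr → ℕ
  | .const c => c
  | .get a => s.nat (a.eval s)
  | .add a b => a.eval s + b.eval s
  | .sub a b => a.eval s - b.eval s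
  | .mul a b => a.eval s * b.eval s

noncomputable def RealExpr.eval (s : RamState) : RealExpr → ℝ
  | .ofNat a => (a.eval s : ℝ)
  | .get a => s.real (a.eval s)
  | .add x y => x.eval s + y.eval s
  | .sub x y => x.eval s - y.eval s
  | .mul x y => x.eval s * y.eval s
  | .div x y => x.eval s / y.eval s
  | .sqrt x => Real.sqrt (x.eval s)

def TestExpr.holds (s : RamState) : TestExpr → Prop
  | .natLt a b => a.eval s < b.eval s
  | .realLt x y => x.eval s < y.eval s
  | .not b => ¬ b.holds s
  | .and b c => b.holds s ∧ c.holds s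

/-- The cost of an expression is the number of its nodes. -/
def NatExpr.cost : NatExpr → ℕ
  | .const _ => 1
  | .get a => a.cost + 1
  | .add a b => a.cost + b.cost + 1
  | .sub a b => a.cost + b.cost + 1
  | .mul a b => a.cost + b.cost + 1

def RealExpr.cost : RealExpr → ℕ
  | .ofNat a => a.cost + 1
  | .get a => a.cost + 1
  | .add x y => x.cost + y.cost + 1
  | .sub x y => x.cost + y.cost + 1
  | .mul x y => x.cost + y.cost + 1
  | .div x y => x.cost + y.cost + 1
  | .sqrt x => x.cost + 1

def TestExpr.cost : TestExpr → ℕ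
  | .natLt a b => a.cost + b.cost + 1
  | .realLt x y => x.cost + y.cost + 1
  | .not b => b.cost + 1
  | .and b c => b.cost + c.cost + 1

/-- Programs: `setNat a e` and `setReal a x` write to the address `a`; `loop b p` repeats `p`
while the test `b` holds. -/
inductive RamProgram where
  | skip
  | setNat (a e : NatExpr)
  | setReal (a : NatExpr) (x : RealExpr)
  | seq (p q : RamProgram)
  | ite (b : TestExpr) (p q : RamProgram)
  | loop (b : TestExpr) (p : RamProgram)

/-- `Exec p s T s'`: started in `s`, the program `p` halts after `T` steps in `s'`. -/
inductive Exec : RamProgram → RamState → ℕ → RamState → Prop where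
  | skip (s : RamState) : Exec .skip s 1 s
  | setNat (s : RamState) (a e : NatExpr) :
      Exec (.setNat a e) s (a.cost + e.cost + 1)
        { s with nat := Function.update s.nat (a.eval s) (e.eval s) }
  | setReal (s : RamState) (a : NatExpr) (x : RealExpr) :
      Exec (.setReal a x) s (a.cost + x.cost + 1)
        { s with real := Function.update s.real (a.eval s) (x.eval s) }
  | seq {p q : RamProgram} {s s₁ s₂ : RamState} {T₁ T₂ : ℕ} :
      Exec p s T₁ s₁ → Exec q s₁ T₂ s₂ → Exec (.seq p q) s (T₁ + T₂) s₂
  | iteTrue {b : TestExpr} {p q : RamProgram} {s s₁ : RamState} {T : ℕ} :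
      b.holds s → Exec p s T s₁ → Exec (.ite b p q) s (b.cost + 1 + T) s₁
  | iteFalse {b : TestExpr} {p q : RamProgram} {s s₁ : RamState} {T : ℕ} :
      ¬ b.holds s → Exec q s T s₁ → Exec (.ite b p q) s (b.cost + 1 + T) s₁
  | loopDone {b : TestExpr} {p : RamProgram} {s : RamState} :
      ¬ b.holds s → Exec (.loop b p) s (b.cost + 1) s
  | loopStep {b : TestExpr} {p : RamProgram} {s s₁ s₂ : RamState} {T₁ T₂ : ℕ} :
      b.holds s → Exec p s T₁ s₁ → Exec (.loop b p) s₁ T₂ s₂ →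
        Exec (.loop b p) s (b.cost + 1 + T₁ + T₂) s₂

/-- The initial memory on the input `d`, `δ`, `Q`. The natural number at address `0` is `d`; the
real number at address `0` is `δ`; the entries of `Q`, row by row (the pair `(i, j)` is the
coordinate number `i * d + j`), stand from the real address `1` on, entry number `p` with its real
part at `2 * p + 1` and its imaginary part at `2 * p + 2`. Everything else is `0`. -/
noncomputable def inputState {d : ℕ} (Q : Matrix (Fin d × Fin d) (Fin d × Fin d) ℂ) (δ : ℝ) :
    RamState where
  nat := fun a => if a = 0 then d else 0
  real := fun a =>
    if a = 0 then δ
    else if h : (a - 1) / 2 < (d * d) * (d * d) then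
      let rc := finProdFinEquiv.symm ⟨(a - 1) / 2, h⟩
      let z := Q (finProdFinEquiv.symm rc.1) (finProdFinEquiv.symm rc.2)
      if a % 2 = 1 then z.re else z.im
    else 0

/-! Correctness. The functional `Tr (Q^* X)` is linear and every density matrix is a mixture of pure
states, so `OptSep(Q)` is the maximum of `⟨w, Q w⟩ = ∑ λ_t |⟨Ψ_t, w⟩|²` over unit product vectors `w
= u ⊗ v`. The eigenvalues below `δ/2` contribute at most `δ/2` altogether. The remaining part is
`‖g_w‖²`, where `g_w ∈ ℂ^Γ` has the coordinates `√λ_t ⟨w, Ψ_t⟩`, and `‖g_w‖` is the maximum of `|⟨α,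
g_w⟩|` over the unit ball. Now `⟨α, g_w⟩ = ⟨w, φ_α⟩` (`inner_phiVec`), and the maximum of `|⟨w,
φ_α⟩|` over unit product vectors `w` is the largest Schmidt coefficient of `φ_α`. Exchanging the two
maxima therefore replaces the search over product vectors by a search over a ball of dimension
`|Γ|`. A net costs a factor `1 - 2ε`, that is, at most `2 ε ‖Q‖_F = δ/2`. `output_bounds` carries
out this estimate with inexact linear algebra, so that it serves both halves of the theorem.

Running time. The eigenvalues in `Γ` give `|Γ| (δ/2)² ≤ ‖Q‖_F²`. With `X = ⌈‖Q‖_F²/δ²⌉`, a grid with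
`64 X + 3` points on each of the `2|Γ|` real axes is fine enough (`mesh_bounds`), and its size is
the only exponential quantity. The rest is polynomial in `d`, `d^k` and `X`. The spectral
decomposition comes from Jacobi rotations, where `d^4` sweeps halve the squared off-diagonal norm
(`offSq_iterate_jacobiSweep`). The number `μ₁²` is approximated by the `2^p`-th root of the trace of
the `2^p`-th power of the reduced matrix, using only `p` squarings and `p` square roots
(`abs_traceRoot_sub_le`). As reals cannot be rounded, `X` is found by counting, and the grid points
are numbered and decoded by integer arithmetic.

The logarithm in the exponent may be negative, but `x² ln x ≥ -1/4`, so `log d` with `d ≥ 2` keeps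
the exponent positive and comparable to `log d` from below.

The program is written in a small array language with a total semantics `Code.den`. Its compiler to
the real RAM is verified once (`Code.raw_exec`), with a running time polynomial in the largest loop
length. After that, `main_correct` concerns mathematical functions only, and `exists_time_le` only
the size of the loop lengths. -/

open scoped ComplexOrder Matrix

/-! ## A structured language over complex arrays -/

/-- Natural number expressions: `env l` is a loop index or a parameter, `var m` a variable. -/
inductive IdxExpr where
  | const (c : ℕ)
  | env (l : ℕ)
  | var (m : ℕ)
  | add (a b : IdxExpr)
  | sub (a b : IdxExpr)
  | mul (a b : IdxExpr)

/-- Memory as seen by the structured language: natural variables, the read-only input, and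
two-dimensional complex arrays. -/
structure ArrState where
  nat : ℕ → ℕ
  inp : ℕ → ℝ
  arr : ℕ → ℕ → ℕ → ℂ

namespace IdxExpr

instance : Add IdxExpr := ⟨.add⟩
instance : Sub IdxExpr := ⟨.sub⟩
instance : Mul IdxExpr := ⟨.mul⟩
instance (n : ℕ) : OfNat IdxExpr n := ⟨.const n⟩

def eval (e : ℕ → ℕ) (σ : ArrState) : IdxExpr → ℕ
  | .const c => c
  | .env l => e l
  | .var m => σ.nat m
  | .add a b => a.eval e σ + b.eval e σ
  | .sub a b => a.eval e σ - b.eval e σ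
  | .mul a b => a.eval e σ * b.eval e σ

def wf (l : ℕ) : IdxExpr → Prop
  | .const _ => True
  | .env i => i < l
  | .var _ => True
  | .add a b => a.wf l ∧ b.wf l
  | .sub a b => a.wf l ∧ b.wf l
  | .mul a b => a.wf l ∧ b.wf l

/-- The natural memory is split modulo 3: `3 * l` holds the loop index of level `l`, `3 * l + 1` the
bound of that loop, and `3 * m + 2` the variable `m`. -/
def raw : IdxExpr → NatExpr
  | .const c => .const c
  | .env l => .get (.const (3 * l))
  | .var m => .get (.const (3 * m + 2))
  | .add a b => .add a.raw b.raw
  | .sub a b => .sub a.raw b.raw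
  | .mul a b => .mul a.raw b.raw

/-- `a ^ k` for a fixed exponent `k`. -/
def npow (a : IdxExpr) : ℕ → IdxExpr
  | 0 => 1
  | k + 1 => a.npow k * a

/-- `1` if `a = b`, else `0`. -/
def eqb (a b : IdxExpr) : IdxExpr := 1 - ((a - b) + (b - a))

section
variable (e : ℕ → ℕ) (σ : ArrState) (a b : IdxExpr) (l : ℕ)

@[simp] theorem eval_const (c : ℕ) : (IdxExpr.const c).eval e σ = c := rfl
@[simp] theorem eval_env (i : ℕ) : (IdxExpr.env i).eval e σ = e i := rfl
@[simp] theorem eval_var (i : ℕ) : (IdxExpr.var i).eval e σ = σ.nat i := rfl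
@[simp] theorem eval_ofNat (n : ℕ) : (no_index (OfNat.ofNat n) : IdxExpr).eval e σ = OfNat.ofNat n := rfl
@[simp] theorem eval_add : (a + b).eval e σ = a.eval e σ + b.eval e σ := rfl
@[simp] theorem eval_sub : (a - b).eval e σ = a.eval e σ - b.eval e σ := rfl
@[simp] theorem eval_mul : (a * b).eval e σ = a.eval e σ * b.eval e σ := rfl

@[simp] theorem wf_const (c : ℕ) : (IdxExpr.const c).wf l ↔ True := Iff.rfl
@[simp] theorem wf_env (i : ℕ) : (IdxExpr.env i).wf l ↔ i < l := Iff.rfl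
@[simp] theorem wf_var (i : ℕ) : (IdxExpr.var i).wf l ↔ True := Iff.rfl
@[simp] theorem wf_ofNat (n : ℕ) : (no_index (OfNat.ofNat n) : IdxExpr).wf l ↔ True := Iff.rfl
@[simp] theorem wf_add : (a + b).wf l ↔ a.wf l ∧ b.wf l := Iff.rfl
@[simp] theorem wf_sub : (a - b).wf l ↔ a.wf l ∧ b.wf l := Iff.rfl
@[simp] theorem wf_mul : (a * b).wf l ↔ a.wf l ∧ b.wf l := Iff.rfl

@[simp] theorem eval_npow (k : ℕ) : (a.npow k).eval e σ = a.eval e σ ^ k := by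
  induction k with
  | zero => rfl
  | succ k ih => simp [npow, ih, pow_succ]

theorem wf_npow (k : ℕ) (h : a.wf l) : (a.npow k).wf l := by
  induction k with
  | zero => simp [npow]
  | succ k ih => simp [npow, ih, h]

@[simp] theorem eval_eqb : (eqb a b).eval e σ = if a.eval e σ = b.eval e σ then 1 else 0 := by
  simp only [eqb, eval_sub, eval_add, eval_ofNat]
  split_ifs <;> omega

@[simp] theorem wf_eqb : (eqb a b).wf l ↔ a.wf l ∧ b.wf l := by
  simp [eqb]; tauto

end
end IdxExpr

/-- The first real address that does not belong to the input. -/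
def inputEnd (d : ℕ) : ℕ := 2 * ((d * d) * (d * d)) + 1

/-- `a` if `a` is an input address, else `0`. -/
def clipAddr (d a : ℕ) : ℕ := a * (1 - (a + 1 - inputEnd d))

/-- Clipping makes every `inp` read land in the input, so its value never depends on how the arrays
are placed behind it. -/
theorem clipAddr_lt (d a : ℕ) : clipAddr d a < inputEnd d := by
  unfold clipAddr
  rcases Nat.lt_or_ge a (inputEnd d) with h | h
  · have : a + 1 - inputEnd d = 0 := by omega
    simpa [this] using h
  · have : 1 - (a + 1 - inputEnd d) = 0 := by omega
    rw [this, mul_zero]; exact Nat.succ_pos _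

theorem clipAddr_of_lt {d a : ℕ} (h : a < inputEnd d) : clipAddr d a = a := by
  have : a + 1 - inputEnd d = 0 := by omega
  simp [clipAddr, this]

/-- An injective polynomial pairing. -/
def pairCode (a b : ℕ) : ℕ := (a + b) * (a + b) + a

/-- The code lies in the interval from `(a + b)²` to `(a + b + 1)² - 1`, which determines `a + b`.
-/
theorem pairCode_inj {a b a' b' : ℕ} (h : pairCode a b = pairCode a' b') : a = a' ∧ b = b' := by
  unfold pairCode at h
  have h1 : a + b = a' + b' := by
    rcases lt_trichotomy (a + b) (a' + b') with h2 | h2 | h2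
    · exfalso; nlinarith
    · exact h2
    · exfalso; nlinarith
  rw [h1] at h
  omega

/-- The real address of the cell `(i, j)` of the array `c`. -/
def cellAddr (d c i j : ℕ) : ℕ := inputEnd d + 3 * pairCode (pairCode i j) c

theorem pairCode_ne {c i j c' i' j' : ℕ} (h : ¬ (c = c' ∧ i = i' ∧ j = j')) :
    pairCode (pairCode i j) c ≠ pairCode (pairCode i' j') c' := by
  intro h'
  obtain ⟨h1, h2⟩ := pairCode_inj h'
  obtain ⟨h3, h4⟩ := pairCode_inj h1
  exact h ⟨h2, h3, h4⟩

/-- Complex expressions; `rdiv` and `rsqrt` act on real parts. -/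
inductive CellExpr where
  | nat (a : IdxExpr)
  | inp (a : IdxExpr)
  | get (c : ℕ) (i j : IdxExpr)
  | I
  | add (x y : CellExpr)
  | sub (x y : CellExpr)
  | mul (x y : CellExpr)
  | conj (x : CellExpr)
  | rdiv (x y : CellExpr)
  | rsqrt (x : CellExpr)

namespace CellExpr

instance : Add CellExpr := ⟨.add⟩
instance : Sub CellExpr := ⟨.sub⟩
instance : Mul CellExpr := ⟨.mul⟩
instance (n : ℕ) : OfNat CellExpr n := ⟨.nat (.const n)⟩

noncomputable def eval (e : ℕ → ℕ) (σ : ArrState) : CellExpr → ℂ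
  | .nat a => (a.eval e σ : ℂ)
  | .inp a => (σ.inp (clipAddr (e 0) (a.eval e σ)) : ℂ)
  | .get c i j => σ.arr c (i.eval e σ) (j.eval e σ)
  | .I => Complex.I
  | .add x y => x.eval e σ + y.eval e σ
  | .sub x y => x.eval e σ - y.eval e σ
  | .mul x y => x.eval e σ * y.eval e σ
  | .conj x => star (x.eval e σ)
  | .rdiv x y => (((x.eval e σ).re / (y.eval e σ).re : ℝ) : ℂ)
  | .rsqrt x => ((Real.sqrt (x.eval e σ).re : ℝ) : ℂ)

def wf (l : ℕ) : CellExpr → Prop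
  | .nat a => a.wf l
  | .inp a => a.wf l
  | .get _ i j => i.wf l ∧ j.wf l
  | .I => True
  | .add x y => x.wf l ∧ y.wf l
  | .sub x y => x.wf l ∧ y.wf l
  | .mul x y => x.wf l ∧ y.wf l
  | .conj x => x.wf l
  | .rdiv x y => x.wf l ∧ y.wf l
  | .rsqrt x => x.wf l

section
variable (e : ℕ → ℕ) (σ : ArrState) (x y : CellExpr) (l : ℕ)

@[simp] theorem eval_nat (a : IdxExpr) : (nat a).eval e σ = (a.eval e σ : ℂ) := rfl
@[simp] theorem eval_inp (a : IdxExpr) :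
    (inp a).eval e σ = (σ.inp (clipAddr (e 0) (a.eval e σ)) : ℂ) := rfl
@[simp] theorem eval_get (c : ℕ) (i j : IdxExpr) :
    (get c i j).eval e σ = σ.arr c (i.eval e σ) (j.eval e σ) := rfl
@[simp] theorem eval_I : I.eval e σ = Complex.I := rfl
@[simp] theorem eval_ofNat (n : ℕ) :
    (no_index (OfNat.ofNat n) : CellExpr).eval e σ = ((OfNat.ofNat n : ℕ) : ℂ) := rfl
@[simp] theorem eval_add : (x + y).eval e σ = x.eval e σ + y.eval e σ := rfl
@[simp] theorem eval_sub : (x - y).eval e σ = x.eval e σ - y.eval e σ := rfl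
@[simp] theorem eval_mul : (x * y).eval e σ = x.eval e σ * y.eval e σ := rfl
@[simp] theorem eval_conj : (conj x).eval e σ = star (x.eval e σ) := rfl
@[simp] theorem eval_rdiv :
    (rdiv x y).eval e σ = (((x.eval e σ).re / (y.eval e σ).re : ℝ) : ℂ) := rfl
@[simp] theorem eval_rsqrt : (rsqrt x).eval e σ = ((Real.sqrt (x.eval e σ).re : ℝ) : ℂ) := rfl

@[simp] theorem wf_nat (a : IdxExpr) : (nat a).wf l ↔ a.wf l := Iff.rfl
@[simp] theorem wf_inp (a : IdxExpr) : (inp a).wf l ↔ a.wf l := Iff.rfl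
@[simp] theorem wf_get (c : ℕ) (i j : IdxExpr) : (get c i j).wf l ↔ i.wf l ∧ j.wf l := Iff.rfl
@[simp] theorem wf_I : I.wf l ↔ True := Iff.rfl
@[simp] theorem wf_ofNat (n : ℕ) : (no_index (OfNat.ofNat n) : CellExpr).wf l ↔ True := Iff.rfl
@[simp] theorem wf_add : (x + y).wf l ↔ x.wf l ∧ y.wf l := Iff.rfl
@[simp] theorem wf_sub : (x - y).wf l ↔ x.wf l ∧ y.wf l := Iff.rfl
@[simp] theorem wf_mul : (x * y).wf l ↔ x.wf l ∧ y.wf l := Iff.rfl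
@[simp] theorem wf_conj : (conj x).wf l ↔ x.wf l := Iff.rfl
@[simp] theorem wf_rdiv : (rdiv x y).wf l ↔ x.wf l ∧ y.wf l := Iff.rfl
@[simp] theorem wf_rsqrt : (rsqrt x).wf l ↔ x.wf l := Iff.rfl

end
end CellExpr

/-- Tests; `reLt` compares real parts. -/
inductive Guard where
  | natLt (a b : IdxExpr)
  | reLt (x y : CellExpr)
  | not (b : Guard)
  | and (b c : Guard)

namespace Guard

@[simp] def holds (e : ℕ → ℕ) (σ : ArrState) : Guard → Prop
  | .natLt a b => a.eval e σ < b.eval e σ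
  | .reLt x y => (x.eval e σ).re < (y.eval e σ).re
  | .not b => ¬ b.holds e σ
  | .and b c => b.holds e σ ∧ c.holds e σ

@[simp] def wf (l : ℕ) : Guard → Prop
  | .natLt a b => a.wf l ∧ b.wf l
  | .reLt x y => x.wf l ∧ y.wf l
  | .not b => b.wf l
  | .and b c => b.wf l ∧ c.wf l

end Guard

/-- Programs of the structured language; `loop l N p` runs `p` with `env l = 0, …, N - 1`. -/
inductive Code where
  | skip
  | setVar (m : ℕ) (a : IdxExpr)
  | store (c : ℕ) (i j : IdxExpr) (x : CellExpr)
  | seq (p q : Code)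
  | ite (b : Guard) (p q : Code)
  | loop (l : ℕ) (N : IdxExpr) (p : Code)

infixr:60 " ;; " => Code.seq

/-- `f (n - 1) ∘ ⋯ ∘ f 0`. -/
def iterIdx {α : Type*} (f : ℕ → α → α) : ℕ → α → α
  | 0, s => s
  | n + 1, s => f n (iterIdx f n s)

@[simp] theorem iterIdx_zero {α : Type*} (f : ℕ → α → α) (s : α) : iterIdx f 0 s = s := rfl
theorem iterIdx_succ {α : Type*} (f : ℕ → α → α) (n : ℕ) (s : α) :
    iterIdx f (n + 1) s = f n (iterIdx f n s) := rfl

namespace ArrState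

/-- Replace the array `c`. -/
def setArr (σ : ArrState) (c : ℕ) (a : ℕ → ℕ → ℂ) : ArrState :=
  { σ with arr := Function.update σ.arr c a }

/-- Replace the variable `m`. -/
def setNat (σ : ArrState) (m v : ℕ) : ArrState :=
  { σ with nat := Function.update σ.nat m v }

section
variable (σ : ArrState) (c c' m m' v : ℕ) (a b : ℕ → ℕ → ℂ)

@[simp] theorem setArr_nat : (σ.setArr c a).nat = σ.nat := rfl
@[simp] theorem setArr_inp : (σ.setArr c a).inp = σ.inp := rfl
@[simp] theorem setArr_same : (σ.setArr c a).arr c = a := by simp [setArr]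
@[simp] theorem setArr_arr :
    (σ.setArr c a).arr c' = if c' = c then a else σ.arr c' := by
  simp [setArr, Function.update_apply]
@[simp] theorem setArr_setArr : (σ.setArr c a).setArr c b = σ.setArr c b := by simp [setArr]
@[simp] theorem setArr_self : σ.setArr c (σ.arr c) = σ := by simp [setArr]
@[simp] theorem setNat_arr : (σ.setNat m v).arr = σ.arr := rfl
@[simp] theorem setNat_inp : (σ.setNat m v).inp = σ.inp := rfl
@[simp] theorem setNat_nat :
    (σ.setNat m v).nat m' = if m' = m then v else σ.nat m' := by
  simp [setNat, Function.update_apply]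

end
end ArrState

namespace Code

open Classical in
/-- The effect of a program. -/
noncomputable def den (e : ℕ → ℕ) : Code → ArrState → ArrState
  | .skip, σ => σ
  | .setVar m a, σ => σ.setNat m (a.eval e σ)
  | .store c i j x, σ => σ.setArr c (fun i' j' =>
      if i' = i.eval e σ ∧ j' = j.eval e σ then x.eval e σ else σ.arr c i' j')
  | .seq p q, σ => q.den e (p.den e σ)
  | .ite b p q, σ => if b.holds e σ then p.den e σ else q.den e σ
  | .loop l N p, σ => iterIdx (fun i s => p.den (Function.update e l i) s) (N.eval e σ) σ

/-- At depth `l` only the levels below `l` are read. -/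
@[simp] def wf (l : ℕ) : Code → Prop
  | .skip => True
  | .setVar _ a => a.wf l
  | .store _ i j x => i.wf l ∧ j.wf l ∧ x.wf l
  | .seq p q => p.wf l ∧ q.wf l
  | .ite b p q => b.wf l ∧ p.wf l ∧ q.wf l
  | .loop l' N p => l' = l ∧ N.wf l ∧ p.wf (l + 1)

/-- No loop runs more than `L` times. -/
@[simp] def bdd (L : ℕ) (e : ℕ → ℕ) : Code → Prop
  | .skip => True
  | .setVar _ _ => True
  | .store _ _ _ _ => True
  | .seq p q => p.bdd L e ∧ q.bdd L e
  | .ite _ p q => p.bdd L e ∧ q.bdd L e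
  -- The bound is demanded in all states, so loop lengths should depend on levels and not on
  -- variables; this is why the number of grid points will be passed as a level.
  | .loop l N p => (∀ σ, N.eval e σ ≤ L) ∧ ∀ i, p.bdd L (Function.update e l i)

end Code

/-! ## Compilation to the real RAM -/

/-- `rs` represents the state `σ` and the first `l` entries of `e`. -/
structure Represents (l : ℕ) (e : ℕ → ℕ) (σ : ArrState) (rs : RamState) : Prop where
  env : ∀ i < l, rs.nat (3 * i) = e i
  var : ∀ m, rs.nat (3 * m + 2) = σ.nat m
  inp : ∀ a < inputEnd (e 0), rs.real a = σ.inp a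
  re : ∀ c i j, rs.real (cellAddr (e 0) c i j) = (σ.arr c i j).re
  im : ∀ c i j, rs.real (cellAddr (e 0) c i j + 1) = (σ.arr c i j).im

def rawInputEnd : NatExpr :=
  let d : NatExpr := .get (.const 0)
  .add (.mul (.const 2) (.mul (.mul d d) (.mul d d))) (.const 1)

def rawClip (a : NatExpr) : NatExpr :=
  .mul a (.sub (.const 1) (.sub (.add a (.const 1)) rawInputEnd))

def rawPair (a b : NatExpr) : NatExpr := .add (.mul (.add a b) (.add a b)) a

def rawCell (c i j : NatExpr) : NatExpr :=
  .add rawInputEnd (.mul (.const 3) (rawPair (rawPair i j) c))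

/-- The real and the imaginary part of an expression. -/
def CellExpr.raw : CellExpr → RealExpr × RealExpr
  | .nat a => (.ofNat a.raw, .ofNat (.const 0))
  | .inp a => (.get (rawClip a.raw), .ofNat (.const 0))
  | .get c i j =>
    (.get (rawCell (.const c) i.raw j.raw),
      .get (.add (rawCell (.const c) i.raw j.raw) (.const 1)))
  | .I => (.ofNat (.const 0), .ofNat (.const 1))
  | .add x y => (.add x.raw.1 y.raw.1, .add x.raw.2 y.raw.2)
  | .sub x y => (.sub x.raw.1 y.raw.1, .sub x.raw.2 y.raw.2)
  | .mul x y =>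
    (.sub (.mul x.raw.1 y.raw.1) (.mul x.raw.2 y.raw.2),
      .add (.mul x.raw.1 y.raw.2) (.mul x.raw.2 y.raw.1))
  | .conj x => (x.raw.1, .sub (.ofNat (.const 0)) x.raw.2)
  | .rdiv x y => (.div x.raw.1 y.raw.1, .ofNat (.const 0))
  | .rsqrt x => (.sqrt x.raw.1, .ofNat (.const 0))

def Guard.raw : Guard → TestExpr
  | .natLt a b => .natLt a.raw b.raw
  | .reLt x y => .realLt x.raw.1 y.raw.1
  | .not b => .not b.raw
  | .and b c => .and b.raw c.raw

/-- The right-hand side of a store may read the very cell that is overwritten. Its imaginary part is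
therefore parked in the third address of the cell, which no expression reads, until the real part
has been written. -/
def Code.raw : Code → RamProgram
  | .skip => .skip
  | .setVar m a => .setNat (.const (3 * m + 2)) a.raw
  | .store c i j x =>
    let t := rawCell (.const c) i.raw j.raw
    .seq (.setReal (.add t (.const 2)) x.raw.2)
      (.seq (.setReal t x.raw.1) (.setReal (.add t (.const 1)) (.get (.add t (.const 2)))))
  | .seq p q => .seq p.raw q.raw
  | .ite b p q => .ite b.raw p.raw q.raw
  | .loop l N p =>
    .seq (.setNat (.const (3 * l)) (.const 0))
      (.seq (.setNat (.const (3 * l + 1)) N.raw)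
        (.loop (.natLt (.get (.const (3 * l))) (.get (.const (3 * l + 1))))
          (.seq p.raw (.setNat (.const (3 * l)) (.add (.get (.const (3 * l))) (.const 1))))))

/-- A bound for the running time when no loop runs more than `L` times. -/
def Code.time (L : ℕ) : Code → ℕ
  | .skip => 1
  | .setVar _ a => a.raw.cost + 2
  | .store c i j x =>
    3 * (rawCell (.const c) i.raw j.raw).cost + x.raw.1.cost + x.raw.2.cost +
      (rawCell (.const c) i.raw j.raw).cost + 12
  | .seq p q => p.time L + q.time L
  | .ite b p q => b.raw.cost + 1 + p.time L + q.time L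
  | .loop _ N p => N.raw.cost + 11 + L * (p.time L + 12)

/-- The text is fixed, so only the nesting of its loops matters: each loop raises the degree by one.
-/
theorem Code.time_le (p : Code) : ∃ A D : ℕ, ∀ L, p.time L ≤ A * (L + 1) ^ D := by
  induction p with
  | skip => exact ⟨1, 0, fun L => by simp [time]⟩
  | setVar m a => exact ⟨_, 0, fun L => by simp only [time, pow_zero, mul_one]; exact le_rfl⟩
  | store c i j x => exact ⟨_, 0, fun L => by simp only [time, pow_zero, mul_one]; exact le_rfl⟩
  | seq p q hp hq =>
    obtain ⟨A, D, h⟩ := hp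
    obtain ⟨A', D', h'⟩ := hq
    refine ⟨A + A', max D D', fun L => ?_⟩
    have h1 : (L + 1) ^ D ≤ (L + 1) ^ max D D' := Nat.pow_le_pow_right (by omega) (le_max_left _ _)
    have h2 : (L + 1) ^ D' ≤ (L + 1) ^ max D D' :=
      Nat.pow_le_pow_right (by omega) (le_max_right _ _)
    calc _ ≤ A * (L + 1) ^ D + A' * (L + 1) ^ D' := add_le_add (h L) (h' L)
      _ ≤ _ := by rw [add_mul]; gcongr
  | ite b p q hp hq =>
    obtain ⟨A, D, h⟩ := hp
    obtain ⟨A', D', h'⟩ := hq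
    refine ⟨b.raw.cost + 1 + A + A', max D D', fun L => ?_⟩
    have h1 : (L + 1) ^ D ≤ (L + 1) ^ max D D' := Nat.pow_le_pow_right (by omega) (le_max_left _ _)
    have h2 : (L + 1) ^ D' ≤ (L + 1) ^ max D D' :=
      Nat.pow_le_pow_right (by omega) (le_max_right _ _)
    have h3 : b.raw.cost + 1 ≤ (b.raw.cost + 1) * (L + 1) ^ max D D' :=
      Nat.le_mul_of_pos_right _ (by positivity)
    calc _ ≤ (b.raw.cost + 1) * (L + 1) ^ max D D' + A * (L + 1) ^ D + A' * (L + 1) ^ D' :=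
          add_le_add (add_le_add h3 (h L)) (h' L)
      _ ≤ _ := by
        rw [add_mul (b.raw.cost + 1 + A), add_mul (b.raw.cost + 1)]; gcongr
  | loop l N p hp =>
    obtain ⟨A, D, h⟩ := hp
    refine ⟨N.raw.cost + 11 + A + 12, D + 1, fun L => ?_⟩
    have h3 : 1 ≤ (L + 1) ^ D := Nat.one_le_pow _ _ (by omega)
    have h4 := h L
    simp only [time, pow_succ]
    have h5 : L * (p.time L + 12) ≤ (L + 1) * ((A + 12) * (L + 1) ^ D) := by
      apply Nat.mul_le_mul (by omega); nlinarith
    have h6 : N.raw.cost + 11 ≤ (N.raw.cost + 11) * ((L + 1) ^ D * (L + 1)) :=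
      Nat.le_mul_of_pos_right _ (by positivity)
    nlinarith

section
variable {l : ℕ} {e : ℕ → ℕ} {σ : ArrState} {rs : RamState}

theorem IdxExpr.raw_eval (h : Represents l e σ rs) (a : IdxExpr) (ha : a.wf l) :
    a.raw.eval rs = a.eval e σ := by
  induction a with
  | const c => rfl
  | env i => exact h.env i ha
  | var m => exact h.var m
  | add a b iha ihb => simp [raw, NatExpr.eval, eval, iha ha.1, ihb ha.2]
  | sub a b iha ihb => simp [raw, NatExpr.eval, eval, iha ha.1, ihb ha.2]
  | mul a b iha ihb => simp [raw, NatExpr.eval, eval, iha ha.1, ihb ha.2]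

theorem rawInputEnd_eval (h : Represents l e σ rs) (hl : 1 ≤ l) :
    rawInputEnd.eval rs = inputEnd (e 0) := by
  have := h.env 0 hl
  simp only [mul_zero] at this
  simp [rawInputEnd, NatExpr.eval, inputEnd, this]

theorem rawCell_eval (h : Represents l e σ rs) (hl : 1 ≤ l) (c i j : NatExpr) :
    (rawCell c i j).eval rs = cellAddr (e 0) (c.eval rs) (i.eval rs) (j.eval rs) := by
  simp [rawCell, rawPair, cellAddr, pairCode, NatExpr.eval, rawInputEnd_eval h hl]

theorem CellExpr.raw_eval (h : Represents l e σ rs) (hl : 1 ≤ l) (x : CellExpr) (hx : x.wf l) :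
    x.raw.1.eval rs = (x.eval e σ).re ∧ x.raw.2.eval rs = (x.eval e σ).im := by
  induction x with
  | nat a => simp [raw, eval, RealExpr.eval, NatExpr.eval, IdxExpr.raw_eval h a hx]
  | inp a =>
    have h1 := h.inp _ (clipAddr_lt (e 0) (a.eval e σ))
    simp only [clipAddr] at h1
    simp [raw, eval, RealExpr.eval, NatExpr.eval, IdxExpr.raw_eval h a hx, rawClip,
      rawInputEnd_eval h hl, h1, clipAddr]
  | get c i j =>
    simp [raw, eval, RealExpr.eval, NatExpr.eval, rawCell_eval h hl, IdxExpr.raw_eval h i hx.1,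
      IdxExpr.raw_eval h j hx.2, h.re, h.im]
  | I => simp [raw, eval, RealExpr.eval, NatExpr.eval]
  | add x y ihx ihy => simp [raw, eval, RealExpr.eval, ihx hx.1, ihy hx.2]
  | sub x y ihx ihy => simp [raw, eval, RealExpr.eval, ihx hx.1, ihy hx.2]
  | mul x y ihx ihy => simp [raw, eval, RealExpr.eval, ihx hx.1, ihy hx.2]
  | conj x ihx => simp [raw, eval, RealExpr.eval, NatExpr.eval, ihx hx]
  | rdiv x y ihx ihy => simp [raw, eval, RealExpr.eval, NatExpr.eval, ihx hx.1, ihy hx.2,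
      -Complex.ofReal_div]
  | rsqrt x ihx => simp [raw, eval, RealExpr.eval, NatExpr.eval, ihx hx]

theorem Guard.raw_holds (h : Represents l e σ rs) (hl : 1 ≤ l) (b : Guard) (hb : b.wf l) :
    b.raw.holds rs ↔ b.holds e σ := by
  induction b with
  | natLt a b => simp [raw, holds, TestExpr.holds, IdxExpr.raw_eval h a hb.1,
      IdxExpr.raw_eval h b hb.2]
  | reLt x y => simp [raw, holds, TestExpr.holds, (CellExpr.raw_eval h hl x hb.1).1,
      (CellExpr.raw_eval h hl y hb.2).1]
  | not b ih => simp [raw, holds, TestExpr.holds, ih hb]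
  | and b c ihb ihc => simp [raw, holds, TestExpr.holds, ihb hb.1, ihc hb.2]

theorem Represents.update_nat (h : Represents l e σ rs) {a v : ℕ} (h1 : ∀ i < l, a ≠ 3 * i)
    (h2 : ∀ m, a ≠ 3 * m + 2) :
    Represents l e σ { rs with nat := Function.update rs.nat a v } where
  env i hi := by
    rw [← h.env i hi]; exact Function.update_of_ne (h1 i hi).symm _ _
  var m := by
    rw [← h.var m]; exact Function.update_of_ne (h2 m).symm _ _
  inp := h.inp
  re := h.re
  im := h.im

theorem Represents.succ (h : Represents l e σ rs) (hl : 1 ≤ l) {v : ℕ} (hv : rs.nat (3 * l) = v) :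
    Represents (l + 1) (Function.update e l v) σ rs := by
  have h0 : Function.update e l v 0 = e 0 := Function.update_of_ne (by omega) _ _
  refine ⟨fun i hi => ?_, h.var, ?_, ?_, ?_⟩
  · rcases Nat.lt_succ_iff_lt_or_eq.1 hi with h1 | h1
    · rw [Function.update_of_ne (by omega)]; exact h.env i h1
    · subst h1; simp [hv]
  · rw [h0]; exact h.inp
  · rw [h0]; exact h.re
  · rw [h0]; exact h.im

theorem Represents.of_succ {v : ℕ} (h : Represents (l + 1) (Function.update e l v) σ rs)
    (hl : 1 ≤ l) : Represents l e σ rs := by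
  have h0 : Function.update e l v 0 = e 0 := Function.update_of_ne (by omega) _ _
  refine ⟨fun i hi => ?_, h.var, ?_, ?_, ?_⟩
  · rw [h.env i (by omega), Function.update_of_ne (by omega)]
  · rw [← h0]; exact h.inp
  · rw [← h0]; exact h.re
  · rw [← h0]; exact h.im

theorem Represents.setNat (h : Represents l e σ rs) (m v : ℕ) :
    Represents l e (σ.setNat m v) { rs with nat := Function.update rs.nat (3 * m + 2) v } where
  env i hi := by
    rw [← h.env i hi]; exact Function.update_of_ne (by omega) _ _
  var m' := by
    by_cases hm : m' = m
    · subst hm; simp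
    · simp only [ArrState.setNat_nat, hm, if_false, ← h.var m']
      exact Function.update_of_ne (by omega) _ _
  inp := h.inp
  re := h.re
  im := h.im

theorem Represents.setCell (h : Represents l e σ rs) (c i j : ℕ) (z : ℂ) :
    Represents l e (σ.setArr c fun i' j' => if i' = i ∧ j' = j then z else σ.arr c i' j')
      { rs with real :=
        Function.update (Function.update (Function.update rs.real (cellAddr (e 0) c i j + 2) z.im)
          (cellAddr (e 0) c i j) z.re) (cellAddr (e 0) c i j + 1) z.im } where
  env := h.env
  var := h.var
  inp a ha := by
    rw [ArrState.setArr_inp, ← h.inp a ha]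
    simp only [cellAddr]
    rw [Function.update_of_ne (by omega), Function.update_of_ne (by omega),
      Function.update_of_ne (by omega)]
  re c' i' j' := by
    by_cases hc : c' = c ∧ i' = i ∧ j' = j
    · obtain ⟨rfl, rfl, rfl⟩ := hc
      simp
    · have := pairCode_ne hc
      have h2 : (((σ.setArr c fun i' j' => if i' = i ∧ j' = j then z else σ.arr c i' j').arr
          c' i' j')) = σ.arr c' i' j' := by
        by_cases h3 : c' = c
        · subst h3
          have : ¬ (i' = i ∧ j' = j) := fun h4 => hc ⟨rfl, h4⟩
          simp [this]
        · simp [h3]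
      rw [h2, ← h.re]
      simp only [cellAddr]
      rw [Function.update_of_ne (by omega), Function.update_of_ne (by omega),
        Function.update_of_ne (by omega)]
  im c' i' j' := by
    by_cases hc : c' = c ∧ i' = i ∧ j' = j
    · obtain ⟨rfl, rfl, rfl⟩ := hc
      simp
    · have := pairCode_ne hc
      have h2 : (((σ.setArr c fun i' j' => if i' = i ∧ j' = j then z else σ.arr c i' j').arr
          c' i' j')) = σ.arr c' i' j' := by
        by_cases h3 : c' = c
        · subst h3
          have : ¬ (i' = i ∧ j' = j) := fun h4 => hc ⟨rfl, h4⟩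
          simp [this]
        · simp [h3]
      rw [h2, ← h.im]
      simp only [cellAddr]
      rw [Function.update_of_ne (by omega), Function.update_of_ne (by omega),
        Function.update_of_ne (by omega)]

end

/-- The compiled program computes `den` within the time bound. -/
theorem Code.raw_exec (p : Code) : ∀ (l : ℕ) (e : ℕ → ℕ) (σ : ArrState) (rs : RamState) (L : ℕ),
    1 ≤ l → p.wf l → p.bdd L e → Represents l e σ rs →
    ∃ T rs', Exec p.raw rs T rs' ∧ T ≤ p.time L ∧ Represents l e (p.den e σ) rs' ∧
      ∀ i < l, rs'.nat (3 * i + 1) = rs.nat (3 * i + 1) := by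
  induction p with
  | skip =>
    intro l e σ rs L _ _ _ h
    exact ⟨_, _, Exec.skip rs, le_rfl, h, fun _ _ => rfl⟩
  | setVar m a =>
    intro l e σ rs L hl hw hb h
    refine ⟨_, _, Exec.setNat rs _ _, ?_, ?_, ?_⟩
    · simp only [time, NatExpr.cost]; omega
    · rw [IdxExpr.raw_eval h a hw]
      exact h.setNat m _
    · intro i hi
      exact Function.update_of_ne (by simp only [NatExpr.eval]; omega) _ _
  | store c i j x =>
    intro l e σ rs L hl hw hb h
    obtain ⟨hi, hj, hx⟩ := hw
    -- Addresses are computed from the natural memory alone, so the three real assignments see the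
    -- same target cell.
    have key : ∀ r : ℕ → ℝ, (rawCell (.const c) i.raw j.raw).eval { rs with real := r }
        = cellAddr (e 0) c (i.eval e σ) (j.eval e σ) := by
      intro r
      have h1 : ∀ a : NatExpr, a.eval { rs with real := r } = a.eval rs := by
        intro a
        induction a with
        | const c => rfl
        | get a ih => simp [NatExpr.eval, ih]
        | add a b iha ihb => simp [NatExpr.eval, iha, ihb]
        | sub a b iha ihb => simp [NatExpr.eval, iha, ihb]
        | mul a b iha ihb => simp [NatExpr.eval, iha, ihb]
      rw [h1, rawCell_eval h hl, IdxExpr.raw_eval h i hi, IdxExpr.raw_eval h j hj]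
      rfl
    obtain ⟨hre, him⟩ := CellExpr.raw_eval h hl x hx
    have key0 := key rs.real
    have hre' : ∀ v, x.raw.1.eval
        { rs with real :=
          Function.update rs.real (cellAddr (e 0) c (i.eval e σ) (j.eval e σ) + 2) v } = (x.eval e σ).re := by
      intro v
      have h' : Represents l e σ
          { rs with real :=
            Function.update rs.real (cellAddr (e 0) c (i.eval e σ) (j.eval e σ) + 2) v } := by
        refine ⟨h.env, h.var, fun a ha => ?_, fun c' i' j' => ?_, fun c' i' j' => ?_⟩
        · rw [← h.inp a ha]
          exact Function.update_of_ne (by simp only [cellAddr]; omega) _ _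
        · rw [← h.re]
          exact Function.update_of_ne (by simp only [cellAddr]; omega) _ _
        · rw [← h.im]
          exact Function.update_of_ne (by simp only [cellAddr]; omega) _ _
      exact (CellExpr.raw_eval h' hl x hx).1
    refine ⟨_, _, Exec.seq (Exec.setReal _ _ _) (Exec.seq (Exec.setReal _ _ _)
      (Exec.setReal _ _ _)), ?_, ?_, ?_⟩
    · simp only [time, NatExpr.cost, RealExpr.cost]; omega
    · simp only [NatExpr.eval, RealExpr.eval, key0, key, him, hre']
      have := h.setCell c (i.eval e σ) (j.eval e σ) (x.eval e σ)
      simpa [den] using this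
    · intro i hi; rfl
  | seq p q ihp ihq =>
    intro l e σ rs L hl hw hb h
    obtain ⟨T, rs', h1, h2, h3, h4⟩ := ihp l e σ rs L hl hw.1 hb.1 h
    obtain ⟨T', rs'', h1', h2', h3', h4'⟩ := ihq l e _ rs' L hl hw.2 hb.2 h3
    exact ⟨_, _, Exec.seq h1 h1', add_le_add h2 h2', h3', fun i hi => (h4' i hi).trans (h4 i hi)⟩
  | ite b p q ihp ihq =>
    intro l e σ rs L hl hw hb h
    by_cases hg : b.holds e σ
    · obtain ⟨T, rs', h1, h2, h3, h4⟩ := ihp l e σ rs L hl hw.2.1 hb.1 h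
      refine ⟨_, _, Exec.iteTrue ((Guard.raw_holds h hl b hw.1).2 hg) h1, ?_, ?_, h4⟩
      · simp only [time]; omega
      · simpa [den, hg] using h3
    · obtain ⟨T, rs', h1, h2, h3, h4⟩ := ihq l e σ rs L hl hw.2.2 hb.2 h
      refine ⟨_, _, Exec.iteFalse (mt (Guard.raw_holds h hl b hw.1).1 hg) h1, ?_, ?_, h4⟩
      · simp only [time]; omega
      · simpa [den, hg] using h3
  | loop l' N p ih =>
    intro l e σ rs L hl hw hb h
    obtain ⟨rfl, hN, hp⟩ := hw
    set M := N.eval e σ with hM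
    set f : ℕ → ArrState → ArrState := fun i s => p.den (Function.update e l' i) s with hf
    -- Induction on the number `m` of remaining rounds. The stored bound at `3 * l' + 1` survives
    -- the body because of the last clause of the induction hypothesis at depth `l' + 1`. The
    -- constants are 6 steps for the test and 6 for the increment.
    have main : ∀ m k rs, k + m = M → Represents l' e (iterIdx f k σ) rs →
        rs.nat (3 * l') = k → rs.nat (3 * l' + 1) = M →
        ∃ T rs', Exec (.loop (.natLt (.get (.const (3 * l'))) (.get (.const (3 * l' + 1))))
          (.seq p.raw (.setNat (.const (3 * l')) (.add (.get (.const (3 * l'))) (.const 1)))))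
          rs T rs' ∧ T ≤ 6 + m * (p.time L + 12) ∧ Represents l' e (iterIdx f M σ) rs' ∧
          ∀ i < l', rs'.nat (3 * i + 1) = rs.nat (3 * i + 1) := by
      intro m
      induction m with
      | zero =>
        intro k rs hk hR hn hn1
        refine ⟨_, rs, Exec.loopDone ?_, ?_, ?_, fun _ _ => rfl⟩
        · simp only [TestExpr.holds, NatExpr.eval, hn, hn1]; omega
        · simp [TestExpr.cost, NatExpr.cost]
        · rw [← hk]; exact hR
      | succ m ihm =>
        intro k rs hk hR hn hn1
        obtain ⟨T, rs1, h1, h2, h3, h4⟩ := ih (l' + 1) (Function.update e l' k) (iterIdx f k σ) rs L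
          (by omega) hp (hb.2 k) (hR.succ hl hn)
        have e1 : rs1.nat (3 * l') = k := by simpa using h3.env l' (by omega)
        have e2 := (h4 l' (by omega)).trans hn1
        obtain ⟨T', rs2, h1', h2', h3', h4'⟩ := ihm (k + 1)
          { rs1 with nat := Function.update rs1.nat (3 * l') (k + 1) } (by omega)
          ((h3.of_succ hl).update_nat (fun i hi => by omega) (fun m => by omega))
          (by simp) (by
            change Function.update rs1.nat (3 * l') (k + 1) (3 * l' + 1) = M
            rw [Function.update_of_ne (by omega), e2])
        have hset := Exec.setNat rs1 (.const (3 * l')) (.add (.get (.const (3 * l'))) (.const 1))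
        simp only [NatExpr.eval, e1] at hset
        refine ⟨_, rs2, Exec.loopStep ?_ (Exec.seq h1 hset) h1', ?_, h3', fun i hi => ?_⟩
        · simp only [TestExpr.holds, NatExpr.eval, hn, hn1]; omega
        · simp only [TestExpr.cost, NatExpr.cost, add_mul, one_mul]
          omega
        · rw [h4' i hi, ← h4 i (by omega)]
          exact Function.update_of_ne (by omega) _ _
    have hset := Exec.setNat rs (.const (3 * l')) (.const 0)
    set rs1 : RamState := { rs with nat := Function.update rs.nat (3 * l') 0 } with hrs1
    have hR1 : Represents l' e σ rs1 :=
      h.update_nat (fun i hi => by omega) (fun m => by omega)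
    have hset2 := Exec.setNat rs1 (.const (3 * l' + 1)) N.raw
    rw [IdxExpr.raw_eval hR1 N hN] at hset2
    obtain ⟨T, rs', h1, h2, h3, h4⟩ := main M 0
      { rs1 with nat := Function.update rs1.nat (3 * l' + 1) M } (by omega)
      (hR1.update_nat (fun i hi => by omega) (fun m => by omega))
      (by
        change Function.update rs1.nat (3 * l' + 1) M (3 * l') = 0
        rw [Function.update_of_ne (by omega)]; simp [hrs1]) (by simp)
    refine ⟨_, rs', Exec.seq hset (Exec.seq hset2 h1), ?_, h3, fun i hi => ?_⟩
    · have : M * (p.time L + 12) ≤ L * (p.time L + 12) := Nat.mul_le_mul_right _ (hb.1 σ)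
      simp only [time, NatExpr.cost]
      omega
    · rw [h4 i hi]
      change Function.update (Function.update rs.nat (3 * l') 0) (3 * l' + 1) M (3 * i + 1) = _
      rw [Function.update_of_ne (by omega), Function.update_of_ne (by omega)]

/-! ## Jacobi's eigenvalue method -/

theorem frobNorm_sq {n : Type*} [Fintype n] (M : Matrix n n ℂ) :
    frobNorm M ^ 2 = ∑ i, ∑ j, ‖M i j‖ ^ 2 :=
  Real.sq_sqrt (by positivity)

theorem frobNorm_nonneg {n : Type*} [Fintype n] (M : Matrix n n ℂ) : 0 ≤ frobNorm M :=
  Real.sqrt_nonneg _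

theorem frobNorm_sq_eq_trace {n : Type*} [Fintype n] (M : Matrix n n ℂ) :
    frobNorm M ^ 2 = (Mᴴ * M).trace.re := by
  rw [frobNorm_sq, Finset.sum_comm]
  simp only [Matrix.trace, Matrix.diag, Matrix.mul_apply, Matrix.conjTranspose_apply,
    Complex.re_sum]
  refine Finset.sum_congr rfl fun i _ => Finset.sum_congr rfl fun j _ => ?_
  rw [Complex.star_def, ← Complex.normSq_eq_conj_mul_self, Complex.ofReal_re,
    Complex.normSq_eq_norm_sq]

theorem frobNorm_conj_unitary {n : Type*} [Fintype n] [DecidableEq n] (A : Matrix n n ℂ)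
    {V : Matrix n n ℂ} (hV : Vᴴ * V = 1) : frobNorm (Vᴴ * A * V) = frobNorm A := by
  have hV' : V * Vᴴ = 1 := mul_eq_one_comm.1 hV
  have h : frobNorm (Vᴴ * A * V) ^ 2 = frobNorm A ^ 2 := by
    rw [frobNorm_sq_eq_trace, frobNorm_sq_eq_trace]
    have : (Vᴴ * A * V)ᴴ * (Vᴴ * A * V) = Vᴴ * (Aᴴ * (V * Vᴴ) * A * V) := by
      simp only [Matrix.conjTranspose_mul, Matrix.conjTranspose_conjTranspose, Matrix.mul_assoc]
    rw [this, Matrix.trace_mul_comm, hV', Matrix.mul_one, Matrix.mul_assoc, hV', Matrix.mul_one]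
  exact (sq_eq_sq₀ (frobNorm_nonneg _) (frobNorm_nonneg _)).1 h

/-- The squared Frobenius norm of the off-diagonal part. -/
noncomputable def offSq {n : Type*} [Fintype n] [DecidableEq n] (A : Matrix n n ℂ) : ℝ :=
  ∑ i, ∑ j, if i = j then 0 else ‖A i j‖ ^ 2

section
variable {n : Type*} [Fintype n] [DecidableEq n]

theorem offSq_nonneg (A : Matrix n n ℂ) : 0 ≤ offSq A :=
  Finset.sum_nonneg fun i _ => Finset.sum_nonneg fun j _ => by split_ifs <;> positivity

theorem offSq_add_diag (A : Matrix n n ℂ) : offSq A + ∑ i, ‖A i i‖ ^ 2 = frobNorm A ^ 2 := by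
  rw [frobNorm_sq, offSq, ← Finset.sum_add_distrib]
  refine Finset.sum_congr rfl fun i _ => ?_
  have : ‖A i i‖ ^ 2 = ∑ j, if i = j then ‖A i j‖ ^ 2 else 0 := by simp
  rw [this, ← Finset.sum_add_distrib]
  refine Finset.sum_congr rfl fun j _ => ?_
  split_ifs <;> simp

/-- The tangent-like parameter of the Jacobi rotation. -/
noncomputable def jacobiParam (a c : ℝ) (b : ℂ) : ℝ :=
  (c - a) / 2 + Real.sqrt (((c - a) / 2) ^ 2 + ‖b‖ ^ 2)

/-- The inverse of the normalization of the Jacobi rotation. -/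
noncomputable def jacobiScale (a c : ℝ) (b : ℂ) : ℝ :=
  1 / Real.sqrt (‖b‖ ^ 2 + jacobiParam a c b ^ 2)

/-- This quadratic equation for `y` says that `(b, y)` is an eigenvector of the block with rows `(a,
b)` and `(b^*, c)`, with eigenvalue `a + y`; the other eigenvalue is `c - y`. -/
theorem jacobiParam_eq (a c : ℝ) (b : ℂ) :
    jacobiParam a c b ^ 2 = ‖b‖ ^ 2 + jacobiParam a c b * (c - a) := by
  have := Real.sq_sqrt (show 0 ≤ ((c - a) / 2) ^ 2 + ‖b‖ ^ 2 by positivity)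
  unfold jacobiParam
  linear_combination this

theorem jacobiScale_sq (a c : ℝ) {b : ℂ} (hb : b ≠ 0) :
    jacobiScale a c b ^ 2 * (‖b‖ ^ 2 + jacobiParam a c b ^ 2) = 1 := by
  have h : 0 < ‖b‖ ^ 2 + jacobiParam a c b ^ 2 := by
    have := norm_pos_iff.2 hb; positivity
  rw [jacobiScale, div_pow, Real.sq_sqrt h.le]
  field_simp

/-- The plane rotation in the coordinates `p`, `q` with the columns `(s b, s y)` and
`(-s y, s b^*)`. -/
noncomputable def planeRot (p q : n) (b : ℂ) (s y : ℝ) : Matrix n n ℂ := fun k j =>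
  if j = p then (if k = p then s * b else 0) + (if k = q then (s * y : ℂ) else 0)
  else if j = q then (if k = p then -(s * y : ℂ) else 0) + (if k = q then s * star b else 0)
  else if k = j then 1 else 0

theorem mul_planeRot_left (A : Matrix n n ℂ) (p q : n) (b : ℂ) (s y : ℝ) (k : n) :
    (A * planeRot p q b s y) k p = A k p * (s * b) + A k q * (s * y) := by
  simp [Matrix.mul_apply, planeRot, mul_add, Finset.sum_add_distrib]

theorem mul_planeRot_right (A : Matrix n n ℂ) {p q : n} (hpq : p ≠ q) (b : ℂ) (s y : ℝ) (k : n) :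
    (A * planeRot p q b s y) k q = -(A k p * (s * y)) + A k q * (s * star b) := by
  simp [Matrix.mul_apply, planeRot, mul_add, Finset.sum_add_distrib, hpq.symm]

theorem mul_planeRot_of_ne (A : Matrix n n ℂ) {p q j : n} (hp : j ≠ p) (hq : j ≠ q) (b : ℂ)
    (s y : ℝ) (k : n) : (A * planeRot p q b s y) k j = A k j := by
  simp [Matrix.mul_apply, planeRot, hp, hq]

theorem planeRot_unitary {p q : n} (hpq : p ≠ q) {b : ℂ} {s y : ℝ}
    (h : s ^ 2 * (‖b‖ ^ 2 + y ^ 2) = 1) :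
    (planeRot p q b s y)ᴴ * planeRot p q b s y = 1 := by
  have hb : star b * b = (‖b‖ ^ 2 : ℂ) := by
    rw [Complex.star_def, ← Complex.normSq_eq_conj_mul_self, Complex.normSq_eq_norm_sq]
    norm_cast
  have h' : (s ^ 2 * (‖b‖ ^ 2 + y ^ 2) : ℂ) = 1 := by exact_mod_cast h
  have hs : star (s : ℂ) = s := Complex.conj_ofReal s
  have hy : star (y : ℂ) = y := Complex.conj_ofReal y
  ext i j
  by_cases hjp : j = p
  · subst hjp
    rw [mul_planeRot_left]
    by_cases hij : i = j
    · subst hij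
      simp only [Matrix.conjTranspose_apply, planeRot, hpq, hpq.symm, if_true, if_false, add_zero,
        zero_add, star_mul', hs, hy, Matrix.one_apply_eq]
      linear_combination h' + s ^ 2 * hb
    · rw [Matrix.one_apply_ne hij]
      by_cases hiq : i = q
      · subst hiq
        simp only [Matrix.conjTranspose_apply, planeRot, hpq, hpq.symm, if_true, if_false,
          add_zero, zero_add, star_mul', star_neg, hs, hy, star_star]
        ring
      · simp only [Matrix.conjTranspose_apply, planeRot, hij, hiq, if_false, Ne.symm hij,
          Ne.symm hiq, star_zero, zero_mul, add_zero]
  · by_cases hjq : j = q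
    · subst hjq
      rw [mul_planeRot_right _ hpq]
      by_cases hij : i = j
      · subst hij
        simp only [Matrix.conjTranspose_apply, planeRot, hpq, hpq.symm, if_true, if_false,
          add_zero, zero_add, star_mul', star_neg, hs, hy, star_star, Matrix.one_apply_eq]
        linear_combination h' + s ^ 2 * hb
      · rw [Matrix.one_apply_ne hij]
        by_cases hip : i = p
        · subst hip
          simp only [Matrix.conjTranspose_apply, planeRot, hpq, hpq.symm, if_true, if_false,
            add_zero, zero_add, star_mul', hs, hy]
          ring
        · simp only [Matrix.conjTranspose_apply, planeRot, hij, hip, if_false, Ne.symm hij,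
            Ne.symm hip, star_zero, zero_mul, add_zero, neg_zero]
    · rw [mul_planeRot_of_ne _ hjp hjq]
      simp only [Matrix.conjTranspose_apply, planeRot, Matrix.one_apply]
      by_cases hip : i = p
      · subst hip
        simp [hjp, hjq, Ne.symm hjp]
      · by_cases hiq : i = q
        · subst hiq
          simp [hjp, hjq, Ne.symm hjq, hip]
        · simp only [hip, hiq, if_false]
          by_cases hij : i = j
          · simp [hij]
          · simp [hij, Ne.symm hij]

/-- The rotation that annihilates the entry `(p, q)` of a Hermitian matrix. -/
noncomputable def jacobiRot (A : Matrix n n ℂ) (p q : n) : Matrix n n ℂ :=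
  planeRot p q (A p q) (jacobiScale (A p p).re (A q q).re (A p q))
    (jacobiParam (A p p).re (A q q).re (A p q))

theorem jacobiRot_unitary (A : Matrix n n ℂ) {p q : n} (hpq : p ≠ q) (hb : A p q ≠ 0) :
    (jacobiRot A p q)ᴴ * jacobiRot A p q = 1 :=
  planeRot_unitary hpq (jacobiScale_sq _ _ hb)

/-- The Frobenius norm is invariant, so only the diagonal has to be followed. It changes in two
places, from `a`, `c` to `a + y`, `c - y`, and `(a + y)² + (c - y)² = a² + c² + 2|b|²`. What the
diagonal gains the off-diagonal part loses. -/
theorem offSq_jacobiRot {A : Matrix n n ℂ} (hA : A.IsHermitian) {p q : n} (hpq : p ≠ q)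
    (hb : A p q ≠ 0) :
    offSq ((jacobiRot A p q)ᴴ * A * jacobiRot A p q) = offSq A - 2 * ‖A p q‖ ^ 2 := by
  set V := jacobiRot A p q with hV
  have hVu : Vᴴ * V = 1 := jacobiRot_unitary A hpq hb
  set B := Vᴴ * A * V with hB
  have h1 := offSq_add_diag A
  have h2 := offSq_add_diag B
  rw [hB, frobNorm_conj_unitary A hVu, ← hB] at h2
  set a := (A p p).re with ha
  set c := (A q q).re with hc
  set b := A p q with hbdef
  set y := jacobiParam a c b with hy
  set s := jacobiScale a c b with hs
  have haa : A p p = (a : ℂ) := (hA.coe_re_apply_self p).symm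
  have hcc : A q q = (c : ℂ) := (hA.coe_re_apply_self q).symm
  have hba : A q p = star b := (hA.apply q p).symm
  have hbb : star b * b = (‖b‖ ^ 2 : ℂ) := by
    rw [Complex.star_def, ← Complex.normSq_eq_conj_mul_self, Complex.normSq_eq_norm_sq]
    norm_cast
  have hy2 : (y : ℂ) ^ 2 = (‖b‖ ^ 2 : ℂ) + y * (c - a) := by exact_mod_cast jacobiParam_eq a c b
  have hs2 : (s : ℂ) ^ 2 * ((‖b‖ ^ 2 : ℂ) + y ^ 2) = 1 := by exact_mod_cast jacobiScale_sq a c hb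
  have hss : star (s : ℂ) = s := Complex.conj_ofReal s
  have hyy : star (y : ℂ) = y := Complex.conj_ofReal y
  have hVh : ∀ (M : Matrix n n ℂ) (i k : n), (Vᴴ * M) i k = star ((Mᴴ * V) k i) := by
    intro M i k
    rw [← Matrix.conjTranspose_apply, Matrix.conjTranspose_mul, Matrix.conjTranspose_conjTranspose]
  have hBe : ∀ i, B i i = star (((A * V)ᴴ * V) i i) := by
    intro i; rw [hB, Matrix.mul_assoc, hVh]
  have hBp : B p p = ((a + y : ℝ) : ℂ) := by
    rw [hBe, hV, jacobiRot, mul_planeRot_left]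
    simp only [Matrix.conjTranspose_apply, ← ha, ← hc, ← hbdef, ← hy, ← hs]
    rw [mul_planeRot_left, mul_planeRot_left, haa, hba, hcc]
    simp only [star_add, star_mul', star_star, hss, hyy, ← hbdef]
    push_cast
    linear_combination (s ^ 2 * a + 2 * s ^ 2 * y) * hbb + (a + y) * hs2 - (s ^ 2 * y) * hy2
  have hBq : B q q = ((c - y : ℝ) : ℂ) := by
    rw [hBe, hV, jacobiRot, mul_planeRot_right _ hpq]
    simp only [Matrix.conjTranspose_apply, ← ha, ← hc, ← hbdef, ← hy, ← hs]
    rw [mul_planeRot_right _ hpq, mul_planeRot_right _ hpq, haa, hba, hcc]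
    simp only [star_add, star_neg, star_mul', star_star, hss, hyy, ← hbdef]
    push_cast
    linear_combination (s ^ 2 * c - 2 * s ^ 2 * y) * hbb + (c - y) * hs2 + (s ^ 2 * y) * hy2
  have hBi : ∀ i, i ≠ p → i ≠ q → B i i = A i i := by
    intro i hip hiq
    rw [hBe, hV, jacobiRot, mul_planeRot_of_ne _ hip hiq, Matrix.conjTranspose_apply,
      mul_planeRot_of_ne _ hip hiq, star_star]
  have hdiag : ∑ i, ‖B i i‖ ^ 2 = ∑ i, ‖A i i‖ ^ 2 + 2 * ‖b‖ ^ 2 := by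
    have key : ∀ M : Matrix n n ℂ, ∑ i, ‖M i i‖ ^ 2 =
        ‖M p p‖ ^ 2 + (‖M q q‖ ^ 2 + ∑ i ∈ (Finset.univ.erase p).erase q, ‖M i i‖ ^ 2) := by
      intro M
      rw [Finset.add_sum_erase _ (fun i => ‖M i i‖ ^ 2) (by simp [hpq.symm]),
        Finset.add_sum_erase _ (fun i => ‖M i i‖ ^ 2) (Finset.mem_univ _)]
    rw [key A, key B, hBp, hBq, haa, hcc]
    have : ∑ i ∈ (Finset.univ.erase p).erase q, ‖B i i‖ ^ 2 =
        ∑ i ∈ (Finset.univ.erase p).erase q, ‖A i i‖ ^ 2 := by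
      refine Finset.sum_congr rfl fun i hi => ?_
      simp only [Finset.mem_erase, Finset.mem_univ, and_true] at hi
      rw [hBi i hi.2 hi.1]
    rw [this]
    simp only [Complex.norm_real, Real.norm_eq_abs, sq_abs]
    linear_combination 2 * jacobiParam_eq a c b
  linarith

end

/-- One conditional Jacobi rotation of the basis `U` for the matrix `Q`. -/
noncomputable def jacobiStep {n : ℕ} (Q : Matrix (Fin n) (Fin n) ℂ) (p q : Fin n)
    (U : Matrix (Fin n) (Fin n) ℂ) : Matrix (Fin n) (Fin n) ℂ :=
  let A := Uᴴ * Q * U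
  if p ≠ q ∧ 0 < ‖A p q‖ ^ 2 ∧ ¬ (n ^ 2 * ‖A p q‖ ^ 2 < offSq A) then U * jacobiRot A p q else U

/-- One sweep through all pairs of coordinates. -/
noncomputable def jacobiSweep {n : ℕ} (Q U : Matrix (Fin n) (Fin n) ℂ) :
    Matrix (Fin n) (Fin n) ℂ :=
  iterIdx (fun p U => iterIdx (fun q U =>
    if h : p < n ∧ q < n then jacobiStep Q ⟨p, h.1⟩ ⟨q, h.2⟩ U else U) n U) n U

section
variable {n : ℕ} {Q : Matrix (Fin n) (Fin n) ℂ}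

theorem iterIdx_induction {α : Type*} {f : ℕ → α → α} {P : ℕ → α → Prop} {s : α} {m : ℕ}
    (h0 : P 0 s) (hs : ∀ k a, k < m → P k a → P (k + 1) (f k a)) : P m (iterIdx f m s) := by
  induction m with
  | zero => exact h0
  | succ m ih => exact hs m _ (by omega) (ih fun k a hk h => hs k a (by omega) h)

theorem jacobiStep_unitary (p q : Fin n) {U : Matrix (Fin n) (Fin n) ℂ} (hU : Uᴴ * U = 1) :
    (jacobiStep Q p q U)ᴴ * jacobiStep Q p q U = 1 := by
  unfold jacobiStep
  simp only
  split_ifs with h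
  · rw [Matrix.conjTranspose_mul, Matrix.mul_assoc, ← Matrix.mul_assoc Uᴴ, hU, Matrix.one_mul]
    exact jacobiRot_unitary _ h.1 (fun h0 => by simp [h0] at h)
  · exact hU

/-- A rotation is performed only on an entry carrying at least the fraction `1 / n²` of the
off-diagonal mass; it removes that entry and its mirror image. With this threshold no search for the
largest entry is needed. -/
theorem jacobiStep_cases (hQ : Q.IsHermitian) (p q : Fin n) (U : Matrix (Fin n) (Fin n) ℂ) :
    offSq ((jacobiStep Q p q U)ᴴ * Q * jacobiStep Q p q U) ≤
        (1 - 1 / (n : ℝ) ^ 2) * offSq (Uᴴ * Q * U) ∨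
      jacobiStep Q p q U = U ∧ (p = q ∨
        n ^ 2 * ‖(Uᴴ * Q * U) p q‖ ^ 2 < offSq (Uᴴ * Q * U) ∨ (Uᴴ * Q * U) p q = 0) := by
  have hn : (0 : ℝ) < n := by exact_mod_cast p.pos
  set A := Uᴴ * Q * U with hA
  have hAh : A.IsHermitian := Matrix.isHermitian_conjTranspose_mul_mul U hQ
  by_cases h : p ≠ q ∧ 0 < ‖A p q‖ ^ 2 ∧ ¬ (n ^ 2 * ‖A p q‖ ^ 2 < offSq A)
  · left
    have h1 : jacobiStep Q p q U = U * jacobiRot A p q := by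
      unfold jacobiStep; simp only; rw [if_pos h]
    have hb : A p q ≠ 0 := fun h0 => by simp [h0] at h
    rw [h1]
    have h2 : (U * jacobiRot A p q)ᴴ * Q * (U * jacobiRot A p q) =
        (jacobiRot A p q)ᴴ * A * jacobiRot A p q := by
      rw [hA]; simp only [Matrix.conjTranspose_mul, Matrix.mul_assoc]
    rw [h2, offSq_jacobiRot hAh h.1 hb]
    have h3 := not_lt.1 h.2.2
    have h4 : offSq A / n ^ 2 ≤ ‖A p q‖ ^ 2 := by
      rw [div_le_iff₀ (by positivity)]; linarith
    have h5 : (1 - 1 / (n : ℝ) ^ 2) * offSq A = offSq A - offSq A / n ^ 2 := by ring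
    rw [h5]
    have := sq_nonneg ‖A p q‖
    linarith
  · right
    refine ⟨by unfold jacobiStep; simp only; rw [if_neg h], ?_⟩
    by_cases h1 : p = q
    · exact Or.inl h1
    · by_cases h2 : A p q = 0
      · exact Or.inr (Or.inr h2)
      · refine Or.inr (Or.inl ?_)
        by_contra h3
        exact h ⟨h1, by have := norm_pos_iff.2 h2; positivity, h3⟩

theorem jacobiSweep_unitary {U : Matrix (Fin n) (Fin n) ℂ} (hU : Uᴴ * U = 1) :
    (jacobiSweep Q U)ᴴ * jacobiSweep Q U = 1 := by
  refine iterIdx_induction (P := fun _ U => Uᴴ * U = 1) hU fun p U' _ hU' => ?_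
  refine iterIdx_induction (P := fun _ U => Uᴴ * U = 1) hU' fun q U'' _ hU'' => ?_
  split_ifs with h
  · exact jacobiStep_unitary _ _ hU''
  · exact hU''

/-- A sweep without any rotation would have inspected one and the same matrix throughout and found
all `n (n - 1)` off-diagonal entries below the threshold, which is too little to make up a positive
`offSq`. So some rotation gains the factor, and no later step loses it. -/
theorem offSq_jacobiSweep (hn : 1 ≤ n) (hQ : Q.IsHermitian) (U : Matrix (Fin n) (Fin n) ℂ) :
    offSq ((jacobiSweep Q U)ᴴ * Q * jacobiSweep Q U) ≤
      (1 - 1 / (n : ℝ) ^ 2) * offSq (Uᴴ * Q * U) := by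
  set A := Uᴴ * Q * U with hA
  set r := 1 - 1 / (n : ℝ) ^ 2 with hr
  have hn1 : (1 : ℝ) ≤ n := by exact_mod_cast hn
  have hn2 : 1 / (n : ℝ) ^ 2 ≤ 1 := by
    rw [div_le_one (by positivity)]; nlinarith
  have hr0 : 0 ≤ r := by rw [hr]; linarith
  have hr1 : r ≤ 1 := by
    have : 0 ≤ 1 / (n : ℝ) ^ 2 := by positivity
    rw [hr]; linarith
  -- The invariant of both loops: either the gain has been made, or the basis is still `U` and all
  -- pairs visited so far were skipped for the matrix `A`.
  let bad : ℕ → ℕ → Prop := fun p q => ∀ (hp : p < n) (hq : q < n),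
    (⟨p, hp⟩ : Fin n) = ⟨q, hq⟩ ∨ n ^ 2 * ‖A ⟨p, hp⟩ ⟨q, hq⟩‖ ^ 2 < offSq A ∨ A ⟨p, hp⟩ ⟨q, hq⟩ = 0
  have main : offSq ((jacobiSweep Q U)ᴴ * Q * jacobiSweep Q U) ≤ r * offSq A ∨
      jacobiSweep Q U = U ∧ ∀ p < n, ∀ q < n, bad p q := by
    refine iterIdx_induction (P := fun k U' => offSq (U'ᴴ * Q * U') ≤ r * offSq A ∨
      U' = U ∧ ∀ p < k, ∀ q < n, bad p q) (Or.inr ⟨rfl, by simp⟩) fun p U' hp hU' => ?_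
    set g : ℕ → Matrix (Fin n) (Fin n) ℂ → Matrix (Fin n) (Fin n) ℂ := fun q U =>
      if h : p < n ∧ q < n then jacobiStep Q ⟨p, h.1⟩ ⟨q, h.2⟩ U else U with hg
    have h2 : ∀ m ≤ n, offSq ((iterIdx g m U')ᴴ * Q * iterIdx g m U') ≤ r * offSq A ∨
        iterIdx g m U' = U ∧ (∀ p' < p, ∀ q < n, bad p' q) ∧ ∀ q < m, bad p q := by
      intro m hm
      refine iterIdx_induction (P := fun m V => offSq (Vᴴ * Q * V) ≤ r * offSq A ∨
        V = U ∧ (∀ p' < p, ∀ q < n, bad p' q) ∧ ∀ q < m, bad p q) ?_ fun q V hq hV => ?_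
      · rcases hU' with h | h
        · exact Or.inl h
        · exact Or.inr ⟨h.1, h.2, by simp⟩
      · simp only [hg]
        rw [dif_pos ⟨hp, hq.trans_le hm⟩]
        have hc := jacobiStep_cases hQ ⟨p, hp⟩ ⟨q, hq.trans_le hm⟩ V
        rcases hV with h | ⟨rfl, h3, h4⟩
        · left
          rcases hc with hc | hc
          · exact hc.trans ((mul_le_of_le_one_left (offSq_nonneg _) hr1).trans h)
          · rw [hc.1]; exact h
        · rcases hc with hc | hc
          · exact Or.inl hc
          · refine Or.inr ⟨hc.1, h3, fun q' hq' => ?_⟩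
            rcases Nat.lt_succ_iff_lt_or_eq.1 hq' with h5 | rfl
            · exact h4 q' h5
            · exact fun _ _ => hc.2
    rcases h2 n le_rfl with h | ⟨h, h3, h4⟩
    · exact Or.inl h
    · refine Or.inr ⟨h, fun p' hp' q hq => ?_⟩
      rcases Nat.lt_succ_iff_lt_or_eq.1 hp' with h5 | rfl
      · exact h3 p' h5 q hq
      · exact h4 q hq
  rcases main with h | ⟨h, hbad⟩
  · exact h
  · rw [h, ← hA]
    rcases (offSq_nonneg A).eq_or_lt with h0 | h0
    · rw [← h0]; simp
    · exfalso
      -- The right-hand side equals `offSq A - offSq A / n`, which is the contradiction.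
      have h1 : offSq A ≤ ∑ i : Fin n, ∑ j : Fin n, if i = j then 0 else offSq A / n ^ 2 := by
        conv_lhs => rw [offSq]
        refine Finset.sum_le_sum fun i _ => Finset.sum_le_sum fun j _ => ?_
        split_ifs with hij
        · exact le_rfl
        · rcases hbad i i.2 j j.2 i.2 j.2 with h5 | h5 | h5
          · exact absurd h5 hij
          · rw [le_div_iff₀ (by positivity)]; simp only [Fin.eta] at h5; linarith
          · simp only [Fin.eta] at h5; rw [h5]; simp; positivity
      have h2 : ∑ i : Fin n, ∑ j : Fin n, (if i = j then 0 else offSq A / n ^ 2) =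
          n * ((n - 1) * (offSq A / n ^ 2)) := by
        have : ∀ i : Fin n, ∑ j : Fin n, (if i = j then 0 else offSq A / (n : ℝ) ^ 2) =
            (n - 1) * (offSq A / n ^ 2) := by
          intro i
          have h6 : ∑ j : Fin n, (if i = j then 0 else offSq A / (n : ℝ) ^ 2) +
              ∑ j : Fin n, (if i = j then offSq A / (n : ℝ) ^ 2 else 0) =
              n * (offSq A / n ^ 2) := by
            rw [← Finset.sum_add_distrib]
            have : ∀ j : Fin n, ((if i = j then 0 else offSq A / (n : ℝ) ^ 2) +
              (if i = j then offSq A / (n : ℝ) ^ 2 else 0)) = offSq A / n ^ 2 := by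
              intro j; split_ifs <;> simp
            simp [this]
          rw [Finset.sum_ite_eq, if_pos (Finset.mem_univ _)] at h6
          linarith
        simp [this]
      rw [h2] at h1
      have h3 : (n : ℝ) * ((n - 1) * (offSq A / n ^ 2)) = offSq A - offSq A / n := by
        field_simp
      rw [h3] at h1
      have : 0 < offSq A / n := by positivity
      linarith

/-- Linear convergence of the Jacobi method. -/
theorem offSq_iterate_jacobiSweep (hn : 1 ≤ n) (hQ : Q.IsHermitian) (R : ℕ) :
    let U := (jacobiSweep Q)^[n * n * R] 1
    Uᴴ * U = 1 ∧ 2 ^ R * offSq (Uᴴ * Q * U) ≤ frobNorm Q ^ 2 := by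
  have hn1 : (1 : ℝ) ≤ n := by exact_mod_cast hn
  have hn2 : 1 / (n : ℝ) ^ 2 ≤ 1 := by
    rw [div_le_one (by positivity)]; nlinarith
  have key : ∀ J : ℕ, ((jacobiSweep Q)^[J] 1)ᴴ * (jacobiSweep Q)^[J] 1 = 1 ∧
      offSq (((jacobiSweep Q)^[J] 1)ᴴ * Q * (jacobiSweep Q)^[J] 1) ≤
        (1 - 1 / (n : ℝ) ^ 2) ^ J * frobNorm Q ^ 2 := by
    intro J
    induction J with
    | zero =>
      simp only [Function.iterate_zero, id_eq, Matrix.conjTranspose_one,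
        Matrix.mul_one, pow_zero, one_mul, true_and]
      rw [← offSq_add_diag]
      have : 0 ≤ ∑ i, ‖Q i i‖ ^ 2 := by positivity
      linarith
    | succ J ih =>
      rw [Function.iterate_succ_apply']
      refine ⟨jacobiSweep_unitary ih.1, (offSq_jacobiSweep hn hQ _).trans ?_⟩
      have h : (1 - 1 / (n : ℝ) ^ 2) ^ (J + 1) * frobNorm Q ^ 2 =
          (1 - 1 / (n : ℝ) ^ 2) * ((1 - 1 / (n : ℝ) ^ 2) ^ J * frobNorm Q ^ 2) := by
        rw [pow_succ]; ring
      rw [h]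
      exact mul_le_mul_of_nonneg_left ih.2 (sub_nonneg.2 hn2)
  refine ⟨(key _).1, ?_⟩
  have h1 := (key (n * n * R)).2
  have h2 : (1 - 1 / (n : ℝ) ^ 2) ^ (n * n) ≤ 1 / 2 := by
    -- A block of `n²` sweeps gains the factor `(1 - 1/n²)^(n²) ≤ 1/e ≤ 1/2`.
    have h3 := Real.one_sub_div_pow_le_exp_neg (n := n * n) (t := 1)
      (by push_cast; nlinarith)
    have h4 : Real.exp (-1) ≤ 1 / 2 := by
      rw [Real.exp_neg, inv_eq_one_div]
      exact one_div_le_one_div_of_le (by norm_num) (by have := Real.add_one_le_exp 1; linarith)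
    push_cast at h3
    rw [← pow_two (n : ℝ)] at h3
    linarith
  have h5 : (1 - 1 / (n : ℝ) ^ 2) ^ (n * n * R) ≤ (1 / 2) ^ R := by
    rw [pow_mul]
    exact pow_le_pow_left₀ (pow_nonneg (by linarith) _) h2 R
  calc _ ≤ 2 ^ R * ((1 / 2) ^ R * frobNorm Q ^ 2) := by
        refine mul_le_mul_of_nonneg_left (h1.trans ?_) (by positivity)
        exact mul_le_mul_of_nonneg_right h5 (sq_nonneg _)
    _ = frobNorm Q ^ 2 := by
        rw [← mul_assoc, ← mul_pow]; norm_num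

end

/-! ## Array operations -/

namespace Code
open IdxExpr CellExpr

/-- `arr c i j := ∑ k < N₃, x (i, j, k)` for `i < N₁`, `j < N₂`, where the indices `i`, `j`, `k`
stand at the levels `l`, `l + 1`, `l + 2`. -/
def fill (l c : ℕ) (N₁ N₂ N₃ : IdxExpr) (x : CellExpr) : Code :=
  .loop l N₁ (.loop (l + 1) N₂ (.store c (env l) (env (l + 1)) 0 ;;
    .loop (l + 2) N₃ (.store c (env l) (env (l + 1)) (get c (env l) (env (l + 1)) + x))))

@[simp] theorem wf_fill (l c : ℕ) (N₁ N₂ N₃ : IdxExpr) (x : CellExpr) (l' : ℕ) :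
    (fill l c N₁ N₂ N₃ x).wf l' ↔
      l = l' ∧ N₁.wf l' ∧ N₂.wf (l' + 1) ∧ N₃.wf (l' + 2) ∧ x.wf (l' + 3) := by
  simp only [fill, wf, IdxExpr.wf_env, CellExpr.wf_ofNat, CellExpr.wf_add, CellExpr.wf_get]
  constructor
  · rintro ⟨rfl, h⟩; refine ⟨rfl, ?_⟩; tauto
  · rintro ⟨rfl, h⟩; refine ⟨rfl, h.1, rfl, h.2.1, ⟨?_, ?_, trivial⟩, rfl, h.2.2.1, ?_, ?_,
      ⟨?_, ?_⟩, h.2.2.2⟩ <;> omega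

theorem iterIdx_eq {α : Type*} {f : ℕ → α → α} {P : ℕ → α} {m : ℕ}
    (hs : ∀ k < m, f k (P k) = P (k + 1)) : iterIdx f m (P 0) = P m :=
  iterIdx_induction (P := fun k a => a = P k) rfl fun k _ hk h => h ▸ hs k hk

/-- The quantifier over `a` in the hypotheses expresses that the bounds and the summand do not
depend on the array being filled, so its half-finished contents cannot influence them. The states
`row`, `cell`, `part` are the exact loop invariants of the three levels. -/
theorem den_fill {l c : ℕ} {N₁ N₂ N₃ : IdxExpr} {x : CellExpr} {e : ℕ → ℕ} {σ : ArrState}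
    (n₁ n₂ n₃ : ℕ) (v : ℕ → ℕ → ℕ → ℂ) (h₁ : N₁.eval e σ = n₁)
    (h₂ : ∀ i a, N₂.eval (Function.update e l i) (σ.setArr c a) = n₂)
    (h₃ : ∀ i j a, N₃.eval (Function.update (Function.update e l i) (l + 1) j)
      (σ.setArr c a) = n₃)
    (hx : ∀ i < n₁, ∀ j < n₂, ∀ k < n₃, ∀ a,
      x.eval (Function.update (Function.update (Function.update e l i) (l + 1) j) (l + 2) k)
        (σ.setArr c a) = v i j k) :
    (fill l c N₁ N₂ N₃ x).den e σ = σ.setArr c (fun i j =>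
      if i < n₁ ∧ j < n₂ then ∑ k ∈ Finset.range n₃, v i j k else σ.arr c i j) := by
  set S : ℕ → ℕ → ℂ := fun i j => ∑ k ∈ Finset.range n₃, v i j k with hS
  let row : ℕ → ArrState := fun i => σ.setArr c fun i' j' =>
    if i' < i ∧ j' < n₂ then S i' j' else σ.arr c i' j'
  let cell : ℕ → ℕ → ArrState := fun i j => σ.setArr c fun i' j' =>
    if i' < i ∧ j' < n₂ ∨ i' = i ∧ j' < j then S i' j' else σ.arr c i' j'
  let part : ℕ → ℕ → ℕ → ArrState := fun i j k => σ.setArr c fun i' j' =>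
    if i' < i ∧ j' < n₂ ∨ i' = i ∧ j' < j then S i' j' else
      if i' = i ∧ j' = j then ∑ k ∈ Finset.range k, v i j k else σ.arr c i' j'
  have e0 : row 0 = σ := by simp [row]
  have e1 : ∀ i, cell i 0 = row i := by intro i; simp [row, cell]
  have e2 : ∀ i, cell i n₂ = row (i + 1) := by
    intro i
    simp only [cell, row]
    congr 1; funext i' j'
    have : (i' < i ∧ j' < n₂ ∨ i' = i ∧ j' < n₂) ↔ i' < i + 1 ∧ j' < n₂ := by omega
    simp only [this]
  have e3 : ∀ i j, part i j n₃ = cell i (j + 1) := by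
    intro i j
    simp only [part, cell]
    congr 1; funext i' j'
    by_cases hc : i' = i ∧ j' = j
    · obtain ⟨rfl, rfl⟩ := hc; simp [hS]
    · have : (i' < i ∧ j' < n₂ ∨ i' = i ∧ j' < j + 1) ↔
          (i' < i ∧ j' < n₂ ∨ i' = i ∧ j' < j) := by omega
      simp only [this, hc, if_false]
  change iterIdx _ (N₁.eval e σ) σ = _
  rw [h₁, ← e0]
  conv_rhs => rw [e0]
  refine iterIdx_eq fun i hi => ?_
  change iterIdx _ (N₂.eval _ (row i)) (row i) = _
  rw [h₂, ← e1, ← e2]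
  refine iterIdx_eq fun j hj => ?_
  change iterIdx _ (N₃.eval _ _) _ = _
  have e4 : (Code.store c (env l) (env (l + 1)) 0).den
      (Function.update (Function.update e l i) (l + 1) j) (cell i j) = part i j 0 := by
    simp only [den, cell, part, IdxExpr.eval_env, CellExpr.eval_ofNat, ArrState.setArr_setArr,
      ArrState.setArr_same]
    congr 1; funext i' j'
    have : l ≠ l + 1 := by omega
    simp only [Function.update_self, Function.update_of_ne this]
    by_cases hc : i' = i ∧ j' = j
    · obtain ⟨rfl, rfl⟩ := hc; simp
    · simp [hc]
  rw [e4, h₃, ← e3]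
  refine iterIdx_eq fun k hk => ?_
  have hxk := hx i hi j hj k hk
  simp only [den, part, IdxExpr.eval_env, CellExpr.eval_add, CellExpr.eval_get, hxk,
    ArrState.setArr_setArr, ArrState.setArr_same]
  congr 1; funext i' j'
  have h1 : l ≠ l + 1 := by omega
  have h2 : l ≠ l + 2 := by omega
  have h3 : l + 1 ≠ l + 2 := by omega
  simp only [Function.update_self, Function.update_of_ne h1, Function.update_of_ne h2,
    Function.update_of_ne h3]
  by_cases hc : i' = i ∧ j' = j
  · obtain ⟨rfl, rfl⟩ := hc; simp [Finset.sum_range_succ]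
  · simp [hc]

end Code

/-- The leading `n × n` block of an array. -/
def blockMat (n : ℕ) (a : ℕ → ℕ → ℂ) : Matrix (Fin n) (Fin n) ℂ := fun i j => a i j

/-! ## The program

Arrays: `0` the input matrix, `1` the accuracy, `2`, `3` the row sums and the sum of the squared
moduli of its entries, `4` the basis `U`, `6` the matrix `Uᴴ Q U`, `7`, `8` the row sums and the sum
for its off-diagonal part, `9`, `10`, `11` a rotation, `12`, `13` a net point and its squared norm,
`14` the vector of the net point, `15`, `16` its reduced matrix and the powers of it, `17` the root
of the trace, `18` the optimum, `5` auxiliary. -/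

namespace SepProgram
open IdxExpr CellExpr Code

/-- Level 0 is always `d`. After `findScale`, level 1 is `X = ⌈‖Q‖_F²/δ²⌉`, and in `search` level 2
is the number of grid points; all other levels are loop indices. -/
def dim : IdxExpr := env 0 * env 0

def readInput : Code :=
  fill 1 0 dim dim 1 (inp (2 * (env 1 * dim + env 2) + 1) +
    .I * inp (2 * (env 1 * dim + env 2) + 2)) ;;
  .store 1 0 0 (inp 0) ;;
  fill 1 2 1 dim dim (get 0 (env 2) (env 3) * conj (get 0 (env 2) (env 3))) ;;
  fill 1 3 1 1 dim (get 2 0 (env 3))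

def conjugate (l : ℕ) : Code :=
  fill l 5 dim dim dim (get 0 (env l) (env (l + 2)) * get 4 (env (l + 2)) (env (l + 1))) ;;
  fill l 6 dim dim dim (conj (get 4 (env (l + 2)) (env l)) * get 5 (env (l + 2)) (env (l + 1)))

def offDiag : Code :=
  fill 5 7 1 dim dim
    (nat (1 - eqb (env 6) (env 7)) * (get 6 (env 6) (env 7) * conj (get 6 (env 6) (env 7)))) ;;
  fill 5 8 1 1 dim (get 7 0 (env 7))

def sqNorm (x : CellExpr) : CellExpr := x * conj x

def pivot : CellExpr := get 6 (env 3) (env 4)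

def halfGap : CellExpr := rdiv (get 6 (env 4) (env 4) - get 6 (env 3) (env 3)) 2

def rotateParams : Code :=
  .store 9 0 0 (halfGap + rsqrt (halfGap * halfGap + sqNorm pivot)) ;;
  .store 10 0 0 (rdiv 1 (rsqrt (sqNorm pivot + get 9 0 0 * get 9 0 0)))

def rotate : Code :=
  fill 5 11 dim dim 1
    (nat (eqb (env 6) (env 3)) * (nat (eqb (env 5) (env 3)) * (get 10 0 0 * pivot) +
        nat (eqb (env 5) (env 4)) * (get 10 0 0 * get 9 0 0)) +
      nat (eqb (env 6) (env 4)) * (nat (eqb (env 5) (env 4)) * (get 10 0 0 * conj pivot) -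
        nat (eqb (env 5) (env 3)) * (get 10 0 0 * get 9 0 0)) +
      nat ((1 - eqb (env 6) (env 3)) * (1 - eqb (env 6) (env 4)) * eqb (env 5) (env 6))) ;;
  fill 5 5 dim dim dim (get 4 (env 5) (env 7) * get 11 (env 7) (env 6)) ;;
  fill 5 4 dim dim 1 (get 5 (env 5) (env 6))

def rotateGuard : Guard :=
  .and (.natLt (eqb (env 3) (env 4)) 1) (.and (.reLt 0 (sqNorm pivot))
    (.not (.reLt (nat (dim * dim) * sqNorm pivot) (get 8 0 0))))

def step : Code := conjugate 5 ;; offDiag ;; .ite rotateGuard (rotateParams ;; rotate) .skip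

/-- The exponent of the precision. -/
def precExp (k : ℕ) : IdxExpr := (env 0).npow k + 10

/-- With `K = d^k + 10` the sweeps reduce the squared error to `2^(-X - 2K) ‖Q‖_F²`. As `‖Q‖_F² ≤ X
δ² ≤ 2^X δ²`, the error becomes at most `δ / 2^K`. -/
def jacobi (k : ℕ) : Code :=
  fill 2 4 dim dim 1 (nat (eqb (env 2) (env 3))) ;;
  .loop 2 (dim * dim * (env 1 + 2 * precExp k)) (.loop 3 dim (.loop 4 dim step)) ;;
  conjugate 2

/-- The `+ 1` keeps the mesh meaningful for `X = 0`, that is, for `Q = 0`. -/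
def gridHalf : IdxExpr := 32 * env 1 + 1
def gridBase : IdxExpr := 2 * gridHalf + 1

/-- The test whether the eigenvalue number `env l` is small. -/
def small (l : ℕ) : Guard := .reLt (get 6 (env l) (env l)) (rdiv (get 1 0 0) 2)

def countGrid : Code :=
  .setVar 1 1 ;;
  .loop 2 dim (.ite (small 2) .skip (.setVar 1 (var 1 * (gridBase * gridBase))))

/-- `var 3 := var 2 / gridBase`, for `var 2 ≤ env 2`. -/
def divide : Code :=
  .setVar 3 0 ;;
  .loop 5 (env 2) (.ite (.natLt (var 2) (gridBase * (var 3 + 1))) .skip (.setVar 3 (var 3 + 1)))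

/-- The grid coordinate of the last digit, when `var 3` is the quotient of `var 2`. -/
def coord : CellExpr :=
  rdiv (nat (var 2 - gridBase * var 3) - nat gridHalf) (nat gridHalf)

/-- The number of the grid point is read in base `gridBase`: each index in `Γ` consumes two digits,
one for the real and one for the imaginary part, and the other coordinates are set to zero. -/
def point : Code :=
  .setVar 2 (env 3) ;;
  .loop 4 dim (.ite (small 4) (.store 12 0 (env 4) 0)
    (divide ;; .store 12 0 (env 4) coord ;; .setVar 2 (var 3) ;;
      divide ;; .store 12 0 (env 4) (get 12 0 (env 4) + .I * coord) ;; .setVar 2 (var 3))) ;;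
  fill 4 13 1 1 dim (sqNorm (get 12 0 (env 6)))

/-- The relative error of the trace method is `d / 2^p` and the squared coefficients are at most `δ
(X + 1)`; the summand `d + X + 1` pays for the factor `d (X + 1)`, the rest for the precision. -/
def powers (k : ℕ) : IdxExpr := env 0 + env 1 + 1 + precExp k

def squarings (N : IdxExpr) : Code :=
  .loop 4 N
    (fill 5 16 (env 0) (env 0) (env 0) (get 15 (env 5) (env 7) * get 15 (env 7) (env 6)) ;;
      fill 5 15 (env 0) (env 0) 1 (get 16 (env 5) (env 6)))

def roots (N : IdxExpr) : Code := .loop 4 N (.store 17 0 0 (rsqrt (get 17 0 0)))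

def schmidt (k : ℕ) : Code :=
  fill 4 14 (env 0) (env 0) dim
    (conj (get 12 0 (env 6)) * rsqrt (get 6 (env 6) (env 6)) *
      get 4 (env 4 * env 0 + env 5) (env 6)) ;;
  fill 4 15 (env 0) (env 0) (env 0) (get 14 (env 4) (env 6) * conj (get 14 (env 5) (env 6))) ;;
  squarings (powers k) ;;
  fill 4 17 1 1 (env 0) (get 15 (env 6) (env 6)) ;;
  roots (powers k)

/-- The grid fills a cube, so points outside the unit ball are skipped. Starting the maximum from 0
is harmless because the computed values are nonnegative. -/
def search (k : ℕ) : Code :=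
  .store 18 0 0 0 ;;
  .loop 3 (env 2) (point ;; .ite (.reLt 1 (get 13 0 0)) .skip
    (schmidt k ;; .ite (.reLt (get 18 0 0) (get 17 0 0)) (.store 18 0 0 (get 17 0 0)) .skip))

section
attribute [local simp] readInput conjugate offDiag sqNorm pivot halfGap rotateParams rotate rotateGuard step
  jacobi gridHalf gridBase small countGrid divide coord point squarings roots schmidt search dim powers precExp
  wf_npow

theorem wf_readInput : readInput.wf 1 := by simp
theorem wf_jacobi (k : ℕ) : (jacobi k).wf 2 := by simp
theorem wf_countGrid : countGrid.wf 2 := by simp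
theorem wf_search (k : ℕ) : (search k).wf 3 := by simp

end
end SepProgram

/-! ## The effect of the program -/

theorem blockMat_sum (n m : ℕ) (v : ℕ → ℕ → ℕ → ℂ) (a : ℕ → ℕ → ℂ) :
    blockMat n (fun i j => if i < n ∧ j < n then ∑ k ∈ Finset.range m, v i j k else a i j) =
      fun (i j : Fin n) => ∑ k : Fin m, v i j k := by
  ext i j
  simp [blockMat, Finset.sum_range]

theorem blockMat_mul (n : ℕ) (a b c : ℕ → ℕ → ℂ) :
    blockMat n (fun i j => if i < n ∧ j < n then ∑ k ∈ Finset.range n, a i k * b k j else c i j) =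
      blockMat n a * blockMat n b := by
  rw [blockMat_sum n n (fun i j k => a i k * b k j)]
  ext i j
  simp [blockMat, Matrix.mul_apply]

theorem star_mul_self_eq (z : ℂ) : z * star z = ((‖z‖ ^ 2 : ℝ) : ℂ) := by
  rw [Complex.star_def, Complex.mul_conj, Complex.normSq_eq_norm_sq]

namespace SepProgram
open IdxExpr CellExpr Code

section
variable {e : ℕ → ℕ} {σ : ArrState} {n : ℕ}

/-- The new array contents are left existential: only the leading block, or a single cell, is ever
used. -/
theorem den_conjugate {l : ℕ} (hl : 1 ≤ l) (hn : e 0 * e 0 = n) :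
    ∃ W A, (conjugate l).den e σ = (σ.setArr 5 W).setArr 6 A ∧
      blockMat n A = (blockMat n (σ.arr 4))ᴴ * blockMat n (σ.arr 0) * blockMat n (σ.arr 4) := by
  have h0 : (0 : ℕ) ≠ l := by omega
  have h1 : (0 : ℕ) ≠ l + 1 := by omega
  have h2 : (0 : ℕ) ≠ l + 2 := by omega
  simp only [conjugate, den]
  rw [den_fill (c := 5) n n n (fun i j k => σ.arr 0 i k * σ.arr 4 k j) (by simp [dim, hn])
    (by simp [dim, h0, hn])
    (by simp [dim, h0, h1, hn]) (by simp [Function.update_apply])]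
  rw [den_fill n n n (fun i j k => star (σ.arr 4 k i) * if k < n ∧ j < n then
      ∑ m ∈ Finset.range n, σ.arr 0 k m * σ.arr 4 m j else σ.arr 5 k j) (by simp [dim, hn])
    (by simp [dim, h0, hn])
    (by simp [dim, h0, h1, hn]) (by simp [Function.update_apply])]
  refine ⟨_, _, rfl, ?_⟩
  rw [blockMat_sum n n (fun i j k => star (σ.arr 4 k i) * if k < n ∧ j < n then
      ∑ m ∈ Finset.range n, σ.arr 0 k m * σ.arr 4 m j else σ.arr 5 k j)]
  ext i j
  rw [Matrix.mul_assoc, Matrix.mul_apply]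
  refine Finset.sum_congr rfl fun k _ => ?_
  simp [Matrix.mul_apply, blockMat, Finset.sum_range]

theorem den_offDiag (hn : e 0 * e 0 = n) :
    ∃ a b, offDiag.den e σ = (σ.setArr 7 a).setArr 8 b ∧
      b 0 0 = (offSq (blockMat n (σ.arr 6)) : ℂ) := by
  simp only [offDiag, den]
  rw [den_fill (c := 7) 1 n n (fun _ j k => ((1 - if j = k then 1 else 0 : ℕ) : ℂ) *
      (σ.arr 6 j k * star (σ.arr 6 j k))) (by simp)
    (by simp [dim, Function.update_apply, hn])
    (by simp [dim, Function.update_apply, hn]) (by simp [Function.update_apply])]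
  rw [den_fill 1 1 n (fun _ _ m => if m < n then ∑ k ∈ Finset.range n,
      ((1 - if m = k then 1 else 0 : ℕ) : ℂ) * (σ.arr 6 m k * star (σ.arr 6 m k))
      else σ.arr 7 0 m) (by simp)
    (by simp)
    (by simp [dim, Function.update_apply, hn]) (by simp [Function.update_apply])]
  refine ⟨_, _, rfl, ?_⟩
  simp only [Nat.lt_one_iff, and_self, if_true, Finset.sum_range, Fin.is_lt, offSq,
    Complex.ofReal_sum]
  refine Finset.sum_congr rfl fun i _ => Finset.sum_congr rfl fun j _ => ?_
  by_cases hij : i = j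
  · simp [hij]
  · have : (i : ℕ) ≠ j := fun h => hij (Fin.ext h)
    rw [star_mul_self_eq]
    simp [hij, this, blockMat]

theorem eval_sqNorm (x : CellExpr) : (sqNorm x).eval e σ = ((‖x.eval e σ‖ ^ 2 : ℝ) : ℂ) :=
  star_mul_self_eq _

theorem eval_halfGap : halfGap.eval e σ =
    ((((σ.arr 6 (e 4) (e 4)).re - (σ.arr 6 (e 3) (e 3)).re) / 2 : ℝ) : ℂ) := by
  simp only [halfGap, CellExpr.eval_rdiv, CellExpr.eval_sub, CellExpr.eval_get, IdxExpr.eval_env,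
    CellExpr.eval_ofNat, Complex.sub_re]
  norm_num

theorem den_rotateParams : ∃ a b, rotateParams.den e σ = (σ.setArr 9 a).setArr 10 b ∧
    a 0 0 = (jacobiParam (σ.arr 6 (e 3) (e 3)).re (σ.arr 6 (e 4) (e 4)).re
      (σ.arr 6 (e 3) (e 4)) : ℂ) ∧
    b 0 0 = (jacobiScale (σ.arr 6 (e 3) (e 3)).re (σ.arr 6 (e 4) (e 4)).re
      (σ.arr 6 (e 3) (e 4)) : ℂ) := by
  have h1 : (halfGap + rsqrt (halfGap * halfGap + sqNorm pivot)).eval e σ =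
      (jacobiParam (σ.arr 6 (e 3) (e 3)).re (σ.arr 6 (e 4) (e 4)).re
        (σ.arr 6 (e 3) (e 4)) : ℂ) := by
    simp only [CellExpr.eval_add, CellExpr.eval_rsqrt, CellExpr.eval_mul, eval_halfGap,
      eval_sqNorm, pivot, CellExpr.eval_get, IdxExpr.eval_env, ← Complex.ofReal_mul,
      ← Complex.ofReal_add, Complex.ofReal_re, jacobiParam]
    rw [← pow_two]
  simp only [rotateParams, den, h1]
  refine ⟨_, _, rfl, by simp, ?_⟩
  simp only [IdxExpr.eval_ofNat, and_self, if_true, CellExpr.eval_rdiv, CellExpr.eval_rsqrt,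
    CellExpr.eval_add, CellExpr.eval_mul, eval_sqNorm, pivot, CellExpr.eval_get, IdxExpr.eval_env,
    ArrState.setArr_arr, Nat.reduceEqDiff, if_false,
    ← Complex.ofReal_mul, ← Complex.ofReal_add, Complex.ofReal_re, jacobiScale,
    CellExpr.eval_ofNat]
  rw [← pow_two]
  norm_num

theorem den_rotate (hn : e 0 * e 0 = n) {p q : Fin n} (hp : e 3 = p) (hq : e 4 = q) (hpq : p ≠ q)
    (hy : σ.arr 9 0 0 = (jacobiParam (σ.arr 6 p p).re (σ.arr 6 q q).re (σ.arr 6 p q) : ℂ))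
    (hs : σ.arr 10 0 0 = (jacobiScale (σ.arr 6 p p).re (σ.arr 6 q q).re (σ.arr 6 p q) : ℂ)) :
    ∃ V W U, rotate.den e σ = ((σ.setArr 11 V).setArr 5 W).setArr 4 U ∧
      blockMat n U = blockMat n (σ.arr 4) * jacobiRot (blockMat n (σ.arr 6)) p q := by
  set y := jacobiParam (σ.arr 6 p p).re (σ.arr 6 q q).re (σ.arr 6 p q) with hy'
  set s := jacobiScale (σ.arr 6 p p).re (σ.arr 6 q q).re (σ.arr 6 p q) with hs'
  set b := σ.arr 6 p q with hb
  have hpq' : (p : ℕ) ≠ q := fun h => hpq (Fin.ext h)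
  let V : ℕ → ℕ → ℂ := fun i j =>
    if j = p then (if i = p then s * b else 0) + (if i = q then (s * y : ℂ) else 0)
    else if j = q then (if i = p then -(s * y : ℂ) else 0) + (if i = q then s * star b else 0)
    else if i = j then 1 else 0
  simp only [rotate, den]
  rw [den_fill (c := 11) n n 1 (fun i j _ => V i j) (by simp [dim, hn])
    (by simp [dim, hn]) (by simp) ?_]
  · rw [den_fill (c := 5) n n n (fun i j k => σ.arr 4 i k *
        if k < n ∧ j < n then ∑ _x ∈ Finset.range 1, V k j
          else σ.arr 11 k j) (by simp [dim, hn])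
      (by simp [dim, hn])
      (by simp [dim, hn]) (by simp [Function.update_apply])]
    rw [den_fill n n 1 (fun i j _ => if i < n ∧ j < n then ∑ k ∈ Finset.range n, σ.arr 4 i k *
        (if k < n ∧ j < n then ∑ _x ∈ Finset.range 1, V k j
          else σ.arr 11 k j) else σ.arr 5 i j) (by simp [dim, hn])
      (by simp [dim, hn])
      (by simp) (by simp [Function.update_apply])]
    refine ⟨_, _, _, rfl, ?_⟩
    ext i j
    rw [Matrix.mul_apply]
    simp only [blockMat, Fin.is_lt, and_self, if_true, Finset.sum_range_one]
    rw [Finset.sum_range]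
    simp only [Fin.is_lt, and_self, if_true]
    refine Finset.sum_congr rfl fun k _ => ?_
    simp only [jacobiRot, planeRot, Fin.ext_iff, V]
    rfl
  · intro i _ j _ k _ a
    simp only [CellExpr.eval_add, CellExpr.eval_mul, CellExpr.eval_nat, IdxExpr.eval_eqb,
      IdxExpr.eval_env, CellExpr.eval_get, ArrState.setArr_arr, CellExpr.eval_sub,
      IdxExpr.eval_mul, IdxExpr.eval_sub, IdxExpr.eval_ofNat, Function.update_apply, pivot,
      CellExpr.eval_conj, hp, hq, V]
    simp only [Nat.reduceEqDiff, if_true, if_false,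
      reduceIte, Nat.reduceAdd, hy, hs, ← hb, hp, hq]
    by_cases h1 : j = p <;> by_cases h2 : j = q <;> by_cases h3 : i = p <;> by_cases h4 : i = q <;>
      by_cases h5 : i = j <;> simp_all

/-- What the main loop of the eigenvalue method leaves unchanged. -/
structure SameInput (σ σ' : ArrState) : Prop where
  nat : σ'.nat = σ.nat
  inp : σ'.inp = σ.inp
  arr0 : σ'.arr 0 = σ.arr 0
  arr1 : σ'.arr 1 = σ.arr 1

theorem SameInput.trans {σ σ' σ'' : ArrState} (h : SameInput σ σ') (h' : SameInput σ' σ'') :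
    SameInput σ σ'' :=
  ⟨h'.nat.trans h.nat, h'.inp.trans h.inp, h'.arr0.trans h.arr0, h'.arr1.trans h.arr1⟩

theorem den_step (hn : e 0 * e 0 = n) {p q : Fin n} (hp : e 3 = p) (hq : e 4 = q) :
    SameInput σ (step.den e σ) ∧ blockMat n ((step.den e σ).arr 4) =
      jacobiStep (blockMat n (σ.arr 0)) p q (blockMat n (σ.arr 4)) := by
  obtain ⟨W, A, h1, hA⟩ := den_conjugate (σ := σ) (l := 5) (by norm_num) hn
  obtain ⟨r, o, h2, ho⟩ := den_offDiag (σ := (conjugate 5).den e σ) hn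
  have h3 : step.den e σ = (Code.ite rotateGuard (rotateParams ;; rotate) .skip).den e
    ((((σ.setArr 5 W).setArr 6 A).setArr 7 r).setArr 8 o) := by rw [← h1, ← h2]; rfl
  have ho' : o 0 0 = (offSq (blockMat n A) : ℂ) := by rw [ho, h1]; simp
  set τ := (((σ.setArr 5 W).setArr 6 A).setArr 7 r).setArr 8 o with hτ
  have hτ6 : τ.arr 6 = A := by simp [hτ]
  have hτ4 : τ.arr 4 = σ.arr 4 := by simp [hτ]
  have hτ8 : τ.arr 8 = o := by simp [hτ]
  have hsame : SameInput σ τ := by constructor <;> simp [hτ]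
  have hguard : rotateGuard.holds e τ ↔ p ≠ q ∧ 0 < ‖blockMat n A p q‖ ^ 2 ∧
      ¬ (n ^ 2 * ‖blockMat n A p q‖ ^ 2 < offSq (blockMat n A)) := by
    simp only [rotateGuard, Guard.holds, IdxExpr.eval_eqb, IdxExpr.eval_env, hp, hq,
      IdxExpr.eval_ofNat, eval_sqNorm, pivot, CellExpr.eval_get, hτ6, CellExpr.eval_mul,
      CellExpr.eval_nat, IdxExpr.eval_mul, dim, hn, hτ8, ho', CellExpr.eval_ofNat,
      Complex.ofReal_re, ← Complex.ofReal_natCast, ← Complex.ofReal_mul, Fin.ext_iff]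
    have e1 : ‖A p q‖ = ‖blockMat n A p q‖ := rfl
    rw [e1]
    have e2 : (((n * n : ℕ) : ℝ)) = (n : ℝ) ^ 2 := by push_cast; ring
    rw [e2]
    norm_num [Fin.ext_iff]
  rw [h3]
  unfold jacobiStep
  simp only [← hA]
  by_cases hg : rotateGuard.holds e τ
  · rw [if_pos (hguard.1 hg)]
    simp only [den, if_pos hg]
    obtain ⟨a, b, h4, ha, hb⟩ := den_rotateParams (e := e) (σ := τ)
    rw [h4]
    rw [hτ6, hp, hq] at ha hb
    obtain ⟨V, W', U, h5, hU⟩ := den_rotate (σ := (τ.setArr 9 a).setArr 10 b) hn hp hq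
      (hguard.1 hg).1 (by simpa [hτ6] using ha) (by simpa [hτ6] using hb)
    rw [h5]
    refine ⟨hsame.trans (by constructor <;> simp), ?_⟩
    simpa [hτ6, hτ4] using hU
  · rw [if_neg (mt hguard.2 hg)]
    simp only [den, if_neg hg]
    exact ⟨hsame, by rw [hτ4]⟩

theorem den_jacobi {k X d : ℕ} (h0 : e 0 = d) (h1 : e 1 = X) :
    SameInput σ ((jacobi k).den e σ) ∧
      blockMat (d * d) (((jacobi k).den e σ).arr 4) =
        (jacobiSweep (blockMat (d * d) (σ.arr 0)))^[d * d * (d * d) * (X + 2 * (d ^ k + 10))] 1 ∧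
      blockMat (d * d) (((jacobi k).den e σ).arr 6) =
        (blockMat (d * d) (((jacobi k).den e σ).arr 4))ᴴ * blockMat (d * d) (σ.arr 0) *
          blockMat (d * d) (((jacobi k).den e σ).arr 4) := by
  have hn : e 0 * e 0 = d * d := by rw [h0]
  set n := d * d with hnd
  set Q := blockMat n (σ.arr 0) with hQ
  simp only [jacobi, den]
  rw [den_fill (c := 4) n n 1 (fun i j _ => if i = j then 1 else 0) (by simp [dim, hn])
    (by simp [dim, hn]) (by simp) (by simp [Function.update_apply])]
  set σ₁ := σ.setArr 4 (fun i j => if i < n ∧ j < n then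
    ∑ _x ∈ Finset.range 1, (if i = j then (1 : ℂ) else 0) else σ.arr 4 i j) with hσ₁
  have hJ : (dim * dim * (env 1 + 2 * precExp k)).eval e σ₁ = n * n * (X + 2 * (d ^ k + 10)) := by
    simp [dim, precExp, h0, h1, hnd]
  rw [hJ]
  set f := fun (i : ℕ) s => iterIdx
    (fun i_1 s => iterIdx
      (fun i_2 s => den (Function.update (Function.update (Function.update e 2 i) 3 i_1) 4 i_2)
        step s)
      (dim.eval (Function.update (Function.update e 2 i) 3 i_1) s) s)
    (dim.eval (Function.update e 2 i) s) s with hf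
  have hU₁ : blockMat n (σ₁.arr 4) = 1 := by
    ext i j
    simp [hσ₁, blockMat, Matrix.one_apply, Fin.ext_iff]
  have key : ∀ J, SameInput σ (iterIdx f J σ₁) ∧
      blockMat n ((iterIdx f J σ₁).arr 4) = (jacobiSweep Q)^[J] 1 := by
    intro J
    induction J with
    | zero => exact ⟨by constructor <;> simp [hσ₁], hU₁⟩
    | succ J ih =>
      rw [iterIdx_succ, Function.iterate_succ_apply', ← ih.2]
      set τ := iterIdx f J σ₁ with hτ
      have hd1 : ∀ s, dim.eval (Function.update e 2 J) s = n := by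
        intro s; simp [dim, Function.update_apply, hn]
      have hd2 : ∀ i s, dim.eval (Function.update (Function.update e 2 J) 3 i) s = n := by
        intro i s; simp [dim, Function.update_apply, hn]
      simp only [hf, hd1, hd2]
      have inner : ∀ p (hp : p < n) m (_ : m ≤ n) s, SameInput σ s →
          SameInput σ (iterIdx (fun q s => den (Function.update (Function.update
            (Function.update e 2 J) 3 p) 4 q) step s) m s) ∧
          blockMat n ((iterIdx (fun q s => den (Function.update (Function.update
            (Function.update e 2 J) 3 p) 4 q) step s) m s).arr 4) =
          iterIdx (fun q U => if h : p < n ∧ q < n then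
            jacobiStep Q ⟨p, h.1⟩ ⟨q, h.2⟩ U else U) m (blockMat n (s.arr 4)) := by
        intro p hp m hm s hs
        induction m with
        | zero => exact ⟨hs, rfl⟩
        | succ m ihm =>
          obtain ⟨i1, i2⟩ := ihm (by omega)
          rw [iterIdx_succ, iterIdx_succ, ← i2, dif_pos ⟨hp, by omega⟩]
          have := den_step (σ := iterIdx (fun q s => den (Function.update (Function.update
            (Function.update e 2 J) 3 p) 4 q) step s) m s) (e := Function.update (Function.update
            (Function.update e 2 J) 3 p) 4 m) (n := n) (p := ⟨p, hp⟩) (q := ⟨m, by omega⟩)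
            (by simp [Function.update_apply, hn]) (by simp [Function.update_apply])
            (by simp [Function.update_apply])
          refine ⟨i1.trans this.1, ?_⟩
          rw [this.2, i1.arr0]
      have outer : ∀ m ≤ n, SameInput σ (iterIdx (fun p s => iterIdx (fun q s =>
            den (Function.update (Function.update (Function.update e 2 J) 3 p) 4 q) step s) n s)
            m τ) ∧
          blockMat n ((iterIdx (fun p s => iterIdx (fun q s =>
            den (Function.update (Function.update (Function.update e 2 J) 3 p) 4 q) step s) n s)
            m τ).arr 4) =
          iterIdx (fun p U => iterIdx (fun q U => if h : p < n ∧ q < n then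
            jacobiStep Q ⟨p, h.1⟩ ⟨q, h.2⟩ U else U) n U) m (blockMat n (τ.arr 4)) := by
        intro m hm
        induction m with
        | zero => exact ⟨ih.1, rfl⟩
        | succ m ihm =>
          obtain ⟨i1, i2⟩ := ihm (by omega)
          have := inner m (by omega) n le_rfl _ i1
          rw [iterIdx_succ, iterIdx_succ, ← i2]
          exact this
      exact outer n le_rfl
  obtain ⟨k1, k2⟩ := key (n * n * (X + 2 * (d ^ k + 10)))
  set τ := iterIdx f (n * n * (X + 2 * (d ^ k + 10))) σ₁ with hτ
  obtain ⟨W, A, h2, hA⟩ := den_conjugate (σ := τ) (l := 2) (by norm_num) hn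
  have h3 : den e (conjugate 2) τ = (τ.setArr 5 W).setArr 6 A := h2
  rw [h3]
  refine ⟨k1.trans (by constructor <;> simp), ?_, ?_⟩
  · simpa using k2
  · simp only [ArrState.setArr_arr, Nat.reduceEqDiff, if_false, if_true]
    rw [hA, k1.arr0]

end
end SepProgram

/-! ## The search over the grid -/

/-- The number of grid points in a unit interval. -/
def gridRadius (X : ℕ) : ℕ := 32 * X + 1

/-- The number of grid points on an axis. -/
def gridSize (X : ℕ) : ℕ := 2 * gridRadius X + 1

/-- The grid coordinate of a digit. -/
noncomputable def gridCoord (X g : ℕ) : ℝ := ((g : ℝ) - gridRadius X) / gridRadius X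

open Classical in
/-- The grid point number `c`; its coordinates outside `Γ` are zero. -/
noncomputable def gridPoint (X : ℕ) (Γ : ℕ → Prop) (c t : ℕ) : ℂ :=
  if Γ t then
    (gridCoord X (c / gridSize X ^ (2 * Nat.count Γ t) % gridSize X) : ℂ) +
      Complex.I * gridCoord X (c / gridSize X ^ (2 * Nat.count Γ t + 1) % gridSize X)
  else 0

/-- The squared norm of the grid point number `c` in `n` coordinates. -/
noncomputable def gridSqNorm (n X : ℕ) (Γ : ℕ → Prop) (c : ℕ) : ℝ :=
  ∑ t ∈ Finset.range n, ‖gridPoint X Γ c t‖ ^ 2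

/-- The approximation of the largest squared Schmidt coefficient by the `p`-th iterated square root
of the trace of the `2 ^ p`-th power of the reduced matrix. -/
noncomputable def traceRoot {d : ℕ} (p : ℕ) (Φ : Matrix (Fin d) (Fin d) ℂ) : ℝ :=
  Real.sqrt^[p] ((Φ * Φᴴ) ^ 2 ^ p).trace.re

/-- The matrix of the vector `∑ k, (α k)^* √(lam k) Ψ k`, where the vectors `Ψ k` are the columns
of `U`. -/
noncomputable def combMatrix (d : ℕ) (α : ℕ → ℂ) (lam : ℕ → ℝ) (U : ℕ → ℕ → ℂ) :
    Matrix (Fin d) (Fin d) ℂ := fun i j =>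
  ∑ k ∈ Finset.range (d * d), star (α k) * (Real.sqrt (lam k) : ℂ) * U (i * d + j) k

/-- `Γ`, for eigenvalues on the diagonal of `A`. -/
def largeSet (A : ℕ → ℕ → ℂ) (δ : ℝ) (t : ℕ) : Prop := δ / 2 ≤ (A t t).re

namespace SepProgram
open IdxExpr CellExpr Code

section
variable {e : ℕ → ℕ} {σ : ArrState} {n d X : ℕ} {δ : ℝ}

theorem small_holds (l : ℕ) (hδ : σ.arr 1 0 0 = δ) :
    (small l).holds e σ ↔ ¬ largeSet (σ.arr 6) δ (e l) := by
  simp [small, hδ, largeSet]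

theorem gridBase_eval (h1 : e 1 = X) : gridBase.eval e σ = gridSize X := by
  simp [gridBase, gridHalf, gridSize, gridRadius, h1]

open Classical in
theorem den_countGrid (hn : e 0 * e 0 = n) (h1 : e 1 = X) (hδ : σ.arr 1 0 0 = δ) :
    countGrid.den e σ = σ.setNat 1 (gridSize X ^ (2 * Nat.count (largeSet (σ.arr 6) δ) n)) := by
  simp only [countGrid, den]
  have hN : dim.eval e (σ.setNat 1 1) = n := by simp [dim, hn]
  have h0 : σ.setNat 1 (IdxExpr.eval e σ 1) = σ.setNat 1
      (gridSize X ^ (2 * Nat.count (largeSet (σ.arr 6) δ) 0)) := by simp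
  rw [h0]
  have hN' : ∀ v, dim.eval e (σ.setNat 1 v) = n := fun v => by simp [dim, hn]
  rw [hN']
  refine iterIdx_eq (P := fun t => σ.setNat 1
    (gridSize X ^ (2 * Nat.count (largeSet (σ.arr 6) δ) t))) fun t _ => ?_
  rw [small_holds 2 (δ := δ) (by simpa using hδ)]
  simp only [Function.update_self, ArrState.setNat_arr, Nat.count_succ]
  by_cases ht : largeSet (σ.arr 6) δ t
  · have hB := fun τ => gridBase_eval (e := Function.update e 2 t) (X := X) (σ := τ)
      (by simp [h1])
    simp only [ht, not_true_eq_false, if_false, if_true, IdxExpr.eval_mul, hB, IdxExpr.eval_var,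
      ArrState.setNat_nat, ArrState.setNat, Function.update_idem, Function.update_self]
    congr 2
    ring
  · simp [ht]

theorem den_divide (h1 : e 1 = X) (h2 : σ.nat 2 ≤ e 2) :
    divide.den e σ = σ.setNat 3 (σ.nat 2 / gridSize X) := by
  have hB0 : 0 < gridSize X := by simp [gridSize]
  simp only [divide, den, IdxExpr.eval_env]
  have h0 : σ.setNat 3 (IdxExpr.eval e σ 0) = σ.setNat 3 (min 0 (σ.nat 2 / gridSize X)) := by simp
  have hE : min (e 2) (σ.nat 2 / gridSize X) = σ.nat 2 / gridSize X :=
    min_eq_right ((Nat.div_le_self _ _).trans h2)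
  rw [h0, ← hE]
  -- The counter grows by one per round until it reaches the quotient and then stays; the quotient
  -- is at most the dividend, hence at most the number `e 2` of rounds.
  refine iterIdx_eq (P := fun k => σ.setNat 3 (min k (σ.nat 2 / gridSize X))) fun k _ => ?_
  have hB := fun τ => gridBase_eval (e := Function.update e 5 k) (X := X) (σ := τ)
    (by simp [h1])
  simp only [Guard.holds, IdxExpr.eval_mul, hB, IdxExpr.eval_var, IdxExpr.eval_add,
    ArrState.setNat_nat, IdxExpr.eval_ofNat, Nat.reduceEqDiff, if_true, if_false]
  have hiff : σ.nat 2 < gridSize X * (min k (σ.nat 2 / gridSize X) + 1) ↔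
      σ.nat 2 / gridSize X < min k (σ.nat 2 / gridSize X) + 1 := by
    rw [mul_comm, ← Nat.div_lt_iff_lt_mul hB0]
  simp only [hiff]
  split_ifs with h
  · congr 1; omega
  · simp only [ArrState.setNat, Function.update_idem]
    congr 2; omega

theorem eval_coord {c j : ℕ} (h1 : e 1 = X) (h2 : σ.nat 2 = c / gridSize X ^ j)
    (h3 : σ.nat 3 = σ.nat 2 / gridSize X) :
    coord.eval e σ = (gridCoord X (c / gridSize X ^ j % gridSize X) : ℂ) := by
  have h4 : (var 2 - gridBase * var 3).eval e σ = c / gridSize X ^ j % gridSize X := by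
    simp only [IdxExpr.eval_sub, IdxExpr.eval_mul, gridBase_eval h1, IdxExpr.eval_var, h3, h2]
    have := Nat.div_add_mod (c / gridSize X ^ j) (gridSize X)
    omega
  have h5 : gridHalf.eval e σ = gridRadius X := by simp [gridHalf, gridRadius, h1]
  simp only [coord, CellExpr.eval_rdiv, CellExpr.eval_sub, CellExpr.eval_nat, h4, h5, gridCoord,
    Complex.sub_re, Complex.natCast_re]

theorem den_point {c : ℕ} (hn : e 0 * e 0 = n) (h1 : e 1 = X) (hδ : σ.arr 1 0 0 = δ)
    (h3 : e 3 = c) (hc : c ≤ e 2) :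
    (∀ a, a ≠ 12 → a ≠ 13 → (point.den e σ).arr a = σ.arr a) ∧
    (∀ t < n, (point.den e σ).arr 12 0 t = gridPoint X (largeSet (σ.arr 6) δ) c t) ∧
    (point.den e σ).arr 13 0 0 = (gridSqNorm n X (largeSet (σ.arr 6) δ) c : ℂ) := by
  classical
  set Γ := largeSet (σ.arr 6) δ with hΓ
  set B := gridSize X with hB
  simp only [point, den]
  set τ₀ := σ.setNat 2 ((env 3).eval e σ) with hτ₀
  have hN : dim.eval e τ₀ = n := by simp [dim, hn]
  rw [hN]
  set τ := iterIdx _ n τ₀ with hτ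
  have key : (∀ a, a ≠ 12 → τ.arr a = σ.arr a) ∧ τ.nat 2 = c / B ^ (2 * Nat.count Γ n) ∧
      ∀ t < n, τ.arr 12 0 t = gridPoint X Γ c t := by
    refine iterIdx_induction (P := fun m (τ : ArrState) => (∀ a, a ≠ 12 → τ.arr a = σ.arr a) ∧
      τ.nat 2 = c / B ^ (2 * Nat.count Γ m) ∧ ∀ t < m, τ.arr 12 0 t = gridPoint X Γ c t) ?_ ?_
    · refine ⟨fun a _ => by simp [hτ₀], by simp [hτ₀, h3], by simp⟩
    · rintro m ρ hm ⟨i1, i2, i3⟩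
      have hs : (small 4).holds (Function.update e 4 m) ρ ↔ ¬ Γ m := by
        rw [small_holds 4 (δ := δ) (by rw [i1 1 (by norm_num), hδ]), i1 6 (by norm_num)]
        simp [hΓ]
      simp only [hs]
      by_cases hm' : Γ m
      · simp only [hm', not_true_eq_false, if_false]
        have e1 : Function.update e 4 m 1 = X := by simp [h1]
        have e2 : Function.update e 4 m 2 = e 2 := by simp
        have b1 : ρ.nat 2 ≤ e 2 := by rw [i2]; exact (Nat.div_le_self _ _).trans hc
        rw [den_divide (σ := ρ) e1 (by rw [e2]; exact b1)]
        set ρ₁ := ρ.setNat 3 (ρ.nat 2 / gridSize X) with hρ₁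
        have c1 : coord.eval (Function.update e 4 m) ρ₁ =
            (gridCoord X (c / B ^ (2 * Nat.count Γ m) % B) : ℂ) :=
          eval_coord (j := 2 * Nat.count Γ m) e1 (by simp [hρ₁, i2, hB]) (by simp [hρ₁])
        rw [c1]
        set ρ₂ := (ρ₁.setArr 12 (fun i' j' => if i' = (0 : IdxExpr).eval (Function.update e 4 m) ρ₁ ∧
          j' = (env 4).eval (Function.update e 4 m) ρ₁ then
            (gridCoord X (c / B ^ (2 * Nat.count Γ m) % B) : ℂ) else ρ₁.arr 12 i' j')) with hρ₂
        set ρ₃ := ρ₂.setNat 2 ((var 3).eval (Function.update e 4 m) ρ₂) with hρ₃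
        have n3 : ρ₃.nat 2 = c / B ^ (2 * Nat.count Γ m + 1) := by
          simp [hρ₃, hρ₂, hρ₁, i2, Nat.div_div_eq_div_mul, pow_succ, hB]
        rw [den_divide (σ := ρ₃) e1 (by rw [e2, n3]; exact (Nat.div_le_self _ _).trans hc)]
        set ρ₄ := ρ₃.setNat 3 (ρ₃.nat 2 / gridSize X) with hρ₄
        have c2 : coord.eval (Function.update e 4 m) ρ₄ =
            (gridCoord X (c / B ^ (2 * Nat.count Γ m + 1) % B) : ℂ) :=
          eval_coord (j := 2 * Nat.count Γ m + 1) e1 (by simp [hρ₄, n3, hB]) (by simp [hρ₄])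
        have a4 : ρ₄.arr = ρ₂.arr := by simp [hρ₄, hρ₃]
        refine ⟨fun a ha => ?_, ?_, fun t ht => ?_⟩
        · simp [ha, a4, hρ₂, hρ₁, i1 a ha]
        · simp only [ArrState.setNat_nat, if_true, IdxExpr.eval_var, ArrState.setArr_nat, hρ₄,
            n3, Nat.count_succ, hm', Nat.div_div_eq_div_mul]
          congr 1
        · simp only [ArrState.setNat_arr, ArrState.setArr_same, IdxExpr.eval_ofNat,
            IdxExpr.eval_env, Function.update_self, true_and, CellExpr.eval_add,
            CellExpr.eval_get, CellExpr.eval_mul, CellExpr.eval_I, c2, a4, hρ₂, if_true]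
          rcases Nat.lt_succ_iff_lt_or_eq.1 ht with h | rfl
          · have : t ≠ m := by omega
            simp only [this, if_false]
            exact i3 t h
          · simp [gridPoint, hm', hB]
      · simp only [hm', not_false_eq_true, if_true]
        refine ⟨fun a ha => by simp [ha, i1 a ha], by simp [i2, Nat.count_succ, hm'],
          fun t ht => ?_⟩
        simp only [ArrState.setArr_same, IdxExpr.eval_ofNat,
            IdxExpr.eval_env, Function.update_self, true_and]
        rcases Nat.lt_succ_iff_lt_or_eq.1 ht with h | rfl
        · have : t ≠ m := by omega
          simp only [this, if_false]
          exact i3 t h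
        · simp [gridPoint, hm']
  obtain ⟨k1, k2, k3⟩ := key
  rw [den_fill 1 1 n (fun _ _ k => ((‖τ.arr 12 0 k‖ ^ 2 : ℝ) : ℂ)) (by simp) (by simp)
    (by simp [dim, hn]) (by intros; rw [eval_sqNorm]; simp [Function.update_apply])]
  refine ⟨fun a h12 h13 => by simp [h13, k1 a h12], fun t ht => by simpa using k3 t ht, ?_⟩
  simp only [ArrState.setArr_same, Nat.lt_one_iff, and_self, if_true, gridSqNorm,
    Complex.ofReal_sum]
  refine Finset.sum_congr rfl fun k hk => ?_
  rw [k3 k (Finset.mem_range.1 hk)]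

theorem den_squarings (N : IdxExpr) (h0 : e 0 = d) :
    ∃ a b, (squarings N).den e σ = (σ.setArr 16 a).setArr 15 b ∧
      blockMat d b = blockMat d (σ.arr 15) ^ 2 ^ N.eval e σ := by
  simp only [squarings, den]
  refine iterIdx_induction (P := fun m ρ => ∃ a b, ρ = (σ.setArr 16 a).setArr 15 b ∧
    blockMat d b = blockMat d (σ.arr 15) ^ 2 ^ m) ⟨σ.arr 16, σ.arr 15, by simp, by simp⟩ ?_
  rintro m _ _ ⟨a, b, rfl, hb⟩
  rw [den_fill (c := 16) d d d (fun i j k => b i k * b k j) (by simp [h0]) (by simp [h0])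
    (by simp [h0]) (by simp [Function.update_apply])]
  rw [den_fill (c := 15) d d 1 (fun i j _ => if i < d ∧ j < d then
    ∑ k ∈ Finset.range d, b i k * b k j else a i j) (by simp [h0]) (by simp [h0])
    (by simp) (by simp [Function.update_apply])]
  refine ⟨fun i j => if i < d ∧ j < d then ∑ k ∈ Finset.range d, b i k * b k j else a i j,
    fun i j => if i < d ∧ j < d then ∑ k ∈ Finset.range d, b i k * b k j else b i j, ?_, ?_⟩
  · simp only [ArrState.setArr, Finset.sum_range_one]
    congr 1
    funext c
    by_cases h15 : c = 15
    · subst h15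
      simp only [Function.update_self]
      funext i j
      split_ifs <;> simp
    · by_cases h16 : c = 16
      · subst h16; simp
      · simp [h15, h16]
  · rw [blockMat_mul, hb, ← pow_add]; congr 1; ring

theorem den_roots (N : IdxExpr) : ∃ a, (roots N).den e σ = σ.setArr 17 a ∧
    (a 0 0).re = Real.sqrt^[N.eval e σ] (σ.arr 17 0 0).re := by
  simp only [roots, den]
  refine iterIdx_induction (P := fun m s => ∃ a, s = σ.setArr 17 a ∧
    (a 0 0).re = Real.sqrt^[m] (σ.arr 17 0 0).re) ⟨σ.arr 17, by simp, rfl⟩ ?_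
  rintro m _ _ ⟨a, rfl, ha⟩
  refine ⟨_, ArrState.setArr_setArr _ _ _ _, ?_⟩
  rw [Function.iterate_succ_apply', ← ha]
  simp

theorem den_schmidt {k : ℕ} (h0 : e 0 = d) (h1 : e 1 = X) :
    (∀ a, a ∉ Finset.Icc 14 17 → ((schmidt k).den e σ).arr a = σ.arr a) ∧
    (((schmidt k).den e σ).arr 17 0 0).re = traceRoot (d + X + 1 + (d ^ k + 10))
      (combMatrix d (σ.arr 12 0) (fun t => (σ.arr 6 t t).re) (σ.arr 4)) := by
  set p := d + X + 1 + (d ^ k + 10) with hp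
  set Φ := combMatrix d (σ.arr 12 0) (fun t => (σ.arr 6 t t).re) (σ.arr 4) with hΦ
  have hP : ∀ τ, (powers k).eval e τ = p := by intro τ; simp [powers, precExp, h0, h1, hp]
  have hS : ∃ a b, (fill 4 14 (env 0) (env 0) dim
      (conj (get 12 0 (env 6)) * rsqrt (get 6 (env 6) (env 6)) *
        get 4 (env 4 * env 0 + env 5) (env 6)) ;;
      fill 4 15 (env 0) (env 0) (env 0) (get 14 (env 4) (env 6) * conj (get 14 (env 5) (env 6)))).den
        e σ = (σ.setArr 14 a).setArr 15 b ∧ blockMat d b = Φ * Φᴴ := by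
    simp only [den]
    rw [den_fill (c := 14) d d (d * d) (fun i j k => star (σ.arr 12 0 k) *
      (Real.sqrt (σ.arr 6 k k).re : ℂ) * σ.arr 4 (i * d + j) k) (by simp [h0]) (by simp [h0])
      (by simp [dim, h0]) (by simp [Function.update_apply, h0])]
    rw [den_fill (c := 15) d d d (fun i j m => (if i < d ∧ m < d then ∑ k ∈ Finset.range (d * d),
      star (σ.arr 12 0 k) * (Real.sqrt (σ.arr 6 k k).re : ℂ) * σ.arr 4 (i * d + m) k
        else σ.arr 14 i m) * star (if j < d ∧ m < d then ∑ k ∈ Finset.range (d * d),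
      star (σ.arr 12 0 k) * (Real.sqrt (σ.arr 6 k k).re : ℂ) * σ.arr 4 (j * d + m) k
        else σ.arr 14 j m)) (by simp [h0]) (by simp [h0]) (by simp [h0])
      (by simp [Function.update_apply])]
    refine ⟨_, _, rfl, ?_⟩
    ext i j
    rw [Matrix.mul_apply]
    simp only [blockMat, Fin.is_lt, and_self, if_true]
    rw [Finset.sum_range]
    refine Finset.sum_congr rfl fun m _ => ?_
    simp only [Fin.is_lt, and_self, if_true, Matrix.conjTranspose_apply, hΦ, combMatrix]
  obtain ⟨a, b, hab, hb⟩ := hS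
  set τ := (σ.setArr 14 a).setArr 15 b with hτ
  obtain ⟨a', b', hρ, hb'⟩ := den_squarings (e := e) (σ := τ) (powers k) h0
  rw [hP, hτ, ArrState.setArr_same, hb] at hb'
  have e1 : (schmidt k).den e σ = (fill 4 17 1 1 (env 0) (get 15 (env 6) (env 6)) ;;
      roots (powers k)).den e ((τ.setArr 16 a').setArr 15 b') := by rw [← hρ, ← hab]; rfl
  rw [e1]
  set ρ := (τ.setArr 16 a').setArr 15 b' with hρ'
  rw [den]
  rw [den_fill (c := 17) 1 1 d (fun _ _ k => b' k k) (by simp) (by simp) (by simp [h0])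
    (by simp [hρ', Function.update_apply])]
  set ρ₂ := ρ.setArr 17 _ with hρ₂
  have hr : (ρ₂.arr 17 0 0).re = ((Φ * Φᴴ) ^ 2 ^ p).trace.re := by
    rw [← hb', hρ₂, ArrState.setArr_same, Matrix.trace]
    simp [blockMat, Finset.sum_range]
  obtain ⟨a'', h5, h6⟩ := den_roots (e := e) (σ := ρ₂) (powers k)
  rw [h5]
  refine ⟨fun c hc => ?_, ?_⟩
  · have : c ≠ 14 ∧ c ≠ 15 ∧ c ≠ 16 ∧ c ≠ 17 := by
      simp only [Finset.mem_Icc] at hc; omega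
    simp [this, hρ₂, hρ', hτ]
  · rw [ArrState.setArr_same, h6, hr, hP]; rfl

/-- The alternative `opt = 0` is the initial value of the running maximum; it is turned into an
attained value once the net is known to be nonempty and its values nonnegative. -/
theorem den_search {k : ℕ} (h0 : e 0 = d) (h1 : e 1 = X) (hδ : σ.arr 1 0 0 = δ) :
    let s : ℕ → ℝ := fun c => traceRoot (d + X + 1 + (d ^ k + 10))
      (combMatrix d (gridPoint X (largeSet (σ.arr 6) δ) c) (fun t => (σ.arr 6 t t).re) (σ.arr 4))
    let ok : ℕ → Prop := fun c => c < e 2 ∧ gridSqNorm (d * d) X (largeSet (σ.arr 6) δ) c ≤ 1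
    let opt := (((search k).den e σ).arr 18 0 0).re
    (opt = 0 ∨ ∃ c, ok c ∧ s c = opt) ∧ 0 ≤ opt ∧ ∀ c, ok c → s c ≤ opt := by
  intro s ok opt
  have key : ∀ m ≤ e 2, ∀ τ, τ = iterIdx (fun c s => (point ;; .ite (.reLt 1 (get 13 0 0)) .skip
      (schmidt k ;; .ite (.reLt (get 18 0 0) (get 17 0 0))
        (.store 18 0 0 (get 17 0 0)) .skip)).den (Function.update e 3 c) s) m
      (σ.setArr 18 (fun i j => if i = 0 ∧ j = 0 then 0 else σ.arr 18 i j)) →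
      (∀ a < 12, τ.arr a = σ.arr a) ∧
      ((τ.arr 18 0 0).re = 0 ∨ ∃ c, ok c ∧ s c = (τ.arr 18 0 0).re) ∧ 0 ≤ (τ.arr 18 0 0).re ∧
        ∀ c < m, ok c → s c ≤ (τ.arr 18 0 0).re := by
    intro m hm
    induction m with
    | zero =>
      rintro τ rfl
      refine ⟨fun a ha => ?_, Or.inl (by simp), by simp, by simp⟩
      have : a ≠ 18 := by omega
      simp [this]
    | succ m ih =>
      rintro τ rfl
      rw [iterIdx_succ]
      obtain ⟨i1, i2, i3, i4⟩ := ih (by omega) _ rfl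
      set ρ := iterIdx _ m _ with hρ
      set e' := Function.update e 3 m with he'
      have e0 : e' 0 = d := by simp [he', h0]
      have e1 : e' 1 = X := by simp [he', h1]
      have e2 : e' 2 = e 2 := by simp [he']
      have e3 : e' 3 = m := by simp [he']
      obtain ⟨p1, p2, p3⟩ := den_point (e := e') (σ := ρ) (c := m) (n := d * d) (δ := δ)
        (by rw [e0]) e1 (by rw [i1 1 (by norm_num), hδ]) e3 (by omega)
      rw [i1 6 (by norm_num)] at p2 p3
      rw [den]
      set ρ₁ := point.den e' ρ with hρ₁
      have q18 : ρ₁.arr 18 = ρ.arr 18 := p1 18 (by norm_num) (by norm_num)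
      have q12 : ∀ a < 12, ρ₁.arr a = σ.arr a := fun a ha => by
        rw [p1 a (by omega) (by omega), i1 a ha]
      rw [den]
      have hg : (Guard.reLt 1 (get 13 0 0)).holds e' ρ₁ ↔
          ¬ gridSqNorm (d * d) X (largeSet (σ.arr 6) δ) m ≤ 1 := by
        simp [p3]
      by_cases hok : gridSqNorm (d * d) X (largeSet (σ.arr 6) δ) m ≤ 1
      · rw [if_neg (by rw [hg]; exact not_not.2 hok)]
        obtain ⟨s1, s2⟩ := den_schmidt (k := k) (e := e') (σ := ρ₁) e0 e1
        rw [den]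
        set ρ₂ := (schmidt k).den e' ρ₁ with hρ₂
        have r18 : ρ₂.arr 18 = ρ.arr 18 := by rw [s1 18 (by simp), q18]
        have r12 : ∀ a < 12, ρ₂.arr a = σ.arr a := fun a ha => by
          rw [s1 a (by simp only [Finset.mem_Icc]; omega), q12 a ha]
        have hs : (ρ₂.arr 17 0 0).re = s m := by
          rw [s2]
          have : combMatrix d (ρ₁.arr 12 0) (fun t => (ρ₁.arr 6 t t).re) (ρ₁.arr 4) =
              combMatrix d (gridPoint X (largeSet (σ.arr 6) δ) m) (fun t => (σ.arr 6 t t).re)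
                (σ.arr 4) := by
            ext i j
            rw [q12 6 (by norm_num), q12 4 (by norm_num)]
            refine Finset.sum_congr rfl fun t ht => ?_
            rw [p2 t (Finset.mem_range.1 ht)]
          rw [this]
        have hokm : ok m := ⟨by omega, hok⟩
        rw [den]
        have hg2 : (Guard.reLt (get 18 0 0) (get 17 0 0)).holds e' ρ₂ ↔
            (ρ.arr 18 0 0).re < s m := by
          simp [r18, hs]
        by_cases hlt : (ρ.arr 18 0 0).re < s m
        · rw [if_pos (hg2.2 hlt)]
          have hval : (((Code.store 18 0 0 (get 17 0 0)).den e' ρ₂).arr 18 0 0).re = s m := by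
            simp [den, hs]
          rw [hval]
          refine ⟨fun a ha => ?_, Or.inr ⟨m, hokm, rfl⟩, i3.trans hlt.le, fun c hc hokc => ?_⟩
          · have : a ≠ 18 := by omega
            simp [den, this, r12 a ha]
          · rcases Nat.lt_succ_iff_lt_or_eq.1 hc with h | rfl
            · exact (i4 c h hokc).trans hlt.le
            · exact le_rfl
        · rw [if_neg (mt hg2.1 hlt)]
          simp only [den]
          rw [r18]
          refine ⟨r12, i2, i3, fun c hc hokc => ?_⟩
          rcases Nat.lt_succ_iff_lt_or_eq.1 hc with h | rfl
          · exact i4 c h hokc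
          · exact not_lt.1 hlt
      · rw [if_pos (hg.2 hok)]
        simp only [den]
        rw [q18]
        refine ⟨q12, i2, i3, fun c hc hokc => ?_⟩
        rcases Nat.lt_succ_iff_lt_or_eq.1 hc with h | rfl
        · exact i4 c h hokc
        · exact absurd hokc.2 hok
  have hfin := (key (e 2) le_rfl _ rfl).2
  have hopt : opt = ((iterIdx (fun c s => (point ;; .ite (.reLt 1 (get 13 0 0)) .skip
      (schmidt k ;; .ite (.reLt (get 18 0 0) (get 17 0 0))
        (.store 18 0 0 (get 17 0 0)) .skip)).den (Function.update e 3 c) s) (e 2)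
      (σ.setArr 18 (fun i j => if i = 0 ∧ j = 0 then 0 else σ.arr 18 i j))).arr 18 0 0).re := by
    simp only [opt, search]
    rw [den]
    have : (Code.store 18 0 0 0).den e σ =
        σ.setArr 18 (fun i j => if i = 0 ∧ j = 0 then 0 else σ.arr 18 i j) := by
      simp [den]
    rw [this]; rfl
  rw [← hopt] at hfin
  exact ⟨hfin.1, hfin.2.1, fun c hc => hfin.2.2 c hc.1 hc⟩

end
end SepProgram

/-! ## The whole program -/

/-- The input matrix with the coordinates numbered consecutively. -/
def flatten {d : ℕ} (Q : Matrix (Fin d × Fin d) (Fin d × Fin d) ℂ) :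
    Matrix (Fin (d * d)) (Fin (d * d)) ℂ :=
  Q.submatrix finProdFinEquiv.symm finProdFinEquiv.symm

theorem frobNorm_flatten {d : ℕ} (Q : Matrix (Fin d × Fin d) (Fin d × Fin d) ℂ) :
    frobNorm (flatten Q) = frobNorm Q := by
  unfold frobNorm flatten
  congr 1
  rw [← finProdFinEquiv.symm.sum_comp (fun i => ∑ j, ‖Q i j‖ ^ 2)]
  refine Finset.sum_congr rfl fun i _ => ?_
  rw [← finProdFinEquiv.symm.sum_comp (fun j => ‖Q (finProdFinEquiv.symm i) j‖ ^ 2)]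
  rfl

theorem inputState_entry {d : ℕ} (Q : Matrix (Fin d × Fin d) (Fin d × Fin d) ℂ) (δ : ℝ)
    (i j : Fin (d * d)) :
    (inputState Q δ).real (2 * (i * (d * d) + j) + 1) = (flatten Q i j).re ∧
      (inputState Q δ).real (2 * (i * (d * d) + j) + 2) = (flatten Q i j).im ∧
      2 * (i * (d * d) + j) + 2 < inputEnd d := by
  have hp : (i : ℕ) * (d * d) + j < (d * d) * (d * d) := by
    calc (i : ℕ) * (d * d) + j < i * (d * d) + d * d := by have := j.2; omega
      _ = (i + 1) * (d * d) := by ring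
      _ ≤ _ := Nat.mul_le_mul_right _ i.2
  have hs : (finProdFinEquiv.symm ⟨(i : ℕ) * (d * d) + j, hp⟩ : Fin (d * d) × Fin (d * d)) =
      (i, j) := by
    rw [Equiv.symm_apply_eq]
    ext
    simp [finProdFinEquiv]; ring
  have key : ∀ p (hp : p < (d * d) * (d * d)), (finProdFinEquiv.symm ⟨p, hp⟩ :
      Fin (d * d) × Fin (d * d)) = (i, j) →
      (inputState Q δ).real (2 * p + 1) = (flatten Q i j).re ∧
      (inputState Q δ).real (2 * p + 2) = (flatten Q i j).im := by
    intro p hp hs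
    have h1 : (2 * p + 1 - 1) / 2 = p := by omega
    have h2 : (2 * p + 2 - 1) / 2 = p := by omega
    constructor
    · have h3 : (2 * p + 1) % 2 = 1 := by omega
      simp only [inputState, h1, h3, hp, Nat.succ_ne_zero, dite_true, if_false, if_true, hs]
      rfl
    · have h3 : ¬ (2 * p + 2) % 2 = 1 := by omega
      simp only [inputState, h2, h3, hp, Nat.succ_ne_zero, dite_true, if_false, hs]
      rfl
  obtain ⟨h1, h2⟩ := key _ hp hs
  refine ⟨h1, h2, ?_⟩
  unfold inputEnd; omega

namespace SepProgram
open IdxExpr CellExpr Code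

/-- The initial state as seen by the structured language. -/
noncomputable def initialState {d : ℕ} (Q : Matrix (Fin d × Fin d) (Fin d × Fin d) ℂ) (δ : ℝ) :
    ArrState := ⟨fun _ => 0, (inputState Q δ).real, fun _ _ _ => 0⟩

section
variable {d : ℕ} (Q : Matrix (Fin d × Fin d) (Fin d × Fin d) ℂ) (δ : ℝ) {e : ℕ → ℕ}

theorem represents_initialState (h0 : e 0 = d) :
    Represents 1 e (initialState Q δ) (inputState Q δ) := by
  have key : ∀ a, inputEnd d ≤ a → (inputState Q δ).real a = 0 := by
    intro a ha
    unfold inputEnd at ha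
    have h1 : ¬ (a - 1) / 2 < (d * d) * (d * d) := by omega
    have h2 : a ≠ 0 := by omega
    simp [inputState, h1, h2]
  refine ⟨fun i hi => ?_, fun m => ?_, fun a _ => rfl, fun c i j => ?_, fun c i j => ?_⟩
  · obtain rfl : i = 0 := by omega
    simp [inputState, h0]
  · simp [inputState, initialState]
  · rw [key _ (by unfold cellAddr; rw [h0]; omega)]; simp [initialState]
  · rw [key _ (by unfold cellAddr; rw [h0]; omega)]; simp [initialState]

theorem den_readInput (h0 : e 0 = d) :
    blockMat (d * d) ((readInput.den e (initialState Q δ)).arr 0) = flatten Q ∧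
    (readInput.den e (initialState Q δ)).arr 1 0 0 = δ ∧
    (readInput.den e (initialState Q δ)).arr 3 0 0 = ((frobNorm Q ^ 2 : ℝ) : ℂ) ∧
    (readInput.den e (initialState Q δ)).inp = (inputState Q δ).real := by
  set n := d * d with hnd
  have hn : e 0 * e 0 = n := by rw [h0]
  let q : ℕ → ℕ → ℂ := fun i j => if h : i < n ∧ j < n then flatten Q ⟨i, h.1⟩ ⟨j, h.2⟩ else 0
  simp only [readInput, den]
  rw [den_fill (c := 0) n n 1 (fun i j _ => q i j) (by simp [dim, hn]) (by simp [dim, hn])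
    (by simp) ?_]
  · rw [den_fill (c := 2) 1 n n (fun _ j k => ((‖(if j < n ∧ k < n then
      ∑ _x ∈ Finset.range 1, q j k else (initialState Q δ).arr 0 j k)‖ ^ 2 : ℝ) : ℂ)) (by simp)
      (by simp [dim, hn]) (by simp [dim, hn]) (by
        intro i _ j _ k _ a
        rw [← star_mul_self_eq]; simp [Function.update_apply])]
    rw [den_fill (c := 3) 1 1 n (fun _ _ m => (if m < n then ∑ k ∈ Finset.range n,
      ((‖(if m < n ∧ k < n then ∑ _x ∈ Finset.range 1, q m k else
        (initialState Q δ).arr 0 m k)‖ ^ 2 : ℝ) : ℂ) else 0)) (by simp) (by simp)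
      (by simp [dim, hn]) (by intros; simp [initialState])]
    refine ⟨?_, ?_, ?_, ?_⟩
    · ext i j
      have hij : (i : ℕ) < n ∧ (j : ℕ) < n := ⟨i.2, j.2⟩
      simp [blockMat, q, hij]
    · have h2 : clipAddr (e 0) 0 = 0 := by simp [clipAddr]
      simp [initialState, inputState, h2]
    · rw [← frobNorm_flatten, frobNorm_sq]
      simp only [ArrState.setArr_same, Nat.lt_one_iff, and_self, if_true, Complex.ofReal_sum]
      rw [Finset.sum_range]
      refine Finset.sum_congr rfl fun i _ => ?_
      rw [if_pos i.2, Finset.sum_range]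
      refine Finset.sum_congr rfl fun j _ => ?_
      simp [q]
    · simp [initialState]
  · intro i hi j hj k _ a
    obtain ⟨h1, h2, h3⟩ := inputState_entry Q δ ⟨i, hi⟩ ⟨j, hj⟩
    have e0 : Function.update (Function.update (Function.update e 1 i) (1 + 1) j) (1 + 2) k 0 = d := by
      simp [h0]
    have v1 : (2 * (env 1 * dim + env 2) + 1).eval (Function.update (Function.update
        (Function.update e 1 i) (1 + 1) j) (1 + 2) k) ((initialState Q δ).setArr 0 a) =
        2 * (i * (d * d) + j) + 1 := by
      simp [dim, Function.update_apply, h0]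
    have v2 : (2 * (env 1 * dim + env 2) + 2).eval (Function.update (Function.update
        (Function.update e 1 i) (1 + 1) j) (1 + 2) k) ((initialState Q δ).setArr 0 a) =
        2 * (i * (d * d) + j) + 2 := by
      simp [dim, Function.update_apply, h0]
    simp only [CellExpr.eval_add, CellExpr.eval_mul, CellExpr.eval_inp, CellExpr.eval_I, v1, v2, e0]
    simp only at h1 h2 h3
    rw [clipAddr_of_lt h3, clipAddr_of_lt (by omega)]
    simp only [ArrState.setArr_inp, initialState, h1, h2, q]
    rw [dif_pos ⟨hi, hj⟩, mul_comm Complex.I, Complex.re_add_im]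

end

section
variable {L : ℕ} {e : ℕ → ℕ} {d X k : ℕ}
attribute [local simp] conjugate offDiag sqNorm pivot halfGap rotateParams rotate rotateGuard step
  jacobi gridHalf gridBase small countGrid divide coord point squarings roots schmidt search dim
  powers precExp readInput fill

theorem bdd_readInput (h0 : e 0 = d) (hL : d * d ≤ L) (h1 : 1 ≤ L) : readInput.bdd L e := by
  simp [h0, hL, h1]

theorem bdd_jacobi (h0 : e 0 = d) (h1 : e 1 = X) (hL : d * d ≤ L) (hL1 : 1 ≤ L)
    (hJ : d * d * (d * d) * (X + 2 * (d ^ k + 10)) ≤ L) : (jacobi k).bdd L e := by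
  simp [h0, h1, hL, hL1, hJ]

theorem bdd_countGrid (h0 : e 0 = d) (hL : d * d ≤ L) : countGrid.bdd L e := by
  simp [h0, hL]

theorem bdd_search (h0 : e 0 = d) (h1 : e 1 = X) (hL : d * d ≤ L) (hd : d ≤ L) (hL1 : 1 ≤ L)
    (hp : d + X + 1 + (d ^ k + 10) ≤ L) (hE : e 2 ≤ L) : (search k).bdd L e := by
  simp [h0, h1, hL, hL1, hp, hd, hE]

end

/-- The test `X δ² < ‖Q‖²`, with `X` at the address `3`. -/
def scaleTest : TestExpr :=
  .realLt (.mul (.mul (.ofNat (.get (.const 3))) (.get (.const 0))) (.get (.const 0)))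
    (CellExpr.get 3 0 0).raw.1

/-- Reals cannot be rounded, so the ceiling of `‖Q‖_F²/δ²` is found by counting upwards. Address 3
is level 1, where the later code expects it. -/
def findScale : RamProgram :=
  .seq (.setNat (.const 3) (.const 0))
    (.loop scaleTest (.setNat (.const 3) (.add (.get (.const 3)) (.const 1))))

/-- The program of the theorem. -/
def main (k : ℕ) : RamProgram :=
  .seq readInput.raw (.seq findScale (.seq (jacobi k).raw (.seq countGrid.raw
    -- Address 5 is the variable 1, the number of grid points computed by `countGrid`; address 6 is
    -- level 2, so that `search` can use it as a loop bound.
    (.seq (.setNat (.const 6) (.get (.const 5))) (.seq (search k).raw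
      (.setReal (.const 0) (CellExpr.get 18 0 0).raw.1))))))

theorem findScale_exec {e : ℕ → ℕ} {σ : ArrState} {rs : RamState} {δ F : ℝ} (hδ : 0 < δ)
    (hR : Represents 1 e σ rs) (h1 : σ.inp 0 = δ) (h3 : σ.arr 3 0 0 = F) :
    ∃ T rs', Exec findScale rs T rs' ∧
      T ≤ (scaleTest.cost + 10) * (⌈F / δ ^ 2⌉₊ + 1) ∧
      Represents 1 e σ rs' ∧ rs'.nat 3 = ⌈F / δ ^ 2⌉₊ := by
  set X := ⌈F / δ ^ 2⌉₊ with hX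
  have test : ∀ rs, Represents 1 e σ rs → (scaleTest.holds rs ↔ rs.nat 3 < X) := by
    intro rs hR
    have e1 := (CellExpr.raw_eval hR le_rfl (CellExpr.get 3 0 0) (by simp)).1
    have e2 : rs.real 0 = δ := by rw [hR.inp 0 (by simp [inputEnd]), h1]
    rw [hX, Nat.lt_ceil, lt_div_iff₀ (by positivity)]
    simp only [scaleTest, TestExpr.holds, RealExpr.eval, NatExpr.eval, e1, e2]
    simp only [CellExpr.eval_get, IdxExpr.eval_ofNat, h3, Complex.ofReal_re]
    rw [mul_assoc, ← pow_two]
  have main : ∀ m k rs, k + m = X → Represents 1 e σ rs → rs.nat 3 = k →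
      ∃ T rs', Exec (.loop scaleTest
        (.setNat (.const 3) (.add (.get (.const 3)) (.const 1)))) rs T rs' ∧
        T ≤ scaleTest.cost + 1 + m * (scaleTest.cost + 10) ∧
        Represents 1 e σ rs' ∧ rs'.nat 3 = X := by
    intro m
    induction m with
    | zero =>
      intro k rs hk hR hn
      exact ⟨_, rs, Exec.loopDone (by rw [test rs hR]; omega), by omega, hR, by omega⟩
    | succ m ih =>
      intro k rs hk hR hn
      have hset := Exec.setNat rs (.const 3) (.add (.get (.const 3)) (.const 1))
      simp only [NatExpr.eval, hn] at hset
      obtain ⟨T, rs', h1, h2, h3, h4⟩ := ih (k + 1)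
        { rs with nat := Function.update rs.nat 3 (k + 1) } (by omega)
        (hR.update_nat (fun i hi => by omega) (fun m => by omega)) (by simp)
      refine ⟨_, rs', Exec.loopStep (by rw [test rs hR]; omega) hset h1, ?_, h3, h4⟩
      simp only [NatExpr.cost, add_mul, one_mul]
      omega
  have hset := Exec.setNat rs (.const 3) (.const 0)
  obtain ⟨T, rs', h1, h2, h3, h4⟩ := main X 0 { rs with nat := Function.update rs.nat 3 0 }
    (by omega) (hR.update_nat (fun i hi => by omega) (fun m => by omega)) (by simp)
  refine ⟨_, rs', Exec.seq hset h1, ?_, h3, h4⟩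
  simp only [NatExpr.cost, mul_add, mul_one]
  rw [mul_comm (scaleTest.cost + 10) X]
  omega

/-- A bound for the running time of the program when its loops run at most `L` times. -/
def mainTime (k L : ℕ) : ℕ :=
  readInput.time L + (scaleTest.cost + 10) * (L + 1) + (jacobi k).time L + countGrid.time L +
    (search k).time L + (CellExpr.get 18 0 0).raw.1.cost + 10

/-- The arrays `U` and `A` are produced before `L` is chosen, since the number `E` of grid points,
and with it the admissible `L`, depends on the diagonal of `A`. -/
theorem main_exec (k : ℕ) {d : ℕ} (Q : Matrix (Fin d × Fin d) (Fin d × Fin d) ℂ) {δ : ℝ}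
    (hδ : 0 < δ) : let X := ⌈frobNorm Q ^ 2 / δ ^ 2⌉₊
    ∃ U A : ℕ → ℕ → ℂ,
      blockMat (d * d) U =
        (jacobiSweep (flatten Q))^[d * d * (d * d) * (X + 2 * (d ^ k + 10))] 1 ∧
      blockMat (d * d) A = (blockMat (d * d) U)ᴴ * flatten Q * blockMat (d * d) U ∧
      ∀ (E : ℕ) [DecidablePred (largeSet A δ)],
        E = gridSize X ^ (2 * Nat.count (largeSet A δ) (d * d)) →
      ∀ L, d * d ≤ L → d ≤ L → 1 ≤ L → X ≤ L →
        d * d * (d * d) * (X + 2 * (d ^ k + 10)) ≤ L → d + X + 1 + (d ^ k + 10) ≤ L → E ≤ L →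
      ∃ T s, Exec (main k) (inputState Q δ) T s ∧ T ≤ mainTime k L ∧
        let v : ℕ → ℝ := fun c => traceRoot (d + X + 1 + (d ^ k + 10))
          (combMatrix d (gridPoint X (largeSet A δ) c) (fun t => (A t t).re) U)
        let ok : ℕ → Prop := fun c => c < E ∧ gridSqNorm (d * d) X (largeSet A δ) c ≤ 1
        (s.real 0 = 0 ∨ ∃ c, ok c ∧ v c = s.real 0) ∧ 0 ≤ s.real 0 ∧
          ∀ c, ok c → v c ≤ s.real 0 := by
  intro X
  set e : ℕ → ℕ := fun i => if i = 0 then d else X with he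
  have e0 : e 0 = d := by simp [he]
  have e1 : e 1 = X := by simp [he]
  obtain ⟨r1, r2, r3, r4⟩ := den_readInput Q δ (e := e) e0
  set σ₁ := readInput.den e (initialState Q δ) with hσ₁
  obtain ⟨j1, j2, j3⟩ := den_jacobi (σ := σ₁) (k := k) e0 e1
  set σ₂ := (jacobi k).den e σ₁ with hσ₂
  rw [r1] at j2 j3
  refine ⟨σ₂.arr 4, σ₂.arr 6, j2, j3, ?_⟩
  intro E _ hE L hL hdL hL1 hX hJ hp hEL
  have hδ₂ : σ₂.arr 1 0 0 = δ := by rw [j1.arr1, r2]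
  have hcount := den_countGrid (e := e) (σ := σ₂) (n := d * d) (X := X) (δ := δ) (by rw [e0]) e1 hδ₂
  -- The two counts differ only in the decidability instance.
  have hEc : ∀ τ : ArrState, τ.setNat 1 (gridSize X ^ (2 * @Nat.count (largeSet (σ₂.arr 6) δ)
      (fun a => Classical.propDecidable _) (d * d))) = τ.setNat 1 E := by
    intro τ
    rw [hE]
    congr
  rw [hEc] at hcount
  obtain ⟨T₁, s₁, x1, t1, R1, -⟩ := readInput.raw_exec 1 e (initialState Q δ) (inputState Q δ) L
    le_rfl wf_readInput (bdd_readInput e0 hL hL1) (represents_initialState Q δ e0)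
  obtain ⟨T₂, s₂, x2, t2, R2, n2⟩ := findScale_exec hδ R1
    (by rw [← hσ₁, r4]; simp [inputState]) r3
  have R2' : Represents 2 e σ₁ s₂ := by
    have := R2.succ le_rfl (v := X) n2
    rwa [← e1, Function.update_eq_self] at this
  obtain ⟨T₃, s₃, x3, t3, R3, -⟩ := (jacobi k).raw_exec 2 e σ₁ s₂ L (by norm_num) (wf_jacobi k)
    (bdd_jacobi e0 e1 hL hL1 hJ) R2'
  obtain ⟨T₄, s₄, x4, t4, R4, -⟩ := countGrid.raw_exec 2 e σ₂ s₃ L (by norm_num) wf_countGrid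
    (bdd_countGrid e0 hL) R3
  rw [hcount] at R4
  have n4 : s₄.nat 5 = E := by simpa using R4.var 1
  have x5 := Exec.setNat s₄ (.const 6) (.get (.const 5))
  simp only [NatExpr.eval, n4] at x5
  set s₅ : RamState := { s₄ with nat := Function.update s₄.nat 6 E } with hs₅
  have R5 : Represents 3 (Function.update e 2 E) (σ₂.setNat 1 E) s₅ :=
    (R4.update_nat (a := 6) (v := E) (fun i hi => by omega) (fun m => by omega)).succ
      (by norm_num) (by simp)
  obtain ⟨T₆, s₆, x6, t6, R6, -⟩ := (search k).raw_exec 3 (Function.update e 2 E)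
    (σ₂.setNat 1 E) s₅ L (by norm_num) (wf_search k)
    (bdd_search (by simp [e0]) (by simp [e1]) hL hdL hL1 hp (by simpa using hEL)) R5
  have x7 := Exec.setReal s₆ (.const 0) (CellExpr.get 18 0 0).raw.1
  rw [(CellExpr.raw_eval R6 (by norm_num) (CellExpr.get 18 0 0) (by simp)).1] at x7
  obtain hs := den_search (e := Function.update e 2 E) (σ := σ₂.setNat 1 E) (d := d) (X := X)
    (δ := δ) (k := k) (by simp [e0]) (by simp [e1]) (by simpa using hδ₂)
  refine ⟨_, _, Exec.seq x1 (Exec.seq x2 (Exec.seq x3 (Exec.seq x4 (Exec.seq x5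
    (Exec.seq x6 x7))))), ?_, ?_⟩
  · have : (scaleTest.cost + 10) * (X + 1) ≤ (scaleTest.cost + 10) * (L + 1) := by gcongr
    have t2' : T₂ ≤ (scaleTest.cost + 10) * (L + 1) := t2.trans this
    simp only [mainTime, NatExpr.cost]
    omega
  · simpa [NatExpr.eval] using hs

end SepProgram

/-! ### Quadratic forms and the Frobenius norm -/

section
variable {n : Type*} [Fintype n]

/-- The real part of `⟨w, Q w⟩`. -/
noncomputable def quadForm (Q : Matrix n n ℂ) (w : EuclideanSpace ℂ n) : ℝ :=
  (∑ x, ∑ y, star (w x) * Q x y * w y).re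

theorem quadForm_sub (Q M : Matrix n n ℂ) (w : EuclideanSpace ℂ n) :
    quadForm (Q - M) w = quadForm Q w - quadForm M w := by
  simp only [quadForm, Matrix.sub_apply, mul_sub, sub_mul, Finset.sum_sub_distrib, Complex.sub_re]

/-- Cauchy–Schwarz over the pairs of indices. This is how Frobenius accuracy of the spectral
decomposition becomes accuracy of the optimum. -/
theorem abs_quadForm_le (Q : Matrix n n ℂ) (w : EuclideanSpace ℂ n) :
    |quadForm Q w| ≤ frobNorm Q * ‖w‖ ^ 2 := by
  have h1 : |quadForm Q w| ≤ ∑ p : n × n, ‖Q p.1 p.2‖ * (‖w p.1‖ * ‖w p.2‖) := by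
    rw [quadForm, Fintype.sum_prod_type]
    refine (Complex.abs_re_le_norm _).trans ((norm_sum_le _ _).trans
      (Finset.sum_le_sum fun x _ => (norm_sum_le _ _).trans (Finset.sum_le_sum fun y _ => ?_)))
    rw [norm_mul, norm_mul, norm_star]
    exact le_of_eq (by ring)
  refine h1.trans ((Real.sum_mul_le_sqrt_mul_sqrt _ _ _).trans (le_of_eq ?_))
  have h2 : ∑ p : n × n, (‖w p.1‖ * ‖w p.2‖) ^ 2 = (‖w‖ ^ 2) ^ 2 := by
    rw [EuclideanSpace.norm_sq_eq, sq (∑ i, _), Finset.sum_mul_sum, Fintype.sum_prod_type]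
    simp only [mul_pow]
  rw [h2, Real.sqrt_sq (by positivity), frobNorm, Fintype.sum_prod_type]

theorem quadForm_nonneg {Q : Matrix n n ℂ} (hQ : Q.PosSemidef) (w : EuclideanSpace ℂ n) :
    0 ≤ quadForm Q w := by
  have := (Complex.le_def.1 (hQ.dotProduct_mulVec_nonneg w.ofLp)).1
  simpa [quadForm, dotProduct, Matrix.mulVec, Finset.mul_sum, mul_assoc] using this

theorem inner_eq_sum (x y : EuclideanSpace ℂ n) : inner ℂ x y = ∑ i, star (x i) * y i := by
  simp [PiLp.inner_apply, mul_comm]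

theorem norm_inner_sq (x y : EuclideanSpace ℂ n) :
    ((‖inner ℂ x y‖ ^ 2 : ℝ) : ℂ) = (∑ i, star (y i) * x i) * ∑ i, star (x i) * y i := by
  rw [← star_mul_self_eq, inner_eq_sum, mul_comm]
  simp [mul_comm]

theorem quadForm_of_eq_sum {Q : Matrix n n ℂ} {Ψ : n → EuclideanSpace ℂ n}
    {lam : n → ℝ} (h : ∀ x y, Q x y = ∑ t, (lam t : ℂ) * Ψ t x * star (Ψ t y))
    (w : EuclideanSpace ℂ n) :
    quadForm Q w = ∑ t, lam t * ‖inner ℂ (Ψ t) w‖ ^ 2 := by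
  have : (∑ x, ∑ y, star (w x) * Q x y * w y) =
      ((∑ t, lam t * ‖inner ℂ (Ψ t) w‖ ^ 2 : ℝ) : ℂ) := by
    push_cast
    calc _ = ∑ x, ∑ y, ∑ t, (lam t : ℂ) * ((star (w x) * Ψ t x) * (star (Ψ t y) * w y)) := by
          simp only [h, Finset.mul_sum, Finset.sum_mul]
          exact Finset.sum_congr rfl fun x _ => Finset.sum_congr rfl fun y _ =>
            Finset.sum_congr rfl fun t _ => by ring
      _ = ∑ t, (lam t : ℂ) * ((∑ x, star (w x) * Ψ t x) * ∑ y, star (Ψ t y) * w y) := by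
          rw [Finset.sum_comm_cycle]
          refine Finset.sum_congr rfl fun t _ => ?_
          rw [Finset.sum_mul_sum, Finset.sum_comm]
          simp only [Finset.mul_sum]
          exact Finset.sum_comm
      _ = _ := Finset.sum_congr rfl fun t _ => by
          have := norm_inner_sq (Ψ t) w
          push_cast at this
          rw [this]
  rw [quadForm, this, Complex.ofReal_re]

theorem Matrix.IsHermitian.apply_eq_sum [DecidableEq n] {Q : Matrix n n ℂ} (hQ : Q.IsHermitian)
    (x y : n) :
    Q x y = ∑ t, (hQ.eigenvalues t : ℂ) * hQ.eigenvectorBasis t x *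
      star (hQ.eigenvectorBasis t y) := by
  conv_lhs => rw [hQ.spectral_theorem]
  rw [Unitary.conjStarAlgAut_apply, Matrix.mul_apply]
  refine Finset.sum_congr rfl fun t _ => ?_
  simp only [Matrix.mul_diagonal, Matrix.star_apply, Matrix.IsHermitian.eigenvectorUnitary_apply,
    Function.comp_apply, Complex.coe_algebraMap]
  ring

end

/-- The product vector `u ⊗ v`. -/
noncomputable def prodVec {d : ℕ} (u v : EuclideanSpace ℂ (Fin d)) :
    EuclideanSpace ℂ (Fin d × Fin d) :=
  WithLp.toLp 2 fun ij => u ij.1 * v ij.2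

@[simp] theorem prodVec_apply {d : ℕ} (u v : EuclideanSpace ℂ (Fin d)) (ij : Fin d × Fin d) :
    prodVec u v ij = u ij.1 * v ij.2 := rfl

theorem inner_prodVec {d : ℕ} (u v u' v' : EuclideanSpace ℂ (Fin d)) :
    inner ℂ (prodVec u v) (prodVec u' v') = inner ℂ u u' * inner ℂ v v' := by
  simp only [inner_eq_sum, prodVec_apply, Finset.sum_mul_sum, Fintype.sum_prod_type, star_mul']
  exact Finset.sum_congr rfl fun x _ => Finset.sum_congr rfl fun y _ => by ring

theorem norm_prodVec {d : ℕ} (u v : EuclideanSpace ℂ (Fin d)) :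
    ‖prodVec u v‖ = ‖u‖ * ‖v‖ := by
  have h : ‖prodVec u v‖ ^ 2 = (‖u‖ * ‖v‖) ^ 2 := by
    rw [EuclideanSpace.norm_sq_eq, mul_pow, EuclideanSpace.norm_sq_eq, EuclideanSpace.norm_sq_eq,
      Finset.sum_mul_sum, Fintype.sum_prod_type]
    simp only [prodVec_apply, norm_mul, mul_pow]
  exact (pow_left_inj₀ (norm_nonneg _) (by positivity) two_ne_zero).1 h

theorem continuous_prodVec {d : ℕ} :
    Continuous fun p : EuclideanSpace ℂ (Fin d) × EuclideanSpace ℂ (Fin d) => prodVec p.1 p.2 := by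
  unfold prodVec
  fun_prop

theorem continuous_quadForm {n : Type*} [Fintype n] (Q : Matrix n n ℂ) :
    Continuous (quadForm Q) := by
  unfold quadForm
  fun_prop

/-! ### Reduction of `optSep` to product vectors -/

section optSep
variable {d : ℕ} {Q : Matrix (Fin d × Fin d) (Fin d × Fin d) ℂ}

theorem IsDensity.sum_eigenvalues {n : Type*} [Fintype n] [DecidableEq n] {ρ : Matrix n n ℂ}
    (h : IsDensity ρ) : ∑ i, h.1.isHermitian.eigenvalues i = 1 := by
  have := h.1.isHermitian.trace_eq_sum_eigenvalues
  have := this.symm.trans h.2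
  refine Complex.ofReal_injective ((Complex.ofReal_sum _ _).trans (this.trans ?_))
  exact Complex.ofReal_one.symm

theorem isDensity_vecMulVec {n : Type*} [Fintype n] {u : EuclideanSpace ℂ n} (hu : ‖u‖ = 1) :
    IsDensity (Matrix.vecMulVec u (star u.ofLp)) := by
  refine ⟨Matrix.posSemidef_vecMulVec_self_star _, ?_⟩
  have h : ((‖u‖ ^ 2 : ℝ) : ℂ) = 1 := by simp [hu]
  rw [EuclideanSpace.norm_sq_eq] at h
  rw [Matrix.trace_vecMulVec, dotProduct, ← h]
  push_cast
  exact Finset.sum_congr rfl fun i _ => by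
    rw [Pi.star_apply, star_mul_self_eq]; push_cast; rfl

/-- The index types are arbitrary because two cases are needed: eigenvector expansions for the upper
bound, and a single vector for attainment. -/
theorem re_trace_kronecker_eq (hQ : Q.IsHermitian) {ι κ : Type*} [Fintype ι] [Fintype κ]
    {ρ σ : Matrix (Fin d) (Fin d) ℂ} {p : ι → ℝ} {q : κ → ℝ}
    {u : ι → EuclideanSpace ℂ (Fin d)} {v : κ → EuclideanSpace ℂ (Fin d)}
    (hρ : ∀ x y, ρ x y = ∑ t, (p t : ℂ) * u t x * star (u t y))
    (hσ : ∀ x y, σ x y = ∑ t, (q t : ℂ) * v t x * star (v t y)) :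
    (Qᴴ * Matrix.kronecker ρ σ).trace.re =
      ∑ i, ∑ j, p i * q j * quadForm Q (prodVec (u i) (v j)) := by
  have : (Qᴴ * Matrix.kronecker ρ σ).trace = ∑ i, ∑ j, ((p i * q j : ℝ) : ℂ) *
      ∑ x, ∑ y, star (prodVec (u i) (v j) x) * Q x y * prodVec (u i) (v j) y := by
    have hK (x y) : Matrix.kronecker ρ σ y x = ∑ i, ∑ j, ((p i * q j : ℝ) : ℂ) *
        (prodVec (u i) (v j) y * star (prodVec (u i) (v j) x)) := by
      rw [Matrix.kronecker, Matrix.kroneckerMap_apply, hρ, hσ, Finset.sum_mul_sum]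
      refine Finset.sum_congr rfl fun i _ => Finset.sum_congr rfl fun j _ => ?_
      simp only [prodVec_apply, star_mul']
      push_cast
      ring
    rw [hQ.eq, Matrix.trace]
    simp only [Matrix.diag, Matrix.mul_apply, hK, Finset.mul_sum]
    calc _ = ∑ x, ∑ y, ∑ ij : ι × κ, ((p ij.1 * q ij.2 : ℝ) : ℂ) *
          (star (prodVec (u ij.1) (v ij.2) x) * Q x y * prodVec (u ij.1) (v ij.2) y) := by
          simp only [Fintype.sum_prod_type (α₁ := ι)]
          refine Finset.sum_congr rfl fun x _ => Finset.sum_congr rfl fun y _ =>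
            Finset.sum_congr rfl fun i _ => Finset.sum_congr rfl fun j _ => by ring
      _ = _ := by
          rw [Finset.sum_comm_cycle, Fintype.sum_prod_type]
  rw [this]
  simp [Complex.re_sum, quadForm, -Complex.ofReal_mul]

theorem exists_optimal_prodVec (hd : 1 ≤ d) (Q : Matrix (Fin d × Fin d) (Fin d × Fin d) ℂ) :
    ∃ u v : EuclideanSpace ℂ (Fin d), ‖u‖ = 1 ∧ ‖v‖ = 1 ∧ ∀ u' v' : EuclideanSpace ℂ (Fin d),
      ‖u'‖ = 1 → ‖v'‖ = 1 → quadForm Q (prodVec u' v') ≤ quadForm Q (prodVec u v) := by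
  obtain ⟨S, hSd⟩ : ∃ S, S = Metric.sphere (0 : EuclideanSpace ℂ (Fin d)) 1 := ⟨_, rfl⟩
  have hS : IsCompact (S ×ˢ S) := by
    rw [hSd]
    exact (isCompact_sphere _ _).prod (isCompact_sphere _ _)
  have hmem (x : EuclideanSpace ℂ (Fin d)) : x ∈ S ↔ ‖x‖ = 1 := by
    rw [hSd, mem_sphere_zero_iff_norm]
  have e : EuclideanSpace.single (⟨0, by omega⟩ : Fin d) (1 : ℂ) ∈ S := by simp [hmem]
  have hf : ContinuousOn (fun p : EuclideanSpace ℂ (Fin d) × EuclideanSpace ℂ (Fin d) =>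
      quadForm Q (prodVec p.1 p.2)) (S ×ˢ S) :=
    ((continuous_quadForm Q).comp continuous_prodVec).continuousOn
  obtain ⟨p, hp, hmax⟩ := hS.exists_isMaxOn (Set.Nonempty.prod ⟨_, e⟩ ⟨_, e⟩) hf
  exact ⟨p.1, p.2, (hmem _).1 hp.1, (hmem _).1 hp.2, fun u' v' hu hv =>
    isMaxOn_iff.1 hmax (u', v') (Set.mk_mem_prod ((hmem _).2 hu) ((hmem _).2 hv))⟩

/-- A half-space containing the product states contains their convex hull, and on a product state
the value is an average of pure values, with weights the products of the eigenvalues. -/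
theorem sepValues_le (hQ : Q.IsHermitian) {B : ℝ}
    (h : ∀ u v : EuclideanSpace ℂ (Fin d), ‖u‖ = 1 → ‖v‖ = 1 → quadForm Q (prodVec u v) ≤ B) :
    B ∈ upperBounds (sepValues Q) := by
  rintro _ ⟨X, hX, rfl⟩
  have hconv : Convex ℝ {X : Matrix (Fin d × Fin d) (Fin d × Fin d) ℂ | (Qᴴ * X).trace.re ≤ B} := by
    refine convex_halfSpace_le (𝕜 := ℝ) ⟨fun X Y => ?_, fun c X => ?_⟩ B
    · simp [Matrix.mul_add]
    · simp
  refine convexHull_min ?_ hconv hX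
  rintro _ ⟨ρ, σ, hρ, hσ, rfl⟩
  rw [Set.mem_ofPred_eq, re_trace_kronecker_eq hQ hρ.1.isHermitian.apply_eq_sum
    hσ.1.isHermitian.apply_eq_sum]
  calc _ ≤ ∑ i, ∑ j, hρ.1.isHermitian.eigenvalues i * hσ.1.isHermitian.eigenvalues j * B := by
        gcongr with i _ j _
        · exact mul_nonneg (hρ.1.eigenvalues_nonneg i) (hσ.1.eigenvalues_nonneg j)
        · exact h _ _ (OrthonormalBasis.norm_eq_one _ _) (OrthonormalBasis.norm_eq_one _ _)
    _ = B := by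
        simp only [← Finset.sum_mul, ← Finset.sum_mul_sum, hρ.sum_eigenvalues, hσ.sum_eigenvalues,
          one_mul]

theorem quadForm_mem_sepValues (hQ : Q.IsHermitian) {u v : EuclideanSpace ℂ (Fin d)}
    (hu : ‖u‖ = 1) (hv : ‖v‖ = 1) : quadForm Q (prodVec u v) ∈ sepValues Q := by
  refine ⟨_, subset_convexHull ℝ _ ⟨_, _, isDensity_vecMulVec hu, isDensity_vecMulVec hv, rfl⟩, ?_⟩
  dsimp only
  rw [re_trace_kronecker_eq hQ (ι := Unit) (κ := Unit) (p := 1) (q := 1) (u := fun _ => u)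
    (v := fun _ => v)]
  · simp
  · simp [Matrix.vecMulVec_apply]
  · simp [Matrix.vecMulVec_apply]

theorem exists_optSep_eq (hd : 1 ≤ d) (hQ : Q.IsHermitian) :
    ∃ u v : EuclideanSpace ℂ (Fin d), ‖u‖ = 1 ∧ ‖v‖ = 1 ∧ optSep Q = quadForm Q (prodVec u v) ∧
      IsGreatest (sepValues Q) (quadForm Q (prodVec u v)) := by
  obtain ⟨u, v, hu, hv, h⟩ := exists_optimal_prodVec hd Q
  have : IsGreatest (sepValues Q) _ := ⟨quadForm_mem_sepValues hQ hu hv, sepValues_le hQ h⟩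
  exact ⟨u, v, hu, hv, this.csSup_eq, this⟩

theorem isGreatest_optSep (hd : 1 ≤ d) (hQ : Q.IsHermitian) :
    IsGreatest (sepValues Q) (optSep Q) := by
  obtain ⟨u, v, -, -, h, h'⟩ := exists_optSep_eq hd hQ
  rwa [h]

theorem quadForm_le_optSep (hd : 1 ≤ d) (hQ : Q.IsHermitian) {u v : EuclideanSpace ℂ (Fin d)}
    (hu : ‖u‖ = 1) (hv : ‖v‖ = 1) : quadForm Q (prodVec u v) ≤ optSep Q :=
  (isGreatest_optSep hd hQ).2 (quadForm_mem_sepValues hQ hu hv)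

theorem optSep_le_frobNorm (hd : 1 ≤ d) (hQ : Q.IsHermitian) : optSep Q ≤ frobNorm Q := by
  obtain ⟨u, v, hu, hv, h, -⟩ := exists_optSep_eq hd hQ
  have := (le_abs_self _).trans (abs_quadForm_le Q (prodVec u v))
  rwa [norm_prodVec, hu, hv, ← h, mul_one, one_pow, mul_one] at this

end optSep

/-! ### Schmidt decompositions -/

section Schmidt
variable {d : ℕ} {φ : EuclideanSpace ℂ (Fin d × Fin d)} {μ : Fin d → ℝ}
  {u v : OrthonormalBasis (Fin d) ℂ (EuclideanSpace ℂ (Fin d))}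

theorem IsSchmidtDecomposition.inner_prodVec (h : IsSchmidtDecomposition φ μ u v)
    (a b : EuclideanSpace ℂ (Fin d)) :
    inner ℂ (prodVec a b) φ = ∑ k, (μ k : ℂ) * (inner ℂ a (u k) * inner ℂ b (v k)) := by
  have hφ : φ = ∑ k, (μ k : ℂ) • prodVec (u k) (v k) := by
    ext ⟨i, j⟩
    rw [h.2 i j]
    simp [mul_assoc]
  rw [hφ, inner_sum]
  simp only [inner_smul_right, _root_.inner_prodVec]

/-- Cauchy–Schwarz together with Parseval in the two bases. Equality holds at `u k ⊗ v k` for the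
largest `μ k`, which identifies the largest coefficient with the maximal overlap with product
vectors. -/
theorem IsSchmidtDecomposition.norm_inner_prodVec_le (h : IsSchmidtDecomposition φ μ u v) {m : ℝ}
    (hm : ∀ k, μ k ≤ m) (hm0 : 0 ≤ m) (a b : EuclideanSpace ℂ (Fin d)) :
    ‖inner ℂ (prodVec a b) φ‖ ≤ m * (‖a‖ * ‖b‖) := by
  rw [h.inner_prodVec]
  calc _ ≤ ∑ k, m * (‖inner ℂ a (u k)‖ * ‖inner ℂ b (v k)‖) := by
        refine (norm_sum_le _ _).trans (Finset.sum_le_sum fun k _ => ?_)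
        rw [norm_mul, norm_mul, Complex.norm_real, Real.norm_of_nonneg (h.1 k)]
        exact mul_le_mul_of_nonneg_right (hm k) (by positivity)
    _ ≤ m * (‖a‖ * ‖b‖) := by
        rw [← Finset.mul_sum]
        refine mul_le_mul_of_nonneg_left ((Real.sum_mul_le_sqrt_mul_sqrt _ _ _).trans ?_) hm0
        rw [OrthonormalBasis.sum_sq_norm_inner_left, OrthonormalBasis.sum_sq_norm_inner_left,
          Real.sqrt_sq (norm_nonneg _), Real.sqrt_sq (norm_nonneg _)]

theorem IsSchmidtDecomposition.inner_prodVec_self (h : IsSchmidtDecomposition φ μ u v)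
    (k : Fin d) : inner ℂ (prodVec (u k) (v k)) φ = μ k := by
  rw [h.inner_prodVec, Finset.sum_eq_single k]
  · simp
  · intro l _ hl
    simp [OrthonormalBasis.inner_eq_ite, hl.symm]
  · simp

theorem IsLargestSchmidtCoeff.nonneg {m : ℝ} (h : IsLargestSchmidtCoeff φ m) : 0 ≤ m := by
  obtain ⟨μ, u, v, h, ⟨k, rfl⟩, -⟩ := h
  exact h.1 k

theorem IsLargestSchmidtCoeff.norm_inner_prodVec_le {m : ℝ} (h : IsLargestSchmidtCoeff φ m)
    {a b : EuclideanSpace ℂ (Fin d)} (ha : ‖a‖ = 1) (hb : ‖b‖ = 1) :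
    ‖inner ℂ (prodVec a b) φ‖ ≤ m := by
  have hm := h.nonneg
  obtain ⟨μ, u, v, h, -, hmax⟩ := h
  simpa [ha, hb] using h.norm_inner_prodVec_le (fun k => hmax ⟨k, rfl⟩) hm a b

theorem IsLargestSchmidtCoeff.exists_norm_inner_prodVec_eq {m : ℝ}
    (h : IsLargestSchmidtCoeff φ m) : ∃ a b : EuclideanSpace ℂ (Fin d), ‖a‖ = 1 ∧ ‖b‖ = 1 ∧
      ‖inner ℂ (prodVec a b) φ‖ = m := by
  obtain ⟨μ, u, v, h, ⟨k, rfl⟩, -⟩ := h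
  refine ⟨u k, v k, OrthonormalBasis.norm_eq_one _ _, OrthonormalBasis.norm_eq_one _ _, ?_⟩
  rw [h.inner_prodVec_self, Complex.norm_real, Real.norm_of_nonneg (h.1 k)]

/-- The vectors of an orthogonal family, divided by their lengths and extended to an orthonormal
basis. -/
theorem exists_orthonormalBasis_smul_eq {f : Fin d → EuclideanSpace ℂ (Fin d)} {c : Fin d → ℝ}
    (hf : ∀ k l, inner ℂ (f k) (f l) = if k = l then ((c k ^ 2 : ℝ) : ℂ) else 0) :
    ∃ u : OrthonormalBasis (Fin d) ℂ (EuclideanSpace ℂ (Fin d)), ∀ k, f k = (c k : ℂ) • u k := by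
  let s : Set (Fin d) := {k | c k ≠ 0}
  have hv : Orthonormal ℂ (s.domRestrict fun k => ((c k)⁻¹ : ℂ) • f k) := by
    rw [orthonormal_iff_ite]
    rintro ⟨k, hk⟩ ⟨l, hl⟩
    have hk' : (c k : ℂ) ≠ 0 := Complex.ofReal_ne_zero.2 hk
    simp only [Set.domRestrict_apply, inner_smul_left, inner_smul_right, hf, Subtype.mk.injEq]
    split_ifs with hkl
    · subst hkl
      simp
      field_simp
    · simp
  obtain ⟨u, hu⟩ := hv.exists_orthonormalBasis_extension_of_card_eq (by simp)
  refine ⟨u, fun k => ?_⟩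
  by_cases hk : c k = 0
  · have : f k = 0 := by
      rw [← inner_self_eq_zero (𝕜 := ℂ), hf]
      simp [hk]
    simp [this, hk]
  · rw [hu k hk, smul_smul, mul_inv_cancel₀ (Complex.ofReal_ne_zero.2 hk), one_smul]

/-- With `v` an eigenbasis of the reduced matrix on the second factor, the contractions `f k` of `φ`
with `v k` are orthogonal and have the eigenvalues as squared lengths. `M` is the transposed
coefficient matrix, so that the eigenvectors enter without conjugation. -/
theorem exists_isSchmidtDecomposition (φ : EuclideanSpace ℂ (Fin d × Fin d)) :
    ∃ μ u v, IsSchmidtDecomposition φ μ u v := by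
  let M : Matrix (Fin d) (Fin d) ℂ := Matrix.of fun j i => φ (i, j)
  have hH : (M * Mᴴ).PosSemidef := Matrix.posSemidef_self_mul_conjTranspose M
  let v := hH.isHermitian.eigenvectorBasis
  let row (i : Fin d) : EuclideanSpace ℂ (Fin d) := WithLp.toLp 2 fun j => φ (i, j)
  let f (k : Fin d) : EuclideanSpace ℂ (Fin d) := WithLp.toLp 2 fun i => inner ℂ (v k) (row i)
  have hf (k l) : inner ℂ (f k) (f l) =
      if k = l then ((√(hH.isHermitian.eigenvalues k) ^ 2 : ℝ) : ℂ) else 0 := by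
    have h1 : inner ℂ (f k) (f l) = ∑ j, star (v l j) * ((M * Mᴴ) *ᵥ (v k).ofLp) j := by
      simp only [inner_eq_sum, f, row, Matrix.mulVec, dotProduct, Matrix.mul_apply, star_sum,
        star_mul', star_star, Finset.mul_sum, Finset.sum_mul,
        Matrix.conjTranspose_apply, M, Matrix.of_apply]
      rw [Finset.sum_comm_cycle, Finset.sum_comm_cycle]
      exact Finset.sum_congr rfl fun j _ => Finset.sum_congr rfl fun i _ => Finset.sum_congr rfl fun x _ => by ring
    rw [h1, hH.isHermitian.mulVec_eigenvectorBasis, Real.sq_sqrt (hH.eigenvalues_nonneg k)]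
    have h2 := OrthonormalBasis.inner_eq_ite v l k
    rw [inner_eq_sum] at h2
    calc _ = (hH.isHermitian.eigenvalues k : ℂ) * ∑ j, star (v l j) * v k j := by
          rw [Finset.mul_sum]
          refine Finset.sum_congr rfl fun j _ => ?_
          simp only [Pi.smul_apply, Complex.real_smul, v]
          ring
      _ = _ := by
          rw [h2]
          by_cases hkl : k = l
          · simp [hkl]
          · simp [hkl, Ne.symm hkl]
  obtain ⟨u, hu⟩ := exists_orthonormalBasis_smul_eq hf
  refine ⟨fun k => √(hH.isHermitian.eigenvalues k), u, v, fun k => Real.sqrt_nonneg _,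
    fun i j => ?_⟩
  have h := congrArg (fun x : EuclideanSpace ℂ (Fin d) => x j) (v.sum_repr' (row i))
  have h' (k) : inner ℂ (v k) (row i) = (√(hH.isHermitian.eigenvalues k) : ℂ) * u k i := by
    have := congrArg (fun x : EuclideanSpace ℂ (Fin d) => x i) (hu k)
    simpa [f] using this
  simp only [h', WithLp.ofLp_sum, Finset.sum_apply, WithLp.ofLp_smul, Pi.smul_apply,
    smul_eq_mul] at h
  exact h.symm

theorem exists_isLargestSchmidtCoeff (hd : 1 ≤ d) (φ : EuclideanSpace ℂ (Fin d × Fin d)) :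
    ∃ m, IsLargestSchmidtCoeff φ m := by
  obtain ⟨μ, u, v, h⟩ := exists_isSchmidtDecomposition φ
  have : Nonempty (Fin d) := ⟨⟨0, by omega⟩⟩
  obtain ⟨k, hk⟩ := Finite.exists_max μ
  exact ⟨μ k, μ, u, v, h, ⟨k, rfl⟩, by rintro _ ⟨l, rfl⟩; exact hk l⟩

end Schmidt

/-! ### The trace of a high power -/

section traceRoot
variable {d : ℕ} {Φ : Matrix (Fin d) (Fin d) ℂ} {μ : Fin d → ℝ}
  {u v : OrthonormalBasis (Fin d) ℂ (EuclideanSpace ℂ (Fin d))}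

/-- A Schmidt decomposition of the vector is a singular value decomposition `U D V` of its matrix,
so `Φ Φᴴ` is unitarily similar to `D Dᴴ`. -/
theorem trace_mul_conjTranspose_pow
    (h : ∀ i j, Φ i j = ∑ k, (μ k : ℂ) * u k i * v k j) (N : ℕ) :
    ((Φ * Φᴴ) ^ N).trace = ((∑ k, (μ k ^ 2) ^ N : ℝ) : ℂ) := by
  let U : Matrix (Fin d) (Fin d) ℂ := Matrix.of fun i k => u k i
  let V : Matrix (Fin d) (Fin d) ℂ := Matrix.of fun k j => v k j
  let D : Matrix (Fin d) (Fin d) ℂ := Matrix.diagonal fun k => (μ k : ℂ)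
  have hU : Uᴴ * U = 1 := by
    ext k l
    have := OrthonormalBasis.inner_eq_ite u k l
    rw [inner_eq_sum] at this
    simpa [Matrix.mul_apply, U, Matrix.one_apply] using this
  have hV : V * Vᴴ = 1 := by
    ext k l
    have := OrthonormalBasis.inner_eq_ite v l k
    rw [inner_eq_sum] at this
    simpa [Matrix.mul_apply, V, Matrix.one_apply, mul_comm, eq_comm] using this
  have hΦ : Φ = U * D * V := by
    ext i j
    rw [h, Matrix.mul_apply]
    exact Finset.sum_congr rfl fun k _ => by simp [U, V, D, Matrix.mul_diagonal, mul_comm]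
  have hD : D * Dᴴ = Matrix.diagonal fun k => ((μ k ^ 2 : ℝ) : ℂ) := by
    simp [D, Matrix.diagonal_conjTranspose, Matrix.diagonal_mul_diagonal, sq]
  have h1 : Φ * Φᴴ = U * (D * Dᴴ) * Uᴴ := by
    rw [hΦ, Matrix.conjTranspose_mul, Matrix.conjTranspose_mul]
    calc _ = U * D * (V * Vᴴ) * Dᴴ * Uᴴ := by simp only [Matrix.mul_assoc]
      _ = _ := by rw [hV, Matrix.mul_one]; simp only [Matrix.mul_assoc]
  have h2 (N : ℕ) : (Φ * Φᴴ) ^ N = U * (D * Dᴴ) ^ N * Uᴴ := by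
    induction N with
    | zero => simp [mul_eq_one_comm.1 hU]
    | succ N ih =>
      rw [pow_succ, ih, h1, pow_succ]
      calc _ = U * (D * Dᴴ) ^ N * (Uᴴ * U) * (D * Dᴴ) * Uᴴ := by simp only [Matrix.mul_assoc]
        _ = _ := by rw [hU, Matrix.mul_one]; simp only [Matrix.mul_assoc]
  rw [h2, Matrix.trace_mul_cycle, hU, Matrix.one_mul, hD, Matrix.diagonal_pow,
    Matrix.trace_diagonal]
  simp

theorem sqrt_iterate_pow {x : ℝ} (hx : 0 ≤ x) (p : ℕ) : Real.sqrt^[p] (x ^ 2 ^ p) = x := by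
  induction p with
  | zero => simp
  | succ p ih => rw [Function.iterate_succ_apply, pow_succ, pow_mul, Real.sqrt_sq (by positivity), ih]

theorem monotone_sqrt_iterate (p : ℕ) : Monotone (Real.sqrt^[p]) :=
  Monotone.iterate (fun _ _ h => Real.sqrt_le_sqrt h) p

/-- With `N = 2^p`, the trace lies between `m^(2N)` and `d m^(2N)`, and `d ≤ (1 + d/N)^N` by
Bernoulli, so its `N`-th root lies between `m²` and `(1 + d/N) m²`. -/
theorem abs_traceRoot_sub_le {φ : EuclideanSpace ℂ (Fin d × Fin d)} {m : ℝ}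
    (hm : IsLargestSchmidtCoeff φ m) (hΦ : ∀ i j, Φ i j = φ (i, j)) (p : ℕ) :
    |traceRoot p Φ - m ^ 2| ≤ m ^ 2 * (d / 2 ^ p) := by
  have hm0 := hm.nonneg
  obtain ⟨μ, u, v, h, ⟨k, rfl⟩, hmax⟩ := hm
  have htr : ((Φ * Φᴴ) ^ 2 ^ p).trace.re = ∑ k, (μ k ^ 2) ^ 2 ^ p := by
    rw [trace_mul_conjTranspose_pow fun i j => (hΦ i j).trans (h.2 i j), Complex.ofReal_re]
  have h1 : μ k ^ 2 ≤ traceRoot p Φ := by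
    rw [traceRoot, htr, ← sqrt_iterate_pow (sq_nonneg (μ k)) p]
    exact monotone_sqrt_iterate p (Finset.single_le_sum (f := fun k => (μ k ^ 2) ^ 2 ^ p)
      (fun _ _ => by positivity) (Finset.mem_univ k))
  have h2 : traceRoot p Φ ≤ (1 + d / 2 ^ p) * μ k ^ 2 := by
    rw [traceRoot, htr, ← sqrt_iterate_pow (x := (1 + d / 2 ^ p) * μ k ^ 2) (by positivity) p]
    refine monotone_sqrt_iterate p ?_
    have hb := one_add_mul_le_pow (a := (d : ℝ) / 2 ^ p)
      (le_trans (by norm_num) (by positivity : (0 : ℝ) ≤ d / 2 ^ p)) (2 ^ p)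
    have hb' : (d : ℝ) ≤ (1 + d / 2 ^ p) ^ 2 ^ p := by
      refine le_trans ?_ hb
      push_cast
      rw [mul_div_cancel₀ _ (by positivity)]
      linarith
    calc _ ≤ ∑ _l : Fin d, (μ k ^ 2) ^ 2 ^ p := by
          gcongr with l
          · exact h.1 l
          · exact hmax ⟨l, rfl⟩
      _ = d * (μ k ^ 2) ^ 2 ^ p := by simp
      _ ≤ _ := by
          rw [mul_pow]
          gcongr
  rw [abs_of_nonneg (by linarith)]
  linarith

end traceRoot

/-! ### Error analysis of the algorithm -/

theorem IsBallNet.exists_le_norm_inner_sq {E : Type*} [NormedAddCommGroup E]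
    [InnerProductSpace ℂ E] {N : Finset E} {ε : ℝ} (hN : IsBallNet N ε) (g : E) :
    ∃ α ∈ N, (1 - 2 * ε) * ‖g‖ ^ 2 ≤ ‖inner ℂ α g‖ ^ 2 := by
  by_cases hg : g = 0
  · obtain ⟨α, hα, -⟩ := hN.2 0 (by simp)
    exact ⟨α, hα, by simp [hg]⟩
  have hg' : 0 < ‖g‖ := norm_pos_iff.2 hg
  -- A net point close to the direction of `g` has overlap at least `(1 - ε) ‖g‖`, and `(1 - ε)² ≥ 1
  -- - 2ε`. For `ε ≥ 1` the left-hand side is not positive.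
  obtain ⟨α, hα, h⟩ := hN.2 (((‖g‖⁻¹ : ℝ) : ℂ) • g)
    (by rw [norm_smul, Complex.norm_real]; simp [hg'.ne'])
  refine ⟨α, hα, ?_⟩
  rcases le_or_gt 1 ε with h1 | h1
  · exact le_trans (mul_nonpos_of_nonpos_of_nonneg (by linarith) (by positivity)) (by positivity)
  have h2 : ‖inner ℂ (((‖g‖⁻¹ : ℝ) : ℂ) • g) g‖ = ‖g‖ := by
    rw [inner_smul_left, inner_self_eq_norm_sq_to_K, norm_mul]
    simp [hg'.ne']
    field_simp
  have h3 : ‖inner ℂ (((‖g‖⁻¹ : ℝ) : ℂ) • g - α) g‖ ≤ ε * ‖g‖ :=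
    (norm_inner_le_norm _ _).trans (mul_le_mul_of_nonneg_right h (norm_nonneg _))
  have h4 : (1 - ε) * ‖g‖ ≤ ‖inner ℂ α g‖ := by
    rw [inner_sub_left] at h3
    have := norm_sub_norm_le (inner ℂ (((‖g‖⁻¹ : ℝ) : ℂ) • g) g) (inner ℂ α g)
    linarith
  calc _ ≤ ((1 - ε) * ‖g‖) ^ 2 := by
        rw [mul_pow]
        gcongr
        nlinarith [sq_nonneg ε]
    _ ≤ _ := pow_le_pow_left₀ (mul_nonneg (by linarith) (norm_nonneg _)) h4 2

theorem IsBallNet.nonneg {E : Type*} [NormedAddCommGroup E] {N : Finset E} {ε : ℝ}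
    (hN : IsBallNet N ε) : 0 ≤ ε := by
  obtain ⟨α, -, h⟩ := hN.2 0 (by simp)
  exact (norm_nonneg _).trans h

section accuracy
variable {d : ℕ} {Q : Matrix (Fin d × Fin d) (Fin d × Fin d) ℂ}
  {Ψ : OrthonormalBasis (Fin d × Fin d) ℂ (EuclideanSpace ℂ (Fin d × Fin d))}
  {lam : Fin d × Fin d → ℝ} {δ η : ℝ}

theorem abs_quadForm_sub_sum_le (hη : frobNorm (Q - spectralSum Ψ lam) ≤ η)
    {w : EuclideanSpace ℂ (Fin d × Fin d)} (hw : ‖w‖ = 1) :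
    |quadForm Q w - ∑ t, lam t * ‖inner ℂ (Ψ t) w‖ ^ 2| ≤ η := by
  rw [← quadForm_of_eq_sum (Q := spectralSum Ψ lam) (Ψ := Ψ) (lam := lam) (fun _ _ => rfl),
    ← quadForm_sub]
  have := abs_quadForm_le (Q - spectralSum Ψ lam) w
  rw [hw, one_pow, mul_one] at this
  exact this.trans hη

/-- The test vector `Ψ t` isolates `lam t`. Approximate eigenvalues of a positive semidefinite
matrix may be negative, but only by the accuracy. -/
theorem neg_le_lam (hQ : Q.PosSemidef) (hη : frobNorm (Q - spectralSum Ψ lam) ≤ η)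
    (t : Fin d × Fin d) : -η ≤ lam t := by
  have h := (abs_le.1 (abs_quadForm_sub_sum_le hη (Ψ.norm_eq_one t))).2
  have h1 : ∑ s, lam s * ‖inner ℂ (Ψ s) (Ψ t)‖ ^ 2 = lam t := by
    rw [Finset.sum_eq_single t]
    · simp
    · intro s _ hs
      simp [OrthonormalBasis.inner_eq_ite, hs]
    · simp
  rw [h1] at h
  linarith [quadForm_nonneg hQ (Ψ t)]

/-- The coordinates `√(lam t) ⟨w, Ψ t⟩`, `t ∈ Γ`. -/
noncomputable def largeCoords (Ψ : OrthonormalBasis (Fin d × Fin d) ℂ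
    (EuclideanSpace ℂ (Fin d × Fin d))) (lam : Fin d × Fin d → ℝ) (δ : ℝ)
    (w : EuclideanSpace ℂ (Fin d × Fin d)) : EuclideanSpace ℂ (LargeIndex lam δ) :=
  WithLp.toLp 2 fun t => (√(lam t.1) : ℂ) * inner ℂ w (Ψ t.1)

/-- The duality on which the algorithm rests: the same number is an overlap of `w` with `φ_α` and of
`α` with the coordinates of `w`, so the maxima over `w` and `α` may be exchanged. -/
theorem inner_phiVec (w : EuclideanSpace ℂ (Fin d × Fin d))
    (α : EuclideanSpace ℂ (LargeIndex lam δ)) :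
    inner ℂ w (phiVec Ψ lam δ α) = inner ℂ α (largeCoords Ψ lam δ w) := by
  rw [phiVec, inner_sum, inner_eq_sum]
  refine Finset.sum_congr rfl fun t _ => ?_
  rw [inner_smul_right, largeCoords, mul_assoc]

theorem norm_largeCoords_sq (hδ : 0 ≤ δ) (w : EuclideanSpace ℂ (Fin d × Fin d)) :
    ‖largeCoords Ψ lam δ w‖ ^ 2 = ∑ t with δ / 2 ≤ lam t, lam t * ‖inner ℂ (Ψ t) w‖ ^ 2 := by
  rw [EuclideanSpace.norm_sq_eq, Finset.sum_subtype (p := fun t => δ / 2 ≤ lam t) _ (by simp)]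
  refine Finset.sum_congr rfl fun t _ => ?_
  simp only [largeCoords, norm_mul, mul_pow, Complex.norm_real]
  rw [norm_inner_symm, Real.norm_of_nonneg (Real.sqrt_nonneg _),
    Real.sq_sqrt ((by positivity : 0 ≤ δ / 2).trans t.2)]

/-- One `η` is the error of the decomposition; the other bounds the negative approximate eigenvalues
dropped with the complement of `Γ`. -/
theorem norm_largeCoords_sq_le (hδ : 0 ≤ δ) (hQ : Q.PosSemidef)
    (hη : frobNorm (Q - spectralSum Ψ lam) ≤ η) {w : EuclideanSpace ℂ (Fin d × Fin d)}
    (hw : ‖w‖ = 1) : ‖largeCoords Ψ lam δ w‖ ^ 2 ≤ quadForm Q w + 2 * η := by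
  have h1 := (abs_le.1 (abs_quadForm_sub_sum_le hη hw)).1
  have h2 := Finset.sum_filter_add_sum_filter_not Finset.univ (fun t => δ / 2 ≤ lam t)
    fun t => lam t * ‖inner ℂ (Ψ t) w‖ ^ 2
  have hη0 : 0 ≤ η := (frobNorm_nonneg _).trans hη
  have h3 : -η ≤ ∑ t with ¬ δ / 2 ≤ lam t, lam t * ‖inner ℂ (Ψ t) w‖ ^ 2 := by
    have h4 : ∑ t with ¬ δ / 2 ≤ lam t, ‖inner ℂ (Ψ t) w‖ ^ 2 ≤ 1 := by
      calc _ ≤ ∑ t, ‖inner ℂ (Ψ t) w‖ ^ 2 :=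
            Finset.sum_le_sum_of_subset_of_nonneg (Finset.filter_subset _ _) fun _ _ _ => by positivity
        _ = 1 := by rw [OrthonormalBasis.sum_sq_norm_inner_right, hw, one_pow]
    calc -η ≤ -η * ∑ t with ¬ δ / 2 ≤ lam t, ‖inner ℂ (Ψ t) w‖ ^ 2 := by nlinarith
      _ ≤ _ := by
        rw [Finset.mul_sum]
        exact Finset.sum_le_sum fun t _ =>
          mul_le_mul_of_nonneg_right (neg_le_lam hQ hη t) (by positivity)
  rw [norm_largeCoords_sq hδ]
  linarith

/-- The weights `‖⟨Ψ_t, w⟩‖²` sum to 1, so the discarded eigenvalues contribute at most `δ / 2` in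
total. -/
theorem quadForm_le_norm_largeCoords_sq (hδ : 0 ≤ δ)
    (hη : frobNorm (Q - spectralSum Ψ lam) ≤ η) {w : EuclideanSpace ℂ (Fin d × Fin d)}
    (hw : ‖w‖ = 1) : quadForm Q w ≤ ‖largeCoords Ψ lam δ w‖ ^ 2 + δ / 2 + η := by
  have h1 := (abs_le.1 (abs_quadForm_sub_sum_le hη hw)).2
  have h2 := Finset.sum_filter_add_sum_filter_not Finset.univ (fun t => δ / 2 ≤ lam t)
    fun t => lam t * ‖inner ℂ (Ψ t) w‖ ^ 2
  have h3 : ∑ t with ¬ δ / 2 ≤ lam t, lam t * ‖inner ℂ (Ψ t) w‖ ^ 2 ≤ δ / 2 := by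
    calc _ ≤ ∑ t with ¬ δ / 2 ≤ lam t, δ / 2 * ‖inner ℂ (Ψ t) w‖ ^ 2 :=
          Finset.sum_le_sum fun t ht => mul_le_mul_of_nonneg_right
            (not_le.1 (Finset.mem_filter.1 ht).2).le (by positivity)
      _ ≤ ∑ t, δ / 2 * ‖inner ℂ (Ψ t) w‖ ^ 2 :=
            Finset.sum_le_sum_of_subset_of_nonneg (Finset.filter_subset _ _) fun _ _ _ => by positivity
      _ = δ / 2 := by rw [← Finset.mul_sum, OrthonormalBasis.sum_sq_norm_inner_right, hw, one_pow, mul_one]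
  rw [norm_largeCoords_sq hδ]
  linarith

theorem sq_schmidtCoeff_le (hd : 1 ≤ d) (hδ : 0 ≤ δ) (hQ : Q.PosSemidef)
    (hη : frobNorm (Q - spectralSum Ψ lam) ≤ η) {α : EuclideanSpace ℂ (LargeIndex lam δ)}
    (hα : ‖α‖ ≤ 1) {m : ℝ} (hm : IsLargestSchmidtCoeff (phiVec Ψ lam δ α) m) :
    m ^ 2 ≤ optSep Q + 2 * η := by
  obtain ⟨a, b, ha, hb, rfl⟩ := hm.exists_norm_inner_prodVec_eq
  have hw : ‖prodVec a b‖ = 1 := by rw [norm_prodVec, ha, hb, one_mul]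
  rw [inner_phiVec]
  calc _ ≤ (‖α‖ * ‖largeCoords Ψ lam δ (prodVec a b)‖) ^ 2 :=
        pow_le_pow_left₀ (norm_nonneg _) (norm_inner_le_norm _ _) 2
    _ ≤ (1 * ‖largeCoords Ψ lam δ (prodVec a b)‖) ^ 2 := by gcongr
    _ ≤ quadForm Q (prodVec a b) + 2 * η := by
        rw [one_mul]
        exact norm_largeCoords_sq_le hδ hQ hη hw
    _ ≤ _ := by linarith [quadForm_le_optSep hd hQ.isHermitian ha hb]

/-- The output of the algorithm, with a spectral decomposition of accuracy `η` and squared Schmidt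
coefficients of accuracy `η'`. -/
theorem output_bounds (hd : 1 ≤ d) (hδ : 0 ≤ δ) (hQ : Q.PosSemidef)
    (hη : frobNorm (Q - spectralSum Ψ lam) ≤ η) {N : Finset (EuclideanSpace ℂ (LargeIndex lam δ))}
    {s : EuclideanSpace ℂ (LargeIndex lam δ) → ℝ} {ε η' τ opt : ℝ} (hN : IsBallNet N ε)
    (hs : ∀ α ∈ N, ∃ m, IsLargestSchmidtCoeff (phiVec Ψ lam δ α) m ∧ |s α - m ^ 2| ≤ η')
    (hopt : IsGreatest (s '' (N : Set (EuclideanSpace ℂ (LargeIndex lam δ)))) opt)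
    (hτ : 2 * ε * (frobNorm Q + 2 * η) ≤ τ) :
    opt ≤ optSep Q + 2 * η + η' ∧ optSep Q ≤ opt + η' + η + δ / 2 + τ := by
  constructor
  · obtain ⟨α, hα, rfl⟩ := hopt.1
    obtain ⟨m, hm, h⟩ := hs α hα
    have := sq_schmidtCoeff_le hd hδ hQ hη (hN.1 α hα) hm
    linarith [(abs_le.1 h).2]
  · obtain ⟨u, v, hu, hv, h, -⟩ := exists_optSep_eq hd hQ.isHermitian
    have hw : ‖prodVec u v‖ = 1 := by rw [norm_prodVec, hu, hv, one_mul]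
    -- The net point is chosen for the coordinates of an optimal product vector; the loss `2ε ‖g‖²`
    -- is controlled by `‖g‖² ≤ optSep Q + 2η ≤ ‖Q‖_F + 2η`.
    obtain ⟨α, hα, hαN⟩ := hN.exists_le_norm_inner_sq (largeCoords Ψ lam δ (prodVec u v))
    obtain ⟨m, hm, hsm⟩ := hs α hα
    have h1 : ‖inner ℂ (prodVec u v) (phiVec Ψ lam δ α)‖ ^ 2 ≤ m ^ 2 :=
      pow_le_pow_left₀ (norm_nonneg _) (hm.norm_inner_prodVec_le hu hv) 2
    rw [inner_phiVec] at h1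
    have h2 := quadForm_le_norm_largeCoords_sq hδ hη hw
    have h3 := norm_largeCoords_sq_le hδ hQ hη hw
    have h4 : 2 * ε * ‖largeCoords Ψ lam δ (prodVec u v)‖ ^ 2 ≤ τ := by
      refine le_trans (mul_le_mul_of_nonneg_left ?_ (mul_nonneg zero_le_two hN.nonneg)) hτ
      linarith [optSep_le_frobNorm hd hQ.isHermitian]
    have h5 : s α ≤ opt := hopt.2 ⟨α, hα, rfl⟩
    linarith [(abs_le.1 hsm).1]

end accuracy

/-! ### The algorithm with exact linear algebra -/

section exact
variable {d : ℕ} {Q : Matrix (Fin d × Fin d) (Fin d × Fin d) ℂ} {δ opt : ℝ}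

theorem frobNorm_eq_zero {n : Type*} [Fintype n] {M : Matrix n n ℂ} : frobNorm M = 0 ↔ M = 0 := by
  rw [← sq_eq_zero_iff, frobNorm_sq, Finset.sum_eq_zero_iff_of_nonneg fun _ _ => by positivity]
  simp only [Finset.mem_univ, true_implies,
    Finset.sum_eq_zero_iff_of_nonneg (fun _ _ => sq_nonneg ‖_‖), sq_eq_zero_iff, norm_eq_zero]
  exact ⟨fun h => Matrix.ext h, fun h => by simp [h]⟩

theorem exists_isBallNet {ι : Type*} [Fintype ι] {ε : ℝ} (hε : 0 < ε) :
    ∃ N : Finset (EuclideanSpace ℂ ι), IsBallNet N ε := by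
  obtain ⟨t, ht, hfin, hcov⟩ := finite_cover_balls_of_compact
    (isCompact_closedBall (0 : EuclideanSpace ℂ ι) 1) hε
  refine ⟨hfin.toFinset, fun y hy => ?_, fun x hx => ?_⟩
  · exact mem_closedBall_zero_iff.1 (ht (hfin.mem_toFinset.1 hy))
  · obtain ⟨y, hy, hxy⟩ := Set.mem_iUnion₂.1 (hcov (mem_closedBall_zero_iff.2 hx))
    exact ⟨y, hfin.mem_toFinset.2 hy, (mem_ball_iff_norm.1 hxy).le⟩

theorem exists_isAlgorithmOutput (hd : 1 ≤ d) (hQ : Q.PosSemidef) (hδ : 0 < δ) :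
    ∃ opt, IsAlgorithmOutput Q δ 0 opt := by
  let Ψ := hQ.isHermitian.eigenvectorBasis
  let lam := hQ.isHermitian.eigenvalues
  have hsp : Q - spectralSum Ψ lam = 0 := by
    ext x y
    simp [spectralSum, hQ.isHermitian.apply_eq_sum x y, Ψ, lam]
  have hfr : frobNorm (Q - spectralSum Ψ lam) ≤ 0 := (frobNorm_eq_zero.2 hsp).le
  obtain ⟨N, hN⟩ : ∃ N : Finset (EuclideanSpace ℂ (LargeIndex lam δ)),
      IsBallNet N (δ / (4 * frobNorm Q)) := by
    -- For `Q = 0` the quotient `δ / (4 * 0)` is 0, and a 0-net exists only because `Γ` is empty.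
    by_cases h0 : frobNorm Q = 0
    · have : IsEmpty (LargeIndex lam δ) := by
        refine ⟨fun t => ?_⟩
        have hl : lam = 0 := hQ.isHermitian.eigenvalues_eq_zero_iff.2 (frobNorm_eq_zero.1 h0)
        have := t.2.trans (congrFun hl t.1).le
        rw [Pi.zero_apply] at this
        linarith
      refine ⟨{0}, by simp, fun x _ => ⟨0, by simp, ?_⟩⟩
      rw [Subsingleton.elim x 0]
      simp [h0]
    · exact exists_isBallNet (div_pos hδ (mul_pos four_pos
        (lt_of_le_of_ne (frobNorm_nonneg _) (Ne.symm h0))))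
  choose m hm using fun α => exists_isLargestSchmidtCoeff hd (phiVec Ψ lam δ α)
  obtain ⟨α₀, hα₀, -⟩ := hN.2 0 (by simp)
  obtain ⟨α, hα, hmax⟩ := N.exists_max_image (fun α => m α ^ 2) ⟨α₀, hα₀⟩
  refine ⟨m α ^ 2, Ψ, lam, hfr, N, fun α => m α ^ 2, hN, fun α _ => ⟨m α, hm α, by simp⟩,
    ⟨α, hα, rfl⟩, ?_⟩
  rintro _ ⟨β, hβ, rfl⟩
  exact hmax β hβ

theorem abs_sub_optSep_le (hd : 1 ≤ d) (hQ : Q.PosSemidef) (hδ : 0 < δ)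
    (h : IsAlgorithmOutput Q δ 0 opt) : |opt - optSep Q| ≤ δ := by
  obtain ⟨Ψ, lam, hη, N, s, hN, hs, hopt⟩ := h
  have hτ : 2 * (δ / (4 * frobNorm Q)) * (frobNorm Q + 2 * 0) ≤ δ / 2 := by
    by_cases h0 : frobNorm Q = 0
    · simp [h0]
      exact (half_pos hδ).le
    · exact le_of_eq (by field_simp; norm_num)
  have := output_bounds hd hδ.le hQ hη hN hs hopt hτ
  rw [abs_le]
  constructor <;> linarith

end exact

/-! ### The grid as a net of the unit ball -/

theorem exists_digits (B m : ℕ) (D : ℕ → ℕ) (hD : ∀ j, D j < B) :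
    ∃ c < B ^ m, ∀ j < m, c / B ^ j % B = D j := by
  induction m with
  | zero => exact ⟨0, by simp, by simp⟩
  | succ m ih =>
    have hB : 0 < B := (Nat.zero_le _).trans_lt (hD 0)
    obtain ⟨c, hc, h⟩ := ih
    refine ⟨c + B ^ m * D m, ?_, fun j hj => ?_⟩
    · calc c + B ^ m * D m < B ^ m * 1 + B ^ m * D m := by omega
        _ = B ^ m * (1 + D m) := by ring
        _ ≤ B ^ m * B := Nat.mul_le_mul_left _ (by have := hD m; omega)
        _ = B ^ (m + 1) := by ring
    · rcases Nat.lt_succ_iff_lt_or_eq.1 hj with hj | rfl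
      · obtain ⟨i, rfl⟩ := Nat.exists_eq_add_of_lt hj
        rw [show B ^ (j + i + 1) * D (j + i + 1) = B ^ j * (B * (B ^ i * D (j + i + 1))) by ring,
          Nat.add_mul_div_left _ _ (pow_pos hB j), Nat.add_mul_mod_self_left]
        exact h j hj
      · rw [Nat.add_mul_div_left _ _ (pow_pos hB j), Nat.div_eq_of_lt hc, zero_add,
          Nat.mod_eq_of_lt (hD j)]

/-- Rounding is towards zero, not to the nearest point: moduli do not grow, so a vector of the ball
is rounded to a grid point of the ball. -/
theorem exists_gridCoord (X : ℕ) {r : ℝ} (hr : |r| ≤ 1) :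
    ∃ g < gridSize X, |gridCoord X g| ≤ |r| ∧ |r - gridCoord X g| ≤ 1 / gridRadius X := by
  have hM : (0 : ℝ) < gridRadius X := by simp [gridRadius]; positivity
  set M := gridRadius X with hMd
  obtain ⟨i, h1, h2⟩ : ∃ i : ℕ, (i : ℝ) / M ≤ |r| ∧ |r| ≤ i / M + 1 / M := by
    refine ⟨⌊|r| * M⌋₊, (div_le_iff₀ hM).2 (Nat.floor_le (by positivity)), ?_⟩
    rw [← add_div, le_div_iff₀ hM]
    exact (Nat.lt_floor_add_one _).le
  have hiM : i ≤ M := by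
    have := (div_le_iff₀ hM).1 (h1.trans hr)
    rw [one_mul] at this
    exact_mod_cast this
  have h0 : 0 ≤ (i : ℝ) / M := by positivity
  rcases le_total 0 r with h | h
  · refine ⟨M + i, by simp only [gridSize]; omega, ?_⟩
    have : gridCoord X (M + i) = i / M := by simp [gridCoord, ← hMd]
    rw [this, abs_of_nonneg h0]
    rw [abs_of_nonneg h] at h1 h2 ⊢
    exact ⟨h1, by rw [abs_le]; constructor <;> linarith [one_div_pos.2 hM]⟩
  · refine ⟨M - i, by simp only [gridSize]; omega, ?_⟩
    have : gridCoord X (M - i) = -(i / M) := by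
      simp [gridCoord, ← hMd, Nat.cast_sub hiM, neg_div]
    rw [this, abs_neg, abs_of_nonneg h0]
    rw [abs_of_nonpos h] at h1 h2 ⊢
    exact ⟨h1, by rw [abs_le]; constructor <;> linarith [one_div_pos.2 hM]⟩

open Classical in
/-- Rounding the coordinates towards zero gives a grid point. -/
theorem exists_gridPoint (X n : ℕ) (Γ : ℕ → Prop) (x : ℕ → ℂ) (hx : ∀ t, ‖x t‖ ≤ 1) :
    ∃ c < gridSize X ^ (2 * Nat.count Γ n), ∀ t < n, Γ t →
      ‖gridPoint X Γ c t‖ ^ 2 ≤ ‖x t‖ ^ 2 ∧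
      ‖x t - gridPoint X Γ c t‖ ^ 2 ≤ 2 * (1 / (gridRadius X : ℝ)) ^ 2 := by
  choose R hR1 hR2 hR3 using fun t => exists_gridCoord X ((Complex.abs_re_le_norm _).trans (hx t))
  choose I hI1 hI2 hI3 using fun t => exists_gridCoord X ((Complex.abs_im_le_norm _).trans (hx t))
  obtain ⟨c, hc, h⟩ := exists_digits (gridSize X) (2 * Nat.count Γ n)
    (fun j => if j % 2 = 0 then R (Nat.nth Γ (j / 2)) else I (Nat.nth Γ (j / 2)))
    (fun j => by split_ifs; exacts [hR1 _, hI1 _])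
  refine ⟨c, hc, fun t ht hΓ => ?_⟩
  have hcount : Nat.count Γ t < Nat.count Γ n := Nat.count_strict_mono hΓ ht
  have h1 := h (2 * Nat.count Γ t) (by omega)
  have h2 := h (2 * Nat.count Γ t + 1) (by omega)
  rw [if_pos (by omega), Nat.mul_div_cancel_left _ two_pos, Nat.nth_count hΓ] at h1
  rw [if_neg (by omega), show (2 * Nat.count Γ t + 1) / 2 = Nat.count Γ t by omega,
    Nat.nth_count hΓ] at h2
  rw [gridPoint, if_pos hΓ, h1, h2]
  simp only [← Complex.normSq_eq_norm_sq, Complex.normSq_apply, ← sq]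
  simp only [Complex.add_re, Complex.add_im, Complex.sub_re, Complex.sub_im, Complex.mul_re,
    Complex.mul_im, Complex.I_re, Complex.I_im, Complex.ofReal_re, Complex.ofReal_im, zero_mul,
    mul_zero, one_mul, sub_zero, add_zero, zero_add]
  have hp : (0 : ℝ) ≤ 1 / gridRadius X := by positivity
  constructor
  · exact add_le_add (sq_le_sq.2 (hR2 t)) (sq_le_sq.2 (hI2 t))
  · rw [two_mul]
    refine add_le_add (sq_le_sq.2 ?_) (sq_le_sq.2 ?_)
    · rw [abs_of_nonneg hp]; exact hR3 t
    · rw [abs_of_nonneg hp]; exact hI3 t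

section
variable {d : ℕ} {U A : ℕ → ℕ → ℂ} {δ : ℝ}

/-- The diagonal of `A`, indexed by pairs. -/
def diagEntry (d : ℕ) (A : ℕ → ℕ → ℂ) (t : Fin d × Fin d) : ℝ :=
  (A (finProdFinEquiv t) (finProdFinEquiv t)).re

open Classical in
theorem sum_largeIndex {M : Type*} [AddCommMonoid M] (F : ℕ → M) :
    ∑ t : LargeIndex (diagEntry d A) δ, F (finProdFinEquiv t.1) =
      ∑ k ∈ Finset.range (d * d) with largeSet A δ k, F k := by
  rw [Finset.sum_filter, ← Fin.sum_univ_eq_sum_range (fun k => if largeSet A δ k then F k else 0),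
    ← Equiv.sum_comp finProdFinEquiv, ← Finset.sum_filter]
  exact (Finset.sum_subtype _ (by simp [largeSet, diagEntry])
    (fun t => F (finProdFinEquiv t))).symm

/-- The grid point number `c` as a vector with coordinates in `Γ`. -/
noncomputable def gridVec (X : ℕ) (d : ℕ) (A : ℕ → ℕ → ℂ) (δ : ℝ) (c : ℕ) :
    EuclideanSpace ℂ (LargeIndex (diagEntry d A) δ) :=
  WithLp.toLp 2 fun t => gridPoint X (largeSet A δ) c (finProdFinEquiv t.1)

theorem norm_gridVec_sq (X c : ℕ) :
    ‖gridVec X d A δ c‖ ^ 2 = gridSqNorm (d * d) X (largeSet A δ) c := by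
  classical
  rw [EuclideanSpace.norm_sq_eq, gridSqNorm]
  refine (sum_largeIndex fun k => ‖gridPoint X (largeSet A δ) c k‖ ^ 2).trans ?_
  rw [Finset.sum_filter]
  refine Finset.sum_congr rfl fun k _ => ?_
  split_ifs with h
  · rfl
  · simp [gridPoint, h]

-- The constant `√(2 |Γ|)` comes from `2 |Γ|` real coordinates, each off by at most one mesh.
open Classical in
theorem exists_gridVec (X : ℕ) {x : EuclideanSpace ℂ (LargeIndex (diagEntry d A) δ)}
    (hx : ‖x‖ ≤ 1) :
    ∃ c < gridSize X ^ (2 * Nat.count (largeSet A δ) (d * d)), ‖gridVec X d A δ c‖ ≤ ‖x‖ ∧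
      ‖x - gridVec X d A δ c‖ ≤
        √(2 * Nat.count (largeSet A δ) (d * d)) * (1 / (gridRadius X : ℝ)) := by
  let y : ℕ → ℂ := fun k => if h : k < d * d ∧ largeSet A δ k then
    x ⟨finProdFinEquiv.symm ⟨k, h.1⟩, by
      simpa only [largeSet, diagEntry, Equiv.apply_symm_apply] using h.2⟩ else 0
  have hy (t : LargeIndex (diagEntry d A) δ) : y (finProdFinEquiv t.1) = x t := by
    have h : (finProdFinEquiv t.1 : ℕ) < d * d ∧ largeSet A δ (finProdFinEquiv t.1) :=
      ⟨(finProdFinEquiv t.1).2, t.2⟩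
    simp only [y, dif_pos h, Fin.eta, Equiv.symm_apply_apply]
  obtain ⟨c, hc, h⟩ := exists_gridPoint X (d * d) (largeSet A δ) y fun k => by
    simp only [y]
    split_ifs
    · exact (PiLp.norm_apply_le x _).trans hx
    · simp
  refine ⟨c, hc, ?_, ?_⟩
  · refine (pow_le_pow_iff_left₀ (norm_nonneg _) (norm_nonneg _) two_ne_zero).1 ?_
    rw [EuclideanSpace.norm_sq_eq, EuclideanSpace.norm_sq_eq]
    refine Finset.sum_le_sum fun t _ => ?_
    have := (h (finProdFinEquiv t.1) (finProdFinEquiv t.1).2 t.2).1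
    rwa [hy] at this
  · refine (pow_le_pow_iff_left₀ (norm_nonneg _) (by positivity) two_ne_zero).1 ?_
    rw [EuclideanSpace.norm_sq_eq, mul_pow, Real.sq_sqrt (by positivity)]
    calc _ ≤ ∑ t : LargeIndex (diagEntry d A) δ, 2 * (1 / (gridRadius X : ℝ)) ^ 2 := by
          refine Finset.sum_le_sum fun t _ => ?_
          have := (h (finProdFinEquiv t.1) (finProdFinEquiv t.1).2 t.2).2
          rwa [hy] at this
      _ = _ := by
          rw [sum_largeIndex (fun _ => 2 * (1 / (gridRadius X : ℝ)) ^ 2), Finset.sum_const,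
            Nat.count_eq_card_filter_range, nsmul_eq_mul]
          ring

-- Each diagonal entry counted is at least `δ / 2`. As `A` is unitarily similar to the input, this
-- bounds the dimension of the ball to be searched.
open Classical in
theorem count_largeSet_mul_le (hδ : 0 ≤ δ) :
    Nat.count (largeSet A δ) (d * d) * (δ / 2) ^ 2 ≤ frobNorm (blockMat (d * d) A) ^ 2 := by
  rw [Nat.count_eq_card_filter_range, ← offSq_add_diag]
  calc _ = ∑ k ∈ Finset.range (d * d) with largeSet A δ k, (δ / 2) ^ 2 := by
        rw [Finset.sum_const, nsmul_eq_mul]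
    _ ≤ ∑ k ∈ Finset.range (d * d) with largeSet A δ k, ‖A k k‖ ^ 2 := by
        refine Finset.sum_le_sum fun k hk => pow_le_pow_left₀ (by positivity) ?_ 2
        exact (Finset.mem_filter.1 hk).2.trans (Complex.re_le_norm _)
    _ ≤ ∑ k ∈ Finset.range (d * d), ‖A k k‖ ^ 2 :=
        Finset.sum_le_sum_of_subset_of_nonneg (Finset.filter_subset _ _) fun _ _ _ => by positivity
    _ = ∑ k : Fin (d * d), ‖blockMat (d * d) A k k‖ ^ 2 :=
        (Fin.sum_univ_eq_sum_range (fun k => ‖A k k‖ ^ 2) _).symm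
    _ ≤ _ := le_add_of_nonneg_left (offSq_nonneg _)

theorem exists_orthonormalBasis_columns {ι : Type*} [Fintype ι] [DecidableEq ι]
    {V : Matrix ι ι ℂ} (hV : Vᴴ * V = 1) :
    ∃ Ψ : OrthonormalBasis ι ℂ (EuclideanSpace ℂ ι), ∀ t x, Ψ t x = V x t := by
  let f (t : ι) : EuclideanSpace ℂ ι := WithLp.toLp 2 fun x => V x t
  have hf : Orthonormal ℂ (Set.univ.domRestrict f) := by
    rw [orthonormal_iff_ite]
    rintro ⟨s, _⟩ ⟨t, _⟩
    have := congrFun (congrFun hV s) t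
    simpa [inner_eq_sum, f, Matrix.mul_apply, Matrix.one_apply] using this
  obtain ⟨Ψ, hΨ⟩ := hf.exists_orthonormalBasis_extension_of_card_eq (by simp)
  exact ⟨Ψ, fun t x => by rw [hΨ t trivial]⟩

/-- Conjugation by the unitary block of `U` preserves the norm and turns the error into the matrix
minus its real diagonal. -/
theorem frobNorm_sub_spectralSum_sq {Q : Matrix (Fin d × Fin d) (Fin d × Fin d) ℂ}
    (hQ : Q.IsHermitian) (hU : (blockMat (d * d) U)ᴴ * blockMat (d * d) U = 1)
    (hA : blockMat (d * d) A = (blockMat (d * d) U)ᴴ * flatten Q * blockMat (d * d) U)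
    {Ψ : OrthonormalBasis (Fin d × Fin d) ℂ (EuclideanSpace ℂ (Fin d × Fin d))}
    (hΨ : ∀ t x, Ψ t x = U (finProdFinEquiv x) (finProdFinEquiv t)) :
    frobNorm (Q - spectralSum Ψ (diagEntry d A)) ^ 2 = offSq (blockMat (d * d) A) := by
  set S := blockMat (d * d) U
  set B := blockMat (d * d) A with hB
  let D : Matrix (Fin (d * d)) (Fin (d * d)) ℂ := Matrix.diagonal fun k => ((A k k).re : ℂ)
  have hfQ : (flatten Q).IsHermitian := hQ.submatrix _
  have hBh : B.IsHermitian := by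
    rw [hA]
    exact Matrix.isHermitian_conjTranspose_mul_mul _ hfQ
  have hsp : flatten (spectralSum Ψ (diagEntry d A)) = S * D * Sᴴ := by
    ext x y
    rw [Matrix.mul_apply, flatten, Matrix.submatrix_apply, spectralSum, Matrix.of_apply,
      ← Equiv.sum_comp finProdFinEquiv]
    refine Finset.sum_congr rfl fun t _ => ?_
    simp only [hΨ, Equiv.apply_symm_apply, S, D, blockMat, diagEntry, Matrix.mul_diagonal,
      Matrix.conjTranspose_apply]
    ring
  have h1 : frobNorm (Q - spectralSum Ψ (diagEntry d A)) = frobNorm (B - D) := by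
    rw [← frobNorm_flatten, show flatten (Q - spectralSum Ψ (diagEntry d A)) =
      flatten Q - flatten (spectralSum Ψ (diagEntry d A)) from rfl, hsp,
      ← frobNorm_conj_unitary _ hU, hA, Matrix.mul_sub, Matrix.sub_mul]
    congr 2
    calc _ = (Sᴴ * S) * D * (Sᴴ * S) := by simp only [Matrix.mul_assoc]
      _ = D := by rw [hU, Matrix.one_mul, Matrix.mul_one]
  rw [h1, frobNorm_sq, offSq]
  refine Finset.sum_congr rfl fun i _ => Finset.sum_congr rfl fun j _ => ?_
  split_ifs with hij
  · subst hij
    have : B i i = ((A i i).re : ℂ) := (Complex.conj_eq_iff_re.1 (hBh.apply i i)).symm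
    simp [D, this]
  · simp [D, Matrix.diagonal_apply_ne _ hij]

theorem combMatrix_gridPoint_apply {X c : ℕ}
    {Ψ : OrthonormalBasis (Fin d × Fin d) ℂ (EuclideanSpace ℂ (Fin d × Fin d))}
    (hΨ : ∀ t x, Ψ t x = U (finProdFinEquiv x) (finProdFinEquiv t)) (i j : Fin d) :
    combMatrix d (gridPoint X (largeSet A δ) c) (fun t => (A t t).re) U i j =
      phiVec Ψ (diagEntry d A) δ (gridVec X d A δ c) (i, j) := by
  classical
  have h := sum_largeIndex (d := d) (A := A) (δ := δ) fun k =>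
    star (gridPoint X (largeSet A δ) c k) * (√(A k k).re : ℂ) * U (i * d + j) k
  rw [phiVec, combMatrix]
  simp only [WithLp.ofLp_sum, Finset.sum_apply, WithLp.ofLp_smul, Pi.smul_apply, smul_eq_mul, hΨ]
  refine Eq.trans ?_ (h.symm.trans (Finset.sum_congr rfl fun t _ => ?_))
  · rw [Finset.sum_filter]
    refine Finset.sum_congr rfl fun k _ => ?_
    split_ifs with hk
    · rfl
    · simp [gridPoint, hk]
  · simp only [gridVec, diagEntry, finProdFinEquiv_apply_val]
    rw [show (i : ℕ) * d + j = j + d * i by ring]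

end

/-! ### Correctness of the machine's output -/

theorem traceRoot_nonneg {d p : ℕ} (hp : 1 ≤ p) (Φ : Matrix (Fin d) (Fin d) ℂ) :
    0 ≤ traceRoot p Φ := by
  obtain ⟨p, rfl⟩ := Nat.exists_eq_add_of_le' hp
  rw [traceRoot, Function.iterate_succ_apply']
  exact Real.sqrt_nonneg _

theorem IsBallNet.mono {E : Type*} [NormedAddCommGroup E] {N : Finset E} {ε ε' : ℝ}
    (hN : IsBallNet N ε) (h : ε ≤ ε') : IsBallNet N ε' :=
  ⟨hN.1, fun x hx => let ⟨y, hy, hxy⟩ := hN.2 x hx; ⟨y, hy, hxy.trans h⟩⟩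

/-- The mesh of the grid against the accuracy demanded of the net. -/
theorem mesh_bounds {F δ η g M X : ℝ} (hF : 0 ≤ F) (hδ : 0 < δ) (hη0 : 0 ≤ η)
    (hη : η ≤ δ / 1024) (hg : g = 0 ∨ 1 ≤ g) (hgF : g * (δ / 2) ^ 2 ≤ F ^ 2)
    (hX : F ^ 2 / δ ^ 2 ≤ X) (hM : 32 * X ≤ M) :
    √(2 * g) * (1 / M) ≤ δ / (4 * F) ∧ 2 * (√(2 * g) * (1 / M)) * (F + 2 * η) ≤ δ / 3 := by
  rcases hg with rfl | hg
  · simp only [mul_zero, Real.sqrt_zero, zero_mul]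
    exact ⟨by positivity, by positivity⟩
  -- A nonempty `Γ` forces `F ≥ δ / 2`, which allows division by `F` and gives `η ≤ F / 512` below.
  have hF' : δ / 2 ≤ F := by
    refine (pow_le_pow_iff_left₀ (by positivity) hF two_ne_zero).1 (le_trans ?_ hgF)
    nlinarith [sq_nonneg (δ / 2)]
  have hF0 : 0 < F := (half_pos hδ).trans_le hF'
  -- From `2g ≤ 8 F² / δ²`, with 8 rounded up to 9.
  have h1 : √(2 * g) ≤ 3 * F / δ := by
    rw [Real.sqrt_le_left (by positivity), div_pow, le_div_iff₀ (by positivity)]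
    nlinarith
  have h2 : 1 / M ≤ δ ^ 2 / (32 * F ^ 2) := by
    rw [show δ ^ 2 / (32 * F ^ 2) = 1 / (32 * (F ^ 2 / δ ^ 2)) by field_simp]
    exact one_div_le_one_div_of_le (by positivity) (by linarith)
  have h3 : √(2 * g) * (1 / M) ≤ 3 * δ / (32 * F) := by
    have hX0 : 0 < X := lt_of_lt_of_le (by positivity) hX
    have hM0 : 0 < M := by linarith
    calc _ ≤ 3 * F / δ * (δ ^ 2 / (32 * F ^ 2)) := mul_le_mul h1 h2 (by positivity) (by positivity)
      _ = _ := by field_simp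
  refine ⟨h3.trans ?_, ?_⟩
  · rw [div_le_div_iff₀ (by positivity) (by positivity)]
    nlinarith [mul_pos hδ hF0]
  · calc _ ≤ 2 * (3 * δ / (32 * F)) * (F + 2 * (F / 512)) := by
          gcongr
          linarith
      _ = δ * (6 / 32 * (1 + 1 / 256)) := by field_simp; norm_num
      _ ≤ δ / 3 := by linarith

namespace SepProgram

theorem main_correct (k : ℕ) {d : ℕ} (hd : 1 ≤ d) {Q : Matrix (Fin d × Fin d) (Fin d × Fin d) ℂ}
    {δ : ℝ} (hQ : Q.PosSemidef) (hδ : 0 < δ) : let X := ⌈frobNorm Q ^ 2 / δ ^ 2⌉₊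
    ∃ g : ℕ, g * (δ / 2) ^ 2 ≤ frobNorm Q ^ 2 ∧
      ∀ L, d * d ≤ L → d ≤ L → 1 ≤ L → X ≤ L →
        d * d * (d * d) * (X + 2 * (d ^ k + 10)) ≤ L → d + X + 1 + (d ^ k + 10) ≤ L →
        gridSize X ^ (2 * g) ≤ L →
      ∃ T s, Exec (main k) (inputState Q δ) T s ∧ T ≤ mainTime k L ∧
        IsAlgorithmOutput Q δ (δ / 2 ^ d ^ k) (s.real 0) ∧ |s.real 0 - optSep Q| ≤ δ := by
  classical
  intro X
  obtain ⟨U, A, hU, hA, hmain⟩ := main_exec k Q hδ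
  set K := d ^ k + 10 with hK
  set F := frobNorm Q with hFd
  have hF0 : 0 ≤ F := frobNorm_nonneg _
  have hX : F ^ 2 / δ ^ 2 ≤ X := Nat.le_ceil _
  have hFX : F ^ 2 ≤ X * δ ^ 2 := (div_le_iff₀ (by positivity)).1 hX
  have hfQ : (flatten Q).IsHermitian := hQ.isHermitian.submatrix _
  obtain ⟨hun, hoff⟩ := offSq_iterate_jacobiSweep (Nat.mul_pos hd hd) hfQ (X + 2 * K)
  rw [← hU] at hun hoff
  rw [← hA, frobNorm_flatten] at hoff
  have hFA : frobNorm (blockMat (d * d) A) = F := by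
    rw [hA, frobNorm_conj_unitary _ hun, frobNorm_flatten]
  obtain ⟨Ψ₀, hΨ₀⟩ := exists_orthonormalBasis_columns (V := (blockMat (d * d) U).submatrix
    (finProdFinEquiv (m := d) (n := d)) finProdFinEquiv) (by
      rw [Matrix.conjTranspose_submatrix, Matrix.submatrix_mul_equiv, hun,
        Matrix.submatrix_one_equiv])
  obtain ⟨Ψ, hΨ⟩ : ∃ Ψ : OrthonormalBasis (Fin d × Fin d) ℂ (EuclideanSpace ℂ (Fin d × Fin d)),
    ∀ t x, Ψ t x = U (finProdFinEquiv x) (finProdFinEquiv t) := ⟨Ψ₀, hΨ₀⟩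
  -- The summand `X` in the exponent of the Jacobi method absorbs the ratio `‖Q‖_F² / δ² ≤ X ≤ 2^X`.
  have hη : frobNorm (Q - spectralSum Ψ (diagEntry d A)) ≤ δ / 2 ^ K := by
    refine (pow_le_pow_iff_left₀ (frobNorm_nonneg _) (by positivity) two_ne_zero).1 ?_
    rw [frobNorm_sub_spectralSum_sq hQ.isHermitian hun hA hΨ, div_pow, le_div_iff₀ (by positivity)]
    have h2 : (X : ℝ) ≤ 2 ^ X := by exact_mod_cast X.lt_two_pow_self.le
    have h3 : 2 ^ X * (offSq (blockMat (d * d) A) * (2 ^ K) ^ 2) ≤ 2 ^ X * δ ^ 2 := by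
      calc _ = 2 ^ (X + 2 * K) * offSq (blockMat (d * d) A) := by
            rw [pow_add 2 X (2 * K), pow_mul' 2 2 K]; ring
        _ ≤ F ^ 2 := hoff
        _ ≤ X * δ ^ 2 := hFX
        _ ≤ _ := by gcongr
    exact le_of_mul_le_mul_left h3 (by positivity)
  have hη1024 : δ / 2 ^ K ≤ δ / 1024 := by
    refine div_le_div_of_nonneg_left hδ.le (by norm_num) ?_
    calc (1024 : ℝ) = 2 ^ 10 := by norm_num
      _ ≤ 2 ^ K := pow_le_pow_right₀ (by norm_num) (by omega)
  have hηk : δ / 2 ^ K ≤ δ / 2 ^ d ^ k :=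
    div_le_div_of_nonneg_left hδ.le (by positivity) (pow_le_pow_right₀ (by norm_num) (by omega))
  set η := δ / 2 ^ K with hηd
  have hη0 : 0 ≤ η := by positivity
  set Γ := largeSet A δ with hΓ
  set g := Nat.count Γ (d * d) with hg
  have hgF : g * (δ / 2) ^ 2 ≤ F ^ 2 := by
    rw [← hFA]
    exact count_largeSet_mul_le hδ.le
  refine ⟨g, hgF, fun L h1 h2 h3 h4 h5 h6 h7 => ?_⟩
  obtain ⟨T, s, hex, hT, hval, hnn, hub⟩ := hmain _ rfl L h1 h2 h3 h4 h5 h6 h7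
  refine ⟨T, s, hex, hT, ?_⟩
  set p := d + X + 1 + K with hp
  set lam := diagEntry d A with hlam
  let N : Finset (EuclideanSpace ℂ (LargeIndex lam δ)) :=
    ((Finset.range (gridSize X ^ (2 * g))).filter fun c => gridSqNorm (d * d) X Γ c ≤ 1).image
      (gridVec X d A δ)
  let f (α : EuclideanSpace ℂ (LargeIndex lam δ)) : ℝ :=
    traceRoot p (Matrix.of fun i j => phiVec Ψ lam δ α (i, j))
  have hf (c : ℕ) : traceRoot p (combMatrix d (gridPoint X Γ c) (fun t => (A t t).re) U) =
      f (gridVec X d A δ c) := by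
    congr 1
    ext i j
    exact combMatrix_gridPoint_apply hΨ i j
  have hmemN {α} : α ∈ N ↔ ∃ c, (c < gridSize X ^ (2 * g) ∧ gridSqNorm (d * d) X Γ c ≤ 1) ∧
      gridVec X d A δ c = α := by
    simp [N]
  have hN : IsBallNet N (√(2 * g) * (1 / (gridRadius X : ℝ))) := by
    refine ⟨fun α hα => ?_, fun x hx => ?_⟩
    · obtain ⟨c, hc, rfl⟩ := hmemN.1 hα
      rw [← norm_gridVec_sq] at hc
      exact (sq_le_one_iff₀ (norm_nonneg _)).1 hc.2
    · obtain ⟨c, hc, hc1, hc2⟩ := exists_gridVec X hx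
      refine ⟨_, hmemN.2 ⟨c, ⟨hc, ?_⟩, rfl⟩, hc2⟩
      rw [← norm_gridVec_sq]
      exact pow_le_one₀ (norm_nonneg _) (hc1.trans hx)
  obtain ⟨hm1, hm2⟩ := mesh_bounds (M := gridRadius X) hF0 hδ hη0 hη1024
    (g := g) (by rcases Nat.eq_zero_or_pos g with h | h; exacts [.inl (by simp [h]), .inr (by exact_mod_cast h)])
    hgF hX (by simp [gridRadius])
  have hs : ∀ α ∈ N, ∃ m, IsLargestSchmidtCoeff (phiVec Ψ lam δ α) m ∧ |f α - m ^ 2| ≤ η := by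
    intro α hα
    obtain ⟨m, hm⟩ := exists_isLargestSchmidtCoeff hd (phiVec Ψ lam δ α)
    refine ⟨m, hm, (abs_traceRoot_sub_le hm (fun _ _ => rfl) p).trans ?_⟩
    have hm2 : m ^ 2 ≤ δ * (X + 1) := by
      have h := sq_schmidtCoeff_le hd hδ.le hQ hη (hN.1 α hα) hm
      -- `X` is a natural number, so `X ≤ X²` and `F² ≤ X δ² ≤ (X δ)²`.
      have hF : F ≤ δ * X := by
        refine (pow_le_pow_iff_left₀ hF0 (by positivity) two_ne_zero).1 (hFX.trans ?_)
        have : (X : ℝ) ≤ X ^ 2 := by exact_mod_cast Nat.le_self_pow two_ne_zero X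
        nlinarith [sq_nonneg δ]
      linarith [optSep_le_frobNorm hd hQ.isHermitian]
    have h2 : ((X : ℝ) + 1) * d ≤ 2 ^ (d + X + 1) := by
      have h3 : X + 1 ≤ 2 ^ (X + 1) := (X + 1).lt_two_pow_self.le
      have h4 : d ≤ 2 ^ d := d.lt_two_pow_self.le
      have := Nat.mul_le_mul h3 h4
      rw [← pow_add, show X + 1 + d = d + X + 1 by ring] at this
      exact_mod_cast this
    calc m ^ 2 * (d / 2 ^ p) ≤ δ * (X + 1) * (d / 2 ^ p) := by gcongr
      _ = δ * ((X + 1) * d) / (2 ^ (d + X + 1) * 2 ^ K) := by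
          rw [hp, pow_add 2 (d + X + 1) K]; ring
      _ ≤ δ * 2 ^ (d + X + 1) / (2 ^ (d + X + 1) * 2 ^ K) := by gcongr
      _ = η := by rw [hηd]; field_simp
  have hopt : IsGreatest (f '' (N : Set (EuclideanSpace ℂ (LargeIndex lam δ)))) (s.real 0) := by
    constructor
    · rcases hval with h0 | ⟨c, hc, hcv⟩
      · obtain ⟨α, hα, -⟩ := hN.2 0 (by simp)
        obtain ⟨c, hc, rfl⟩ := hmemN.1 hα
        refine ⟨_, hα, le_antisymm ?_ (h0.le.trans (traceRoot_nonneg (by omega) _))⟩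
        rw [← hf]
        exact hub c hc
      · exact ⟨_, hmemN.2 ⟨c, hc, rfl⟩, (hf c).symm.trans hcv⟩
    · rintro _ ⟨α, hα, rfl⟩
      obtain ⟨c, hc, rfl⟩ := hmemN.1 hα
      rw [← hf]
      exact hub c hc
  constructor
  · refine ⟨Ψ, lam, hη.trans hηk, N, f, hN.mono hm1, fun α hα => ?_, hopt⟩
    obtain ⟨m, hm, h⟩ := hs α hα
    exact ⟨m, hm, h.trans hηk⟩
  -- The lower bound loses `δ/2` for small eigenvalues, `δ/3` for the grid and `2η ≤ 2δ/1024` for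
  -- the linear algebra; the upper bound loses only `3η`.
  · have := output_bounds hd hδ.le hQ hη hN hs hopt hm2
    rw [abs_le]
    constructor <;> linarith

end SepProgram

/-! ## The running time -/

/-- From `log x ≥ 1 - 1/x` the product is at least `x² - x`. -/
theorem neg_quarter_le_sq_mul_log {x : ℝ} (hx : 0 ≤ x) : -(1 / 4) ≤ x ^ 2 * Real.log x := by
  rcases hx.eq_or_lt with rfl | hx
  · norm_num
  · have h := mul_le_mul_of_nonneg_left (Real.one_sub_inv_le_log_of_pos hx) (sq_nonneg x)
    have h2 : x ^ 2 * (1 - x⁻¹) = x ^ 2 - x := by field_simp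
    nlinarith [sq_nonneg (x - 1 / 2)]

/-- For `‖Q‖_F < δ` the logarithmic term is negative when `Q ≠ 0`; since `1/4 ≤ (2/5) log 2`, it
eats up at most two fifths of `log d`. -/
theorem three_fifths_mul_log_le {d : ℕ} (hd : 2 ≤ d) {x : ℝ} (hx : 0 ≤ x) :
    3 / 5 * Real.log d ≤ Real.log d + x ^ 2 * Real.log x := by
  have h1 : Real.log 2 ≤ Real.log d := Real.log_le_log two_pos (by exact_mod_cast hd)
  linarith [neg_quarter_le_sq_mul_log hx, Real.log_two_gt_d9]

/-- Here `x = ‖Q‖_F / δ`. For `x ≤ 2` the left-hand side is bounded by a constant, which `log d ≥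
log 2` pays for; for `x ≥ 2` it is of the order `x² log x`. -/
theorem net_exponent_le {d : ℕ} (hd : 2 ≤ d) {x g X : ℝ} (hx : 0 ≤ x)
    (hX0 : 0 ≤ X) (hg : g ≤ 4 * x ^ 2) (hX : X ≤ x ^ 2 + 1) :
    (2 * g + 1) * Real.log (64 * X + 3) ≤ 600 * (Real.log d + x ^ 2 * Real.log x) := by
  have hlogX : 0 ≤ Real.log (64 * X + 3) := Real.log_nonneg (by linarith)
  have h1 : Real.log 2 ≤ Real.log d := Real.log_le_log two_pos (by exact_mod_cast hd)
  have h2 := Real.log_two_gt_d9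
  have h3 : (2 * g + 1) * Real.log (64 * X + 3) ≤ (8 * x ^ 2 + 1) * Real.log (64 * x ^ 2 + 67) := by
    refine mul_le_mul (by linarith) (Real.log_le_log (by linarith) (by linarith)) hlogX
      (by positivity)
  refine h3.trans ?_
  rcases le_total x 2 with hx2 | hx2
  · have h4 : x ^ 2 ≤ 4 := by nlinarith
    have h5' : 0 ≤ Real.log (64 * x ^ 2 + 67) := Real.log_nonneg (by linarith [sq_nonneg x])
    have h5 : Real.log (64 * x ^ 2 + 67) ≤ 9 * Real.log 2 := by
      rw [← Real.log_rpow two_pos]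
      exact Real.log_le_log (by positivity) (by norm_num; linarith)
    have h6 := Real.log_two_lt_d9
    calc _ ≤ (8 * 4 + 1) * (9 * Real.log 2) := by gcongr
      _ ≤ _ := by linarith [three_fifths_mul_log_le hd hx]
  · have h4 : (4 : ℝ) ≤ x ^ 2 := by nlinarith
    have hlx : 0 ≤ Real.log x := Real.log_nonneg (by linarith)
    have h5 : Real.log (64 * x ^ 2 + 67) ≤ 9 * Real.log x := by
      rw [show 9 * Real.log x = Real.log (x ^ 9) by simp]
      refine Real.log_le_log (by positivity) ?_
      calc 64 * x ^ 2 + 67 ≤ 2 ^ 7 * x ^ 2 := by linarith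
        _ ≤ x ^ 7 * x ^ 2 := by gcongr
        _ = x ^ 9 := by ring
    calc _ ≤ (9 * x ^ 2) * (9 * Real.log x) := by 
          exact mul_le_mul (by linarith) h5 (Real.log_nonneg (by linarith)) (by positivity)
      _ ≤ _ := by nlinarith [mul_nonneg (sq_nonneg x) hlx]

namespace SepProgram

theorem mainTime_le (k : ℕ) : ∃ A D : ℕ, ∀ L, mainTime k L ≤ A * (L + 1) ^ D := by
  obtain ⟨A₁, D₁, h₁⟩ := readInput.time_le
  obtain ⟨A₂, D₂, h₂⟩ := (jacobi k).time_le
  obtain ⟨A₃, D₃, h₃⟩ := countGrid.time_le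
  obtain ⟨A₄, D₄, h₄⟩ := (search k).time_le
  set a := scaleTest.cost + 10
  set b := (CellExpr.get 18 0 0).raw.1.cost + 10 with hb
  refine ⟨A₁ + a + A₂ + A₃ + A₄ + b, D₁ + D₂ + D₃ + D₄ + 1, fun L => ?_⟩
  have hp {A i : ℕ} (hi : i ≤ D₁ + D₂ + D₃ + D₄ + 1) :
      A * (L + 1) ^ i ≤ A * (L + 1) ^ (D₁ + D₂ + D₃ + D₄ + 1) :=
    Nat.mul_le_mul_left _ (Nat.pow_le_pow_right (Nat.succ_pos _) hi)
  have e₁ := (h₁ L).trans (hp (by omega))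
  have e₂ := (h₂ L).trans (hp (by omega))
  have e₃ := (h₃ L).trans (hp (by omega))
  have e₄ := (h₄ L).trans (hp (by omega))
  have e₅ := hp (A := a) (i := 1) (by omega)
  have e₆ := hp (A := b) (i := 0) (by omega)
  rw [pow_one] at e₅
  rw [pow_zero, mul_one] at e₆
  have : mainTime k L = readInput.time L + a * (L + 1) + (jacobi k).time L + countGrid.time L +
    (search k).time L + b := rfl
  rw [this]
  clear_value a b
  linarith

/-- A common bound for the numbers of repetitions of the loops. -/
def loopBound (k d X g : ℕ) : ℕ :=
  d * d + d + 1 + X + d * d * (d * d) * (X + 2 * (d ^ k + 10)) + (d + X + 1 + (d ^ k + 10)) +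
    gridSize X ^ (2 * g)

/-- The terms polynomial in `d` and linear in `X` are absorbed by the power of `d` and by one extra
factor `64 X + 3`, hence the exponent `2 g + 1`. -/
theorem loopBound_succ_le {k d X g : ℕ} (hd : 2 ≤ d) :
    loopBound k d X g + 1 ≤ d ^ (k + 10) * (64 * X + 3) ^ (2 * g + 1) := by
  have hgs : gridSize X = 64 * X + 3 := by simp only [gridSize, gridRadius]; ring
  rw [loopBound, hgs]
  set Y := (64 * X + 3) ^ (2 * g) with hY
  have hY1 : 1 ≤ Y := Nat.one_le_pow _ _ (by omega)
  have hp {i : ℕ} (hi : i ≤ k + 4) : d ^ i ≤ d ^ (k + 4) := Nat.pow_le_pow_right (by omega) hi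
  set Z := d ^ (k + 4) with hZ
  have h0 : 1 ≤ Z := Nat.one_le_pow _ _ (by omega)
  have h1 : d ≤ Z := by simpa using hp (i := 1) (by omega)
  have h2 : d * d ≤ Z := by simpa [sq] using hp (i := 2) (by omega)
  have h4 : d * d * (d * d) ≤ Z := by
    rw [show d * d * (d * d) = d ^ 4 by ring]; exact hp (by omega)
  have hk : d ^ k ≤ Z := hp (by omega)
  have h5 : d * d * (d * d) * d ^ k = Z := by rw [hZ, pow_add]; ring
  -- Since `d ≥ 2`, six powers of `d` cover the constant 64.
  have h6 : 64 * Z ≤ d ^ (k + 10) := by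
    rw [show k + 10 = 6 + (k + 4) by ring, pow_add _ 6]
    exact Nat.mul_le_mul_right _ (Nat.pow_le_pow_left hd 6)
  calc _ ≤ 64 * Z * ((64 * X + 3) * Y) := by
        rw [mul_add (d * d * (d * d)), mul_add 2, mul_add (d * d * (d * d)),
          mul_left_comm (d * d * (d * d)) 2, h5]
        have a1 : d * d * (d * d) * X ≤ Z * X := Nat.mul_le_mul_right _ h4
        have a2 : X ≤ Z * X := Nat.le_mul_of_pos_left _ h0
        have a3 : Y ≤ Z * Y := Nat.le_mul_of_pos_left _ h0
        have a4 : Z ≤ Z * Y := Nat.le_mul_of_pos_right _ hY1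
        have a5 : Z * X ≤ Z * X * Y := Nat.le_mul_of_pos_right _ hY1
        have a6 : 64 * Z * ((64 * X + 3) * Y) = 4096 * (Z * X * Y) + 192 * (Z * Y) := by ring
        rw [a6]
        omega
    _ ≤ d ^ (k + 10) * (64 * X + 3) ^ (2 * g + 1) := by
        rw [pow_succ (64 * X + 3), mul_comm ((64 * X + 3) ^ (2 * g))]
        exact Nat.mul_le_mul_right _ h6

/-- The exponent `Λ` satisfies `log d ≤ 2Λ` and `1 ≤ 3Λ`. The first gives `(k + 10) log d ≤ (2k +
20) Λ`, which with 600 for the net makes `2k + 620`; the second absorbs the constant factor `A ≤ exp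
A`. -/
theorem exists_time_le (k : ℕ) : ∃ C : ℝ, 0 < C ∧ ∀ (d : ℕ), 2 ≤ d → ∀ (x : ℝ) (X g : ℕ), 0 ≤ x →
    (g : ℝ) ≤ 4 * x ^ 2 → (X : ℝ) ≤ x ^ 2 + 1 →
      (mainTime k (loopBound k d X g) : ℝ) ≤
        Real.exp (C * (Real.log d + x ^ 2 * Real.log x)) := by
  obtain ⟨A, D, h⟩ := mainTime_le k
  refine ⟨3 * A + D * (2 * k + 620) + 1, by positivity, fun d hd x X g hx hg hX => ?_⟩
  have hΛ := three_fifths_mul_log_le hd hx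
  have hnet := net_exponent_le hd hx X.cast_nonneg hg hX
  set Λ := Real.log d + x ^ 2 * Real.log x
  have hlogd : Real.log 2 ≤ Real.log d := Real.log_le_log two_pos (by exact_mod_cast hd)
  have hlog2 := Real.log_two_gt_d9
  have hL : ((loopBound k d X g + 1 : ℕ) : ℝ) ≤ Real.exp ((2 * k + 620) * Λ) := by
    refine (Nat.cast_le.2 (loopBound_succ_le hd)).trans ?_
    have hd0 : (0 : ℝ) < d := by exact_mod_cast (by omega : 0 < d)
    rw [← Real.log_le_iff_le_exp (by positivity)]
    push_cast
    rw [Real.log_mul (by positivity) (by positivity), Real.log_pow, Real.log_pow]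
    push_cast
    have : ((k : ℝ) + 10) * Real.log d ≤ (k + 10) * (2 * Λ) := by gcongr; linarith
    linarith
  have hA : (A : ℝ) ≤ Real.exp (3 * A * Λ) := by
    have h1 : (A : ℝ) ≤ Real.exp A := by linarith [Real.add_one_le_exp (A : ℝ)]
    refine h1.trans (Real.exp_le_exp.2 ?_)
    nlinarith [(Nat.cast_nonneg A : (0 : ℝ) ≤ A)]
  calc (mainTime k (loopBound k d X g) : ℝ)
      ≤ A * ((loopBound k d X g + 1 : ℕ) : ℝ) ^ D := by exact_mod_cast h _
    _ ≤ Real.exp (3 * A * Λ) * Real.exp ((2 * k + 620) * Λ) ^ D := by gcongr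
    _ = Real.exp ((3 * A + D * (2 * k + 620)) * Λ) := by
        rw [← Real.exp_nat_mul, ← Real.exp_add]
        ring_nf
    _ ≤ _ := Real.exp_le_exp.2 (by linarith)

end SepProgram
theorem theorem6p1 :
    -- the maximum that defines `OptSep(Q)` is attained, and with exact linear algebra the
    -- algorithm has an output and every output is within `δ` of `OptSep(Q)`
    (∀ (d : ℕ), 1 ≤ d → ∀ (Q : Matrix (Fin d × Fin d) (Fin d × Fin d) ℂ) (δ : ℝ),
      Q.PosSemidef → 0 < δ →
        IsGreatest (sepValues Q) (optSep Q) ∧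
        (∃ opt : ℝ, IsAlgorithmOutput Q δ 0 opt) ∧
        ∀ opt : ℝ, IsAlgorithmOutput Q δ 0 opt → |opt - optSep Q| ≤ δ) ∧
    -- the running time: one program serves all `d`, `Q`, `δ`
    (∀ k : ℕ, ∃ (P : RamProgram) (C : ℝ), 0 < C ∧
      ∀ (d : ℕ), 2 ≤ d → ∀ (Q : Matrix (Fin d × Fin d) (Fin d × Fin d) ℂ) (δ : ℝ),
        Q.PosSemidef → 0 < δ →
          ∃ (T : ℕ) (s : RamState), Exec P (inputState Q δ) T s ∧
            (T : ℝ) ≤ Real.exp (C * (Real.log d +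
              δ⁻¹ ^ 2 * frobNorm Q ^ 2 * Real.log (frobNorm Q / δ))) ∧
            IsAlgorithmOutput Q δ (δ / 2 ^ d ^ k) (s.real 0) ∧
            |s.real 0 - optSep Q| ≤ δ) := by
  refine ⟨fun d hd Q δ hQ hδ => ⟨isGreatest_optSep hd hQ.isHermitian,
    exists_isAlgorithmOutput hd hQ hδ, fun opt h => abs_sub_optSep_le hd hQ hδ h⟩, fun k => ?_⟩
  obtain ⟨C, hC, hT⟩ := SepProgram.exists_time_le k
  refine ⟨SepProgram.main k, C, hC, fun d hd Q δ hQ hδ => ?_⟩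
  obtain ⟨g, hg, h⟩ := SepProgram.main_correct k (by omega) hQ hδ
  set X := ⌈frobNorm Q ^ 2 / δ ^ 2⌉₊
  obtain ⟨T, s, hex, hTs, hout⟩ := h (SepProgram.loopBound k d X g)
    (by rw [SepProgram.loopBound]; omega) (by rw [SepProgram.loopBound]; omega)
    (by rw [SepProgram.loopBound]; omega) (by rw [SepProgram.loopBound]; omega)
    (by rw [SepProgram.loopBound]; omega) (by rw [SepProgram.loopBound]; omega)
    (by rw [SepProgram.loopBound]; omega)
  refine ⟨T, s, hex, (Nat.cast_le.2 hTs).trans ?_, hout⟩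
  have hx : δ⁻¹ ^ 2 * frobNorm Q ^ 2 = (frobNorm Q / δ) ^ 2 := by
    rw [div_eq_inv_mul, mul_pow]
  rw [hx]
  refine hT d hd (frobNorm Q / δ) X g (div_nonneg (frobNorm_nonneg _) hδ.le) ?_ ?_
  · rw [div_pow, ← mul_div_assoc, le_div_iff₀ (by positivity)]
    linarith
  · rw [div_pow]
    exact (Nat.ceil_lt_add_one (by positivity)).le
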